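/- Setting. Let $W_t(u)=X_t(u)+e_t(u)$, $u\in[0,1]$, $t\in\mathbb Z$, be measurable random curves, where the signal $X_t$ and the noise $e_t$ are pointwise square integrable with mean zero, $\operatorname{Cov}\{e_t(u),e_{t'}(v)\}=0$ for $t\ne t'$, and $\operatorname{Cov}\{X_t(u),e_{t'}(v)\}=0$ for all $t,t',u,v$. Let $Y_t$ be real square-integrable responses. Put $C_k(u,v)=\operatorname{Cov}\{X_t(u),X_{t+k}(v)\}$ and $S_k(u)=\operatorname{Cov}\{Y_t,W_{t+k}(u)\}$ (these do not depend on $t$). For sample size $n$ one observes $Y_t$, $U_{ti}$ and $Z_{ti}=W_t(U_{ti})+\eta_{ti}$ for $1\le i\le m_t$, $1\le t\le n$. The $\psi$-mixing coefficients of a sequence are $\psi(l)=\sup|1-P(B\mid A)/P(B)|$, the supremum over events $A$ generated by the sequence up to time $0$ and $B$ generated by it from time $l$ on, with $P(A)P(B)>0$. Assumptions. Let $s>2$ and $\lambda>(3s-2)/(s-2)$. (1) $\{W_t\}$ is strictly stationary with $\psi(l)\le c\,l^{-\lambda}$ for all $l\ge1$ and some constant $c$, and $\sup_{u}E|W_t(u)|^{2s}<\infty$.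 For the statement on $\widetilde S_k$, the joint sequence $\{(W_t,Y_t)\}$ is strictly stationary with $\psi$-mixing coefficients bounded in the same way. (2) The $\eta_{ti}$ are i.i.d. over all $(t,i)$ with mean zero and $E|\eta_{ti}|^{2s}<\infty$. The $U_{ti}$ are i.i.d. over all $(t,i)$ with a twice continuously differentiable density on $[0,1]$ that is bounded from above and away from zero. (3) For each $n$ the counts $m_t=m_{n,t}$ are independent over $t$, and $m_t/\rho_n$, with $\rho_n>0$, is distributed as a variable $\check m$ with values in $\{1,\dots,\bar m\}$, $P(\check m>1)>0$, whose law does not depend on $n$ and $t$. (4) The families $\{W_t\}$, $\{U_{ti}\}$, $\{\eta_{ti}\}$ and, for each $n$, $\{m_{n,t}\}$ are mutually independent; for the statement on $\widetilde S_k$ the same holds with $\{(W_t,Y_t)\}$ in place of $\{W_t\}$. (5) $K:\mathbb R\to[0,\infty)$ is a symmetric Lipschitz continuous probability density vanishing outside $[-1,1]$. (6) For the lag $k$ considered, $C_k$ is twice continuously differentiable on $[0,1]^2$ (for $\widetilde C_k$) and $S_k$ is twice continuously differentiable on $[0,1]$ (for $\widetilde S_k$). (7) The bandwidths $h_C=h_{C,n}>0$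 (for $\widetilde C_k$) and $h_S=h_{S,n}>0$ (for $\widetilde S_k$) satisfy $h_C\to0$, $h_S\to0$, $\dfrac{\log(n\rho_n^2)}{(n\rho_n^2)^{\theta_C}h_C^2}\to0$ and $\dfrac{\log(n\rho_n)}{(n\rho_n)^{\theta_S}h_S}\to0$, where $$\theta_C=\frac{\lambda-2-(1+\lambda)/(s-1)}{\lambda+2-(1+\lambda)/(s-1)},\qquad \theta_S=\frac{\lambda-3-(1+\lambda)/(s-1)}{\lambda+1-(1+\lambda)/(s-1)}.$$ Estimators. Fix integers $1\le k\le L$. For every $u,v\in[0,1]$ let $\widetilde C_k(u,v)=\widehat a_0$, where $(\widehat a_0,\widehat a_1,\widehat a_2)$ is any minimizer of $$\sum_{t=1}^{n-L}\sum_{i=1}^{m_t}\sum_{j=1}^{m_{t+k}}\bigl\{Z_{ti}Z_{(t+k)j}-a_0-a_1(U_{ti}-u)-a_2(U_{(t+k)j}-v)\bigr\}^2K\Bigl(\frac{U_{ti}-u}{h_C}\Bigr)K\Bigl(\frac{U_{(t+k)j}-v}{h_C}\Bigr),$$ and let $\widetilde S_k(u)=\widehat b_0$, where $(\widehat b_0,\widehat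 b_1)$ is any minimizer of $$\sum_{t=1}^{n-L}\sum_{i=1}^{m_{t+k}}\bigl\{Y_tZ_{(t+k)i}-b_0-b_1(U_{(t+k)i}-u)\bigr\}^2K\Bigl(\frac{U_{(t+k)i}-u}{h_S}\Bigr).$$ Conclusion. As $n\to\infty$, with $\|\cdot\|_{\mathcal S}$ the Hilbert--Schmidt norm, i.e. the $L^2([0,1]^2)$ norm of the kernel, and $\|\cdot\|$ the $L^2([0,1])$ norm, $$\|\widetilde C_k-C_k\|_{\mathcal S}=O_P\Bigl(\frac1{\sqrt{n\rho_n^2h_C^2}}+\frac1{\sqrt n}+h_C^2\Bigr),\qquad \|\widetilde S_k-S_k\|=O_P\Bigl(\frac1{\sqrt{n\rho_nh_S}}+\frac1{\sqrt n}+h_S^2\Bigr).$$ -/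

import Mathlib

open MeasureTheory ProbabilityTheory Filter Topology Set
open scoped unitInterval ENNReal NNReal

noncomputable section

namespace PartialCurve

/-! ### Stationarity and ψ-mixing of a sequence of random elements indexed by `ℤ`

A random curve on `[0,1]` is a random element of `I → ℝ` with its product σ-algebra, so the
σ-algebra generated by a curve is the one generated by all its values. -/

section Sequence

variable {Ω : Type*} {E : Type*} [MeasurableSpace E]

/-- Strict stationarity: the law of the whole sequence is invariant under time shifts. -/
def StrictlyStationary [MeasurableSpace Ω] (P : Measure Ω) (V : ℤ → Ω → E) : Prop :=
  ∀ h : ℤ, P.map (fun ω (t : ℤ) => V (t + h) ω) = P.map (fun ω (t : ℤ) => V t ω)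

/-- The σ-algebra generated by `V t`, `t ≤ 0`. -/
def pastSigma (V : ℤ → Ω → E) : MeasurableSpace Ω :=
  ⨆ t : {t : ℤ // t ≤ 0}, MeasurableSpace.comap (V t.1) inferInstance

/-- The σ-algebra generated by `V t`, `t ≥ l`. -/
def futureSigma (V : ℤ → Ω → E) (l : ℤ) : MeasurableSpace Ω :=
  ⨆ t : {t : ℤ // l ≤ t}, MeasurableSpace.comap (V t.1) inferInstance

/-- The ψ-mixing coefficient
`ψ(l) = sup |1 - P(B | A) / P(B)|` over `A` in the past up to time `0`, `B` in the future from
time `l`, with `P(A) P(B) > 0`; a value in `[0, ∞]`. -/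
def psiMixing [MeasurableSpace Ω] (P : Measure Ω) (V : ℤ → Ω → E) (l : ℕ) : ℝ≥0∞ :=
  ⨆ (A : Set Ω) (B : Set Ω) (_ : MeasurableSet[pastSigma V] A)
    (_ : MeasurableSet[futureSigma V l] B) (_ : 0 < P A * P B),
    ENNReal.ofReal |1 - (ProbabilityTheory.cond P A).real B / P.real B|

/-- A strictly stationary sequence with `ψ(l) ≤ c l^{-lam}` for all `l ≥ 1`. -/
structure IsMixingSequence [MeasurableSpace Ω] (P : Measure Ω) (V : ℤ → Ω → E) (lam : ℝ) :
    Prop where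
  measurable : ∀ t, Measurable (V t)
  stationary : StrictlyStationary P V
  mixing : ∃ c : ℝ, ∀ l : ℕ, 1 ≤ l → psiMixing P V l ≤ ENNReal.ofReal (c * (l : ℝ) ^ (-lam))

end Sequence

section Model

variable {Ω : Type*} [MeasurableSpace Ω]

/-- The error contamination model `W_t(u) = X_t(u) + e_t(u)`, `u ∈ [0,1]`: centred signal `X`,
centred white noise `e`, uncorrelated with each other at all times. -/
structure ContaminationModel (P : Measure Ω) (W X e : ℤ → Ω → I → ℝ) : Prop where
  decomp : ∀ t ω u, W t ω u = X t ω u + e t ω u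
  memLp_X : ∀ t u, MemLp (fun ω => X t ω u) 2 P
  memLp_e : ∀ t u, MemLp (fun ω => e t ω u) 2 P
  mean_X : ∀ t u, ∫ ω, X t ω u ∂P = 0
  mean_e : ∀ t u, ∫ ω, e t ω u ∂P = 0
  white : ∀ s t, s ≠ t → ∀ u v, covariance (fun ω => e s ω u) (fun ω => e t ω v) P = 0
  uncorrelated : ∀ s t u v, covariance (fun ω => X s ω u) (fun ω => e t ω v) P = 0

/-- Each curve is a measurable process: `(ω, u) ↦ W_t(u)` is jointly measurable, where `Ω`
carries the σ-algebra generated by the values of `W_t`.  This is what makes `W_t(U_{ti})` a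
random variable determined by the curve and the location. -/
def MeasurableCurves (W : ℤ → Ω → I → ℝ) : Prop :=
  ∀ t, @Measurable (Ω × I) ℝ
    (@Prod.instMeasurableSpace Ω I (MeasurableSpace.comap (W t) inferInstance) inferInstance)
    inferInstance (fun p => W t p.1 p.2)

/-- `sup_u E|W_t(u)|^q < ∞`. -/
def BoundedMoments (P : Measure Ω) (W : ℤ → Ω → I → ℝ) (q : ℝ) : Prop :=
  ∃ M : ℝ≥0, ∀ t u, ∫⁻ ω, ‖W t ω u‖ₑ ^ q ∂P ≤ M

/-- Measurement errors: i.i.d. over all `(t, i)`, mean zero, `E|η_{ti}|^q < ∞`. -/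
structure IsMeasurementError (P : Measure Ω) (η : ℤ → ℕ → Ω → ℝ) (q : ℝ) : Prop where
  measurable : ∀ t i, Measurable (η t i)
  indep : iIndepFun (fun p : ℤ × ℕ => η p.1 p.2) P
  identDistrib : ∀ t i t' i', IdentDistrib (η t i) (η t' i') P P
  mean : ∀ t i, ∫ ω, η t i ω ∂P = 0
  moment : ∀ t i, MemLp (η t i) (ENNReal.ofReal q) P

/-- Measurement locations: i.i.d. over all `(t, i)`, with a density on `[0,1]` that is twice
continuously differentiable and bounded from above and away from zero. -/
structure IsLocationDesign (P : Measure Ω) (U : ℤ → ℕ → Ω → I) : Prop where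
  measurable : ∀ t i, Measurable (U t i)
  indep : iIndepFun (fun p : ℤ × ℕ => U p.1 p.2) P
  density : ∃ f : ℝ → ℝ, ContDiffOn ℝ 2 f (Icc 0 1) ∧
    (∃ a b : ℝ, 0 < a ∧ ∀ x ∈ Icc (0 : ℝ) 1, a ≤ f x ∧ f x ≤ b) ∧
    ∀ t i, P.map (fun ω => (U t i ω : ℝ)) =
      (volume.restrict (Icc (0 : ℝ) 1)).withDensity (fun x => ENNReal.ofReal (f x))

/-- Numbers of measurements: for every sample size `n` the `m_t` are independent and `m_t / ρ_n`
is distributed as a fixed variable with values in `{1, …, mbar}` which exceeds `1` with positive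
probability. -/
structure IsCountDesign (P : Measure Ω) (m : ℕ → ℤ → Ω → ℕ) (ρ : ℕ → ℝ) : Prop where
  measurable : ∀ n t, Measurable (m n t)
  pos : ∀ n, 0 < ρ n
  indep : ∀ n, iIndepFun (fun t => m n t) P
  law : ∃ (mc : Ω → ℕ) (mbar : ℕ), Measurable mc ∧ (∀ ω, 1 ≤ mc ω ∧ mc ω ≤ mbar) ∧
    0 < P {ω | 1 < mc ω} ∧
    ∀ n t, IdentDistrib (fun ω => (m n t ω : ℝ) / ρ n) (fun ω => (mc ω : ℝ)) P P

/-- The latent sequence `V`, the locations, the errors and (for every sample size) the numbers of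
measurements are mutually independent. -/
structure IsIndependentDesign {E : Type*} [MeasurableSpace E] (P : Measure Ω) (V : ℤ → Ω → E)
    (U : ℤ → ℕ → Ω → I) (η : ℤ → ℕ → Ω → ℝ) (m : ℕ → ℤ → Ω → ℕ) : Prop where
  locations : IndepFun (fun ω (t : ℤ) (i : ℕ) => U t i ω) (fun ω (t : ℤ) => V t ω) P
  errors : IndepFun (fun ω (t : ℤ) (i : ℕ) => η t i ω)
    (fun ω => ((fun t : ℤ => V t ω), (fun (t : ℤ) (i : ℕ) => U t i ω))) P
  counts : ∀ n, IndepFun (fun ω (t : ℤ) => m n t ω)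
    (fun ω => ((fun t : ℤ => V t ω), (fun (t : ℤ) (i : ℕ) => U t i ω),
      (fun (t : ℤ) (i : ℕ) => η t i ω))) P

/-- The observed value at the `i`-th location of the `t`-th curve,
`Z_{ti} = W_t(U_{ti}) + η_{ti}`. -/
def obs (W : ℤ → Ω → I → ℝ) (U : ℤ → ℕ → Ω → I) (η : ℤ → ℕ → Ω → ℝ) (ω : Ω) (t : ℤ) (i : ℕ) :
    ℝ :=
  W t ω (U t i ω) + η t i ω

/-- The lag-`k` autocovariance `Cov(X_t(u), X_{t+k}(v))` of the signal (read at `t = 0`). -/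
def autocov (P : Measure Ω) (X : ℤ → Ω → I → ℝ) (k : ℕ) (u v : I) : ℝ :=
  covariance (fun ω => X 0 ω u) (fun ω => X (k : ℤ) ω v) P

/-- The lag-`k` cross-covariance `Cov(Y_t, W_{t+k}(u))` (read at `t = 0`). -/
def crosscov (P : Measure Ω) (Y : ℤ → Ω → ℝ) (W : ℤ → Ω → I → ℝ) (k : ℕ) (u : I) : ℝ :=
  covariance (Y 0) (fun ω => W (k : ℤ) ω u) P

/-- `R_n = O_P(δ_n)` for `[0, ∞]`-valued `R_n`: for every `ε > 0` there is `M` with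
`P(R_n > M δ_n) ≤ ε` for all large `n`. -/
def IsBigOInProb (P : Measure Ω) (R : ℕ → Ω → ℝ≥0∞) (δ : ℕ → ℝ) : Prop :=
  ∀ ε : ℝ, 0 < ε → ∃ M : ℝ, 0 < M ∧
    ∀ᶠ n in atTop, P {ω | ENNReal.ofReal (M * δ n) < R n ω} ≤ ENNReal.ofReal ε

end Model

/-- A symmetric, Lipschitz continuous probability density on `[-1, 1]`, extended by zero. -/
structure IsSmoothingKernel (K : ℝ → ℝ) : Prop where
  nonneg : ∀ x, 0 ≤ K x
  symm : ∀ x, K (-x) = K x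
  support : ∀ x, 1 < |x| → K x = 0
  integral : ∫ x, K x = 1
  lipschitz : ∃ c : ℝ≥0, LipschitzWith c K

/-- A function on `[0,1]` is twice continuously differentiable up to the boundary. -/
def IsC2 (g : I → ℝ) : Prop :=
  ContDiffOn ℝ 2 (fun x : ℝ => g (projIcc 0 1 zero_le_one x)) (Icc 0 1)

/-- A function on `[0,1]²` is twice continuously differentiable up to the boundary; on a compact
square this says that the second-order partial derivatives exist and are uniformly continuous
and bounded. -/
def IsC2Square (g : I → I → ℝ) : Prop :=
  ContDiffOn ℝ 2
    (fun p : ℝ × ℝ => g (projIcc 0 1 zero_le_one p.1) (projIcc 0 1 zero_le_one p.2))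
    (Icc 0 1 ×ˢ Icc 0 1)

/-- The local linear surface criterion at `(u, v)`.  The arguments `m t`, `U t i`, `Z t i` are the
realized data; the locations of curve `t` are numbered `i = 0, …, m t - 1`. -/
def surfaceLoss (K : ℝ → ℝ) (h : ℝ) (L k n : ℕ) (m : ℤ → ℕ) (U : ℤ → ℕ → I) (Z : ℤ → ℕ → ℝ)
    (u v : I) (a₀ a₁ a₂ : ℝ) : ℝ :=
  ∑ t ∈ Finset.Icc (1 : ℤ) ((n : ℤ) - L), ∑ i ∈ Finset.range (m t),
    ∑ j ∈ Finset.range (m (t + k)),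
      (Z t i * Z (t + k) j - a₀ - a₁ * ((U t i : ℝ) - u) - a₂ * ((U (t + k) j : ℝ) - v)) ^ 2 *
        (K (((U t i : ℝ) - u) / h) * K (((U (t + k) j : ℝ) - v) / h))

/-- `c` is the intercept of a minimizer of the local linear surface criterion at `(u, v)`. -/
def IsSurfaceFit (K : ℝ → ℝ) (h : ℝ) (L k n : ℕ) (m : ℤ → ℕ) (U : ℤ → ℕ → I) (Z : ℤ → ℕ → ℝ)
    (u v : I) (c : ℝ) : Prop :=
  ∃ a₁ a₂ : ℝ, ∀ b₀ b₁ b₂ : ℝ,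
    surfaceLoss K h L k n m U Z u v c a₁ a₂ ≤ surfaceLoss K h L k n m U Z u v b₀ b₁ b₂

/-- The local linear criterion at `u` for the responses `y t`; the locations, the weights and the
noisy curve values are those of curve `t + k`. -/
def lineLoss (K : ℝ → ℝ) (h : ℝ) (L k n : ℕ) (m : ℤ → ℕ) (U : ℤ → ℕ → I) (Z : ℤ → ℕ → ℝ)
    (y : ℤ → ℝ) (u : I) (b₀ b₁ : ℝ) : ℝ :=
  ∑ t ∈ Finset.Icc (1 : ℤ) ((n : ℤ) - L), ∑ i ∈ Finset.range (m (t + k)),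
    (y t * Z (t + k) i - b₀ - b₁ * ((U (t + k) i : ℝ) - u)) ^ 2 *
      K (((U (t + k) i : ℝ) - u) / h)

/-- `c` is the intercept of a minimizer of the local linear criterion at `u`. -/
def IsLineFit (K : ℝ → ℝ) (h : ℝ) (L k n : ℕ) (m : ℤ → ℕ) (U : ℤ → ℕ → I) (Z : ℤ → ℕ → ℝ)
    (y : ℤ → ℝ) (u : I) (c : ℝ) : Prop :=
  ∃ a₁ : ℝ, ∀ b₀ b₁ : ℝ,
    lineLoss K h L k n m U Z y u c a₁ ≤ lineLoss K h L k n m U Z y u b₀ b₁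

/-- The exponent in the condition on the bandwidth of the surface smoother. -/
def thetaC (s lam : ℝ) : ℝ :=
  (lam - 2 - (1 + lam) / (s - 1)) / (lam + 2 - (1 + lam) / (s - 1))

/-- The exponent in the condition on the bandwidth of the one-dimensional smoother. -/
def thetaS (s lam : ℝ) : ℝ :=
  (lam - 3 - (1 + lam) / (s - 1)) / (lam + 1 - (1 + lam) / (s - 1))

/-- The rate `(n ρ_n² h_n²)^{-1/2} + n^{-1/2} + h_n²`. -/
def rateC (ρ h : ℕ → ℝ) (n : ℕ) : ℝ :=
  1 / √(n * ρ n ^ 2 * h n ^ 2) + 1 / √(n : ℝ) + h n ^ 2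

/-- The rate `(n ρ_n h_n)^{-1/2} + n^{-1/2} + h_n²`. -/
def rateS (ρ h : ℕ → ℝ) (n : ℕ) : ℝ :=
  1 / √(n * ρ n * h n) + 1 / √(n : ℝ) + h n ^ 2

end PartialCurve

end

noncomputable section

set_option linter.unusedSectionVars false

namespace PartialCurve

/-! ### Lower tails of sums of nonnegative variables -/

/-! The error is bounded in mean square at each fixed point `(u, v)` and only then integrated. An L²
norm needs no uniform control of the noise, so Tonelli and Markov (`isBigOInProb_of_lintegral_le`)
take the place of exponential inequalities for dependent data. Uniformity in `(u, v)` is needed only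
for the design, whose locations are independent, and there a Bernstein bound works.

Deterministic part. A local linear fit differs from the Taylor polynomial of the target by weighted
noise sums divided by a lower bound `c` of the design quadratic form, plus a bias coming from
remainders of order `h²` (`leastSquares_error`). For `c`, cut `[0,1]` into cells of mesh `δ h`.
Every smoothing window, also at the boundary, contains two separated cells on which the kernel is
bounded below (`exists_cells`), and an affine function that is small at one point of each of three
cell products forming an L has small coefficients (`surface_design_bound`). Hence `c` is of order `n
ρ² h²` (of order `n ρ h` for the line) at all points simultaneously once every pair of cells (every
cell) receives that many pairs of locations (that many locations).

Design part. The bandwidth condition makes the number of cells at most polynomial in `n ρ²` or `n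
ρ`, whereas the probability that a given cell is hit too rarely is exponentially small in a power of
the same quantity (`pair_lower_tail_min`, `surface_tail_le`, `tendsto_line_tail`), so a union bound
suffices. Of the exponents `thetaC` and `thetaS` only the fact that they are less than one enters.

Noise part. The noise is the product of two readings minus its mean given the locations. The design
is independent of the curves and the errors, so it may be frozen and the weights become constants.
ψ-mixing is a relative notion of dependence: `|E fg - E f E g| ≤ c l^{-lam} E|f| E|g|`
(`RelIndep.abs_sub_le`). Second moments of the curves therefore suffice both for square
integrability of lagged products and for covariances that decay like `l^{-lam}` and are summable.
With `y = ρ² h²` or `y = ρ h`, the noise sums have second moment of order `n (y + y²)`, and division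
by `(n y)²` leaves `1 / (n y) + 1 / n`. The bias adds `h⁴`, and these are dominated by the square of
the claimed rate. -/

lemma exp_neg_le_quadratic {y : ℝ} (hy : 0 ≤ y) : Real.exp (-y) ≤ 1 - y + y ^ 2 / 2 := by
  have h1 := Real.quadratic_le_exp_of_nonneg hy
  rw [Real.exp_neg]
  have h2 : 0 < 1 + y + y ^ 2 / 2 := by positivity
  refine (inv_anti₀ h2 h1).trans ?_
  rw [inv_le_iff_one_le_mul₀ h2]
  -- The product of `1 + y + y²/2` and `1 - y + y²/2` is `1 + y⁴/4`.
  nlinarith [sq_nonneg (y ^ 2)]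

/-- One-sided Bernstein inequality: the lower tail of a sum of nonnegative variables whose moment
generating functions multiply is controlled by the first two moments. -/
lemma lower_tail {Ω ι : Type*} [MeasurableSpace Ω] (P : Measure Ω) [IsProbabilityMeasure P]
    (s : Finset ι) (ξ : ι → Ω → ℝ) (hmeas : ∀ i, Measurable (ξ i)) (h0 : ∀ i ω, 0 ≤ ξ i ω)
    (B : ℝ) (hB : ∀ i ω, ξ i ω ≤ B)
    (hmgf : ∀ τ, mgf (∑ i ∈ s, ξ i) P τ = ∏ i ∈ s, mgf (ξ i) P τ)
    (μ m₂ : ℝ) (hμ : 0 ≤ μ) (hm₂ : 0 < m₂)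
    (h1 : ∀ i ∈ s, μ ≤ ∫ ω, ξ i ω ∂P) (h2 : ∀ i ∈ s, ∫ ω, ξ i ω ^ 2 ∂P ≤ m₂) :
    P.real {ω | ∑ i ∈ s, ξ i ω ≤ s.card * μ / 2} ≤ Real.exp (-(s.card * (μ ^ 2 / m₂) / 8)) := by
  -- This `τ` minimises the Chernoff exponent per summand `-τ μ / 2 + τ² m₂ / 2`. The bound `B` on
  -- the variables serves integrability only and does not enter the estimate.
  set τ : ℝ := μ / (2 * m₂) with hτ
  have hτ0 : 0 ≤ τ := by positivity
  have int1 : ∀ i, Integrable (ξ i) P := fun i =>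
    Integrable.of_bound (hmeas i).aestronglyMeasurable B
      (ae_of_all _ fun ω => by rw [Real.norm_of_nonneg (h0 i ω)]; exact hB i ω)
  have int2 : ∀ i, Integrable (fun ω => ξ i ω ^ 2) P := fun i =>
    Integrable.of_bound ((hmeas i).pow_const 2).aestronglyMeasurable (B ^ 2)
      (ae_of_all _ fun ω => by
        rw [Real.norm_of_nonneg (by positivity)]
        exact pow_le_pow_left₀ (h0 i ω) (hB i ω) 2)
  have hm : ∀ i ∈ s, mgf (ξ i) P (-τ) ≤ Real.exp (-τ * μ + τ ^ 2 * m₂ / 2) := by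
    intro i hi
    have a1 : mgf (ξ i) P (-τ) ≤ ∫ ω, (1 - τ * ξ i ω + τ ^ 2 / 2 * ξ i ω ^ 2) ∂P := by
      refine integral_mono_of_nonneg (ae_of_all _ fun ω => (Real.exp_pos _).le) ?_
        (ae_of_all _ fun ω => ?_)
      · exact ((integrable_const _).sub ((int1 i).const_mul _)).add ((int2 i).const_mul _)
      · have := exp_neg_le_quadratic (mul_nonneg hτ0 (h0 i ω))
        simp only [neg_mul]
        refine this.trans (le_of_eq ?_)
        ring
    have a2 : ∫ ω, (1 - τ * ξ i ω + τ ^ 2 / 2 * ξ i ω ^ 2) ∂P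
        = 1 - τ * ∫ ω, ξ i ω ∂P + τ ^ 2 / 2 * ∫ ω, ξ i ω ^ 2 ∂P := by
      have e1 : Integrable (fun ω => 1 - τ * ξ i ω) P :=
        (integrable_const _).sub ((int1 i).const_mul _)
      rw [integral_add e1 ((int2 i).const_mul _),
        integral_sub (integrable_const _) ((int1 i).const_mul _), integral_const_mul,
        integral_const_mul]
      simp
    rw [a2] at a1
    have a3 := mul_le_mul_of_nonneg_left (h1 i hi) hτ0
    have a4 := mul_le_mul_of_nonneg_left (h2 i hi) (by positivity : 0 ≤ τ ^ 2 / 2)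
    have a5 := Real.add_one_le_exp (-τ * μ + τ ^ 2 * m₂ / 2)
    linarith
  have hint : Integrable (fun ω => Real.exp (-τ * (∑ i ∈ s, ξ i) ω)) P := by
    refine Integrable.of_bound ?_ 1 (ae_of_all _ fun ω => ?_)
    · have : Measurable (∑ i ∈ s, ξ i) := by
        rw [Finset.sum_fn]
        exact Finset.measurable_fun_sum s fun i _ => hmeas i
      fun_prop
    · rw [Real.norm_of_nonneg (Real.exp_pos _).le, Real.exp_le_one_iff, Finset.sum_apply]
      have := Finset.sum_nonneg fun i (_ : i ∈ s) => h0 i ω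
      nlinarith
  have hch := measure_le_le_exp_mul_mgf (μ := P) (X := ∑ i ∈ s, ξ i) (t := -τ)
    (s.card * μ / 2) (by linarith) hint
  simp only [Finset.sum_apply] at hch
  refine hch.trans ?_
  rw [hmgf]
  calc Real.exp (- -τ * (s.card * μ / 2)) * ∏ i ∈ s, mgf (ξ i) P (-τ)
      ≤ Real.exp (- -τ * (s.card * μ / 2)) *
          ∏ i ∈ s, Real.exp (-τ * μ + τ ^ 2 * m₂ / 2) := by
        refine mul_le_mul_of_nonneg_left ?_ (Real.exp_pos _).le
        exact Finset.prod_le_prod (fun i _ => mgf_nonneg) hm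
    _ = _ := by
        rw [Finset.prod_const, ← Real.exp_nat_mul, ← Real.exp_add]
        congr 1
        rw [hτ]
        field_simp
        ring

/-! ### Covariance inequality under ψ-mixing -/

section Mixing

variable {Ω : Type*}

/-- Trimming both measures to `m` does not change integrals of `m`-measurable functions, and after
trimming the hypothesis compares the measures on every measurable set. -/
lemma lintegral_le_of_measure_le {m m₀ : MeasurableSpace Ω} (hm : m ≤ m₀)
    (μ ν : Measure Ω) (h : ∀ A, MeasurableSet[m] A → μ A ≤ ν A) {f : Ω → ℝ≥0∞}
    (hf : Measurable[m] f) : ∫⁻ ω, f ω ∂μ ≤ ∫⁻ ω, f ω ∂ν := by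
  rw [← lintegral_trim hm hf, ← lintegral_trim hm hf]
  refine lintegral_mono' ?_ le_rfl
  refine @Measure.le_intro Ω m _ _ fun s hs _ => ?_
  rw [trim_measurableSet_eq hm hs, trim_measurableSet_eq hm hs]
  exact h s hs

/-- Passing from events to functions takes two comparisons of measures. With `B` fixed, `P`
restricted to `B` is compared with a multiple of `P` on `m₁`, which replaces the indicator of `A` by
`f`; then the measure with density `f` is compared with a multiple of `P` on `m₂`. -/
lemma lintegral_mul_le_of_rel {m₁ m₂ m₀ : MeasurableSpace Ω} (P : Measure Ω)
    (hm₁ : m₁ ≤ m₀) (hm₂ : m₂ ≤ m₀) (a : ℝ≥0∞)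
    (h : ∀ A B, MeasurableSet[m₁] A → MeasurableSet[m₂] B → P (A ∩ B) ≤ a * (P A * P B))
    {f g : Ω → ℝ≥0∞} (hf : Measurable[m₁] f) (hg : Measurable[m₂] g) :
    ∫⁻ ω, f ω * g ω ∂P ≤ a * ((∫⁻ ω, f ω ∂P) * ∫⁻ ω, g ω ∂P) := by
  have hf' := hf.mono hm₁ le_rfl
  have hg' := hg.mono hm₂ le_rfl
  have key : ∀ B, MeasurableSet[m₂] B → ∫⁻ ω in B, f ω ∂P ≤ a * (∫⁻ ω, f ω ∂P) * P B := by
    intro B hB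
    have := lintegral_le_of_measure_le hm₁ (P.restrict B) ((a * P B) • P) (fun A hA => by
      rw [Measure.restrict_apply (hm₁ _ hA), Measure.smul_apply, smul_eq_mul]
      refine (h A B hA hB).trans (le_of_eq (by ring))) hf
    rw [lintegral_smul_measure, smul_eq_mul] at this
    exact this.trans (le_of_eq (by ring))
  have := lintegral_le_of_measure_le hm₂ (P.withDensity f) ((a * ∫⁻ ω, f ω ∂P) • P)
    (fun B hB => by
      rw [withDensity_apply _ (hm₂ _ hB), Measure.smul_apply, smul_eq_mul]
      exact key B hB) hg
  rw [lintegral_smul_measure, smul_eq_mul, lintegral_withDensity_eq_lintegral_mul _ hf' hg'] at this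
  exact this.trans (le_of_eq (by ring))

/-- The matching lower bound for the mixed integral, by the same two comparisons. It is kept free of
subtraction because the values lie in `[0, ∞]`. -/
lemma mul_lintegral_le_of_rel {m₁ m₂ m₀ : MeasurableSpace Ω} (P : Measure Ω)
    (hm₁ : m₁ ≤ m₀) (hm₂ : m₂ ≤ m₀) (c : ℝ≥0∞)
    (h : ∀ A B, MeasurableSet[m₁] A → MeasurableSet[m₂] B →
      P A * P B ≤ P (A ∩ B) + c * (P A * P B))
    {f g : Ω → ℝ≥0∞} (hf : Measurable[m₁] f) (hg : Measurable[m₂] g) :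
    (∫⁻ ω, f ω ∂P) * ∫⁻ ω, g ω ∂P ≤
      (∫⁻ ω, f ω * g ω ∂P) + c * ((∫⁻ ω, f ω ∂P) * ∫⁻ ω, g ω ∂P) := by
  have hf' := hf.mono hm₁ le_rfl
  have hg' := hg.mono hm₂ le_rfl
  have key : ∀ B, MeasurableSet[m₂] B → (∫⁻ ω, f ω ∂P) * P B ≤
      (∫⁻ ω in B, f ω ∂P) + c * (∫⁻ ω, f ω ∂P) * P B := by
    intro B hB
    have := lintegral_le_of_measure_le hm₁ (P B • P) (P.restrict B + (c * P B) • P)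
      (fun A hA => by
        rw [Measure.add_apply, Measure.restrict_apply (hm₁ _ hA), Measure.smul_apply,
          Measure.smul_apply, smul_eq_mul, smul_eq_mul]
        have := h A B hA hB
        calc _ = P A * P B := by ring
          _ ≤ _ := this
          _ = _ := by ring) hf
    rw [lintegral_add_measure, lintegral_smul_measure, lintegral_smul_measure, smul_eq_mul,
      smul_eq_mul] at this
    calc _ = P B * ∫⁻ ω, f ω ∂P := by ring
      _ ≤ _ := this
      _ = _ := by ring
  have := lintegral_le_of_measure_le hm₂ ((∫⁻ ω, f ω ∂P) • P)
    (P.withDensity f + (c * ∫⁻ ω, f ω ∂P) • P)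
    (fun B hB => by
      rw [Measure.add_apply, withDensity_apply _ (hm₂ _ hB), Measure.smul_apply,
        Measure.smul_apply, smul_eq_mul, smul_eq_mul]
      exact key B hB) hg
  rw [lintegral_add_measure, lintegral_smul_measure, lintegral_smul_measure, smul_eq_mul,
    smul_eq_mul, lintegral_withDensity_eq_lintegral_mul _ hf' hg'] at this
  exact this.trans (le_of_eq (by simp only [Pi.mul_apply]; ring))

/-- Two σ-algebras are `c`-close to independence, relatively. -/
def RelIndep (m₁ m₂ : MeasurableSpace Ω) {m₀ : MeasurableSpace Ω} (P : Measure Ω) (c : ℝ) : Prop :=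
  ∀ A B, MeasurableSet[m₁] A → MeasurableSet[m₂] B →
    |P.real (A ∩ B) - P.real A * P.real B| ≤ c * (P.real A * P.real B)

variable {m₁ m₂ m₀ : MeasurableSpace Ω} {P : Measure Ω} [IsProbabilityMeasure P] {c : ℝ}

lemma RelIndep.lintegral_mul_le (h : RelIndep m₁ m₂ P c) (hc : 0 ≤ c)
    (hm₁ : m₁ ≤ m₀) (hm₂ : m₂ ≤ m₀)
    {f g : Ω → ℝ≥0∞} (hf : Measurable[m₁] f) (hg : Measurable[m₂] g) :
    ∫⁻ ω, f ω * g ω ∂P ≤ ENNReal.ofReal (1 + c) * ((∫⁻ ω, f ω ∂P) * ∫⁻ ω, g ω ∂P) := by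
  refine lintegral_mul_le_of_rel P hm₁ hm₂ _ (fun A B hA hB => ?_) hf hg
  have := (abs_le.1 (h A B hA hB)).2
  rw [← ofReal_measureReal (μ := P) (s := A ∩ B), ← ofReal_measureReal (μ := P) (s := A),
    ← ofReal_measureReal (μ := P) (s := B), ← ENNReal.ofReal_mul measureReal_nonneg,
    ← ENNReal.ofReal_mul (by positivity)]
  exact ENNReal.ofReal_le_ofReal (by linarith)

lemma RelIndep.mul_lintegral_le (h : RelIndep m₁ m₂ P c) (hc : 0 ≤ c)
    (hm₁ : m₁ ≤ m₀) (hm₂ : m₂ ≤ m₀)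
    {f g : Ω → ℝ≥0∞} (hf : Measurable[m₁] f) (hg : Measurable[m₂] g) :
    (∫⁻ ω, f ω ∂P) * ∫⁻ ω, g ω ∂P ≤
      (∫⁻ ω, f ω * g ω ∂P) + ENNReal.ofReal c * ((∫⁻ ω, f ω ∂P) * ∫⁻ ω, g ω ∂P) := by
  refine mul_lintegral_le_of_rel P hm₁ hm₂ _ (fun A B hA hB => ?_) hf hg
  have := (abs_le.1 (h A B hA hB)).1
  rw [← ofReal_measureReal (μ := P) (s := A ∩ B), ← ofReal_measureReal (μ := P) (s := A),
    ← ofReal_measureReal (μ := P) (s := B), ← ENNReal.ofReal_mul measureReal_nonneg,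
    ← ENNReal.ofReal_mul hc, ← ENNReal.ofReal_add measureReal_nonneg (by positivity)]
  exact ENNReal.ofReal_le_ofReal (by linarith)

/-- Relative dependence costs only the factor `1 + c` against independence, so first moments of the
two factors suffice. -/
lemma RelIndep.integrable_mul (h : RelIndep m₁ m₂ P c) (hc : 0 ≤ c)
    (hm₁ : m₁ ≤ m₀) (hm₂ : m₂ ≤ m₀)
    {f g : Ω → ℝ} (hf : Measurable[m₁] f) (hg : Measurable[m₂] g)
    (hf1 : Integrable f P) (hg1 : Integrable g P) : Integrable (fun ω => f ω * g ω) P := by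
  refine ⟨((hf.mono hm₁ le_rfl).mul (hg.mono hm₂ le_rfl)).aestronglyMeasurable, ?_⟩
  have := h.lintegral_mul_le hc hm₁ hm₂ (measurable_enorm.comp hf)
    (measurable_enorm.comp hg)
  simp only [HasFiniteIntegral, enorm_mul]
  refine this.trans_lt (ENNReal.mul_lt_top ENNReal.ofReal_lt_top (ENNReal.mul_lt_top ?_ ?_))
  · exact hf1.2
  · exact hg1.2

lemma RelIndep.abs_sub_le_of_nonneg (h : RelIndep m₁ m₂ P c) (hc : 0 ≤ c)
    (hm₁ : m₁ ≤ m₀) (hm₂ : m₂ ≤ m₀)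
    {f g : Ω → ℝ} (hf : Measurable[m₁] f) (hg : Measurable[m₂] g)
    (hf1 : Integrable f P) (hg1 : Integrable g P) (hf0 : ∀ ω, 0 ≤ f ω) (hg0 : ∀ ω, 0 ≤ g ω) :
    |∫ ω, f ω * g ω ∂P - (∫ ω, f ω ∂P) * ∫ ω, g ω ∂P|
      ≤ c * ((∫ ω, f ω ∂P) * ∫ ω, g ω ∂P) := by
  have hfg := h.integrable_mul hc hm₁ hm₂ hf hg hf1 hg1
  have F0 : 0 ≤ ∫ ω, f ω ∂P := integral_nonneg hf0
  have G0 : 0 ≤ ∫ ω, g ω ∂P := integral_nonneg hg0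
  have FG0 : 0 ≤ ∫ ω, f ω * g ω ∂P := integral_nonneg fun ω => mul_nonneg (hf0 ω) (hg0 ω)
  have e1 := h.lintegral_mul_le hc hm₁ hm₂ hf.ennreal_ofReal hg.ennreal_ofReal
  have e2 := h.mul_lintegral_le hc hm₁ hm₂ hf.ennreal_ofReal hg.ennreal_ofReal
  simp only [← ENNReal.ofReal_mul (hf0 _)] at e1 e2
  rw [← ofReal_integral_eq_lintegral_ofReal hf1 (ae_of_all _ hf0),
    ← ofReal_integral_eq_lintegral_ofReal hg1 (ae_of_all _ hg0),
    ← ofReal_integral_eq_lintegral_ofReal hfg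
      (ae_of_all _ fun ω => mul_nonneg (hf0 ω) (hg0 ω)), ← ENNReal.ofReal_mul F0] at e1 e2
  rw [← ENNReal.ofReal_mul (by positivity), ENNReal.ofReal_le_ofReal_iff (by positivity)] at e1
  rw [← ENNReal.ofReal_mul hc, ← ENNReal.ofReal_add FG0 (by positivity),
    ENNReal.ofReal_le_ofReal_iff (by positivity)] at e2
  rw [abs_le]
  constructor <;> linarith

/-- Split both functions into positive and negative parts. The four error bounds add up to `c (E f⁺
+ E f⁻) (E g⁺ + E g⁻)`, so no constant is lost. -/
lemma RelIndep.abs_sub_le (h : RelIndep m₁ m₂ P c) (hc : 0 ≤ c)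
    (hm₁ : m₁ ≤ m₀) (hm₂ : m₂ ≤ m₀)
    {f g : Ω → ℝ} (hf : Measurable[m₁] f) (hg : Measurable[m₂] g)
    (hf1 : Integrable f P) (hg1 : Integrable g P) :
    |∫ ω, f ω * g ω ∂P - (∫ ω, f ω ∂P) * ∫ ω, g ω ∂P|
      ≤ c * ((∫ ω, |f ω| ∂P) * ∫ ω, |g ω| ∂P) := by
  have pos_meas : ∀ {m : MeasurableSpace Ω} {f : Ω → ℝ}, Measurable[m] f →
      Measurable[m] (fun ω => (f ω)⁺) := fun hf => by
    simp only [posPart_def]; exact hf.sup_const 0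
  have neg_meas : ∀ {m : MeasurableSpace Ω} {f : Ω → ℝ}, Measurable[m] f →
      Measurable[m] (fun ω => (f ω)⁻) := fun hf => by
    simp only [negPart_def]; exact hf.neg.sup_const 0
  have pos_int : ∀ {f : Ω → ℝ}, Integrable f P → Integrable (fun ω => (f ω)⁺) P :=
    fun hf => by simp only [posPart_def]; exact hf.pos_part
  have neg_int : ∀ {f : Ω → ℝ}, Integrable f P → Integrable (fun ω => (f ω)⁻) P :=
    fun hf => by simp only [negPart_def]; exact hf.neg_part
  have key : ∀ {f g : Ω → ℝ}, Measurable[m₁] f → Measurable[m₂] g → Integrable f P →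
      Integrable g P → (∀ ω, 0 ≤ f ω) → (∀ ω, 0 ≤ g ω) → _ :=
    fun hf hg hf1 hg1 hf0 hg0 => abs_le.1 (h.abs_sub_le_of_nonneg hc hm₁ hm₂ hf hg hf1 hg1 hf0 hg0)
  have pp := key (pos_meas hf) (pos_meas hg) (pos_int hf1) (pos_int hg1)
    (fun ω => posPart_nonneg _) (fun ω => posPart_nonneg _)
  have pn := key (pos_meas hf) (neg_meas hg) (pos_int hf1) (neg_int hg1)
    (fun ω => posPart_nonneg _) (fun ω => negPart_nonneg _)
  have np := key (neg_meas hf) (pos_meas hg) (neg_int hf1) (pos_int hg1)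
    (fun ω => negPart_nonneg _) (fun ω => posPart_nonneg _)
  have nn := key (neg_meas hf) (neg_meas hg) (neg_int hf1) (neg_int hg1)
    (fun ω => negPart_nonneg _) (fun ω => negPart_nonneg _)
  have ipp := h.integrable_mul hc hm₁ hm₂ (pos_meas hf) (pos_meas hg) (pos_int hf1) (pos_int hg1)
  have ipn := h.integrable_mul hc hm₁ hm₂ (pos_meas hf) (neg_meas hg) (pos_int hf1) (neg_int hg1)
  have inp := h.integrable_mul hc hm₁ hm₂ (neg_meas hf) (pos_meas hg) (neg_int hf1) (pos_int hg1)
  have inn := h.integrable_mul hc hm₁ hm₂ (neg_meas hf) (neg_meas hg) (neg_int hf1) (neg_int hg1)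
  have efg : ∫ ω, f ω * g ω ∂P = ∫ ω, (f ω)⁺ * (g ω)⁺ ∂P - ∫ ω, (f ω)⁺ * (g ω)⁻ ∂P -
      ∫ ω, (f ω)⁻ * (g ω)⁺ ∂P + ∫ ω, (f ω)⁻ * (g ω)⁻ ∂P := by
    rw [← integral_sub ipp ipn, ← integral_sub (by exact ipp.sub ipn) inp, ← integral_add
      (by exact (ipp.sub ipn).sub inp) inn]
    refine integral_congr_ae (ae_of_all _ fun ω => ?_)
    simp only
    conv_lhs => rw [← posPart_sub_negPart (f ω), ← posPart_sub_negPart (g ω)]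
    ring
  have e1 : ∀ {f : Ω → ℝ}, Integrable f P →
      ∫ ω, f ω ∂P = ∫ ω, (f ω)⁺ ∂P - ∫ ω, (f ω)⁻ ∂P := fun {f} hf => by
    rw [← integral_sub (pos_int hf) (neg_int hf)]
    refine integral_congr_ae (ae_of_all _ fun ω => ?_)
    exact (posPart_sub_negPart (f ω)).symm
  have e2 : ∀ {f : Ω → ℝ}, Integrable f P →
      ∫ ω, |f ω| ∂P = ∫ ω, (f ω)⁺ ∂P + ∫ ω, (f ω)⁻ ∂P := fun {f} hf => by
    rw [← integral_add (pos_int hf) (neg_int hf)]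
    refine integral_congr_ae (ae_of_all _ fun ω => ?_)
    exact (posPart_add_negPart (f ω)).symm
  rw [efg, e1 hf1, e1 hg1, e2 hf1, e2 hg1, abs_le]
  constructor <;> linarith [pp.1, pp.2, pn.1, pn.2, np.1, np.2, nn.1, nn.2]

end Mixing

lemma pastSigma_le {Ω E : Type*} [MeasurableSpace E] [m₀ : MeasurableSpace Ω] {V : ℤ → Ω → E}
    (hV : ∀ t, Measurable (V t)) : pastSigma V ≤ m₀ :=
  iSup_le fun t => (hV t).comap_le

lemma futureSigma_le {Ω E : Type*} [MeasurableSpace E] [m₀ : MeasurableSpace Ω] {V : ℤ → Ω → E}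
    (hV : ∀ t, Measurable (V t)) (l : ℤ) : futureSigma V l ≤ m₀ :=
  iSup_le fun t => (hV t).comap_le

/-- Multiplying the ψ-coefficient by `P(A) P(B)` clears both denominators. The constant is replaced
by its positive part, which is harmless because the mixing bound is read through `ENNReal.ofReal`.
-/
lemma IsMixingSequence.exists_relIndep {Ω E : Type*} [MeasurableSpace E] [MeasurableSpace Ω]
    {P : Measure Ω} [IsProbabilityMeasure P] {V : ℤ → Ω → E} {lam : ℝ}
    (hV : IsMixingSequence P V lam) :
    ∃ c : ℝ, 0 ≤ c ∧ ∀ l : ℕ, 1 ≤ l →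
      RelIndep (pastSigma V) (futureSigma V l) P (c * (l : ℝ) ^ (-lam)) := by
  obtain ⟨c, hc⟩ := hV.mixing
  refine ⟨max c 0, le_max_right _ _, fun l hl A B hA hB => ?_⟩
  have hpow : 0 ≤ (l : ℝ) ^ (-lam) := Real.rpow_nonneg (by positivity) _
  have hmax : 0 ≤ max c 0 := le_max_right _ _
  have hle : c * (l : ℝ) ^ (-lam) ≤ max c 0 * (l : ℝ) ^ (-lam) :=
    mul_le_mul_of_nonneg_right (le_max_left _ _) hpow
  by_cases h0 : 0 < P A * P B
  · have h1 : ENNReal.ofReal |1 - (ProbabilityTheory.cond P A).real B / P.real B| ≤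
        ENNReal.ofReal (max c 0 * (l : ℝ) ^ (-lam)) := by
      refine le_trans ?_ ((hc l hl).trans (ENNReal.ofReal_le_ofReal hle))
      unfold psiMixing
      exact le_iSup_of_le A (le_iSup_of_le B (le_iSup_of_le hA (le_iSup_of_le hB
        (le_iSup_of_le h0 le_rfl))))
    rw [ENNReal.ofReal_le_ofReal_iff (by positivity)] at h1
    have hPA : 0 < P.real A := by
      rw [measureReal_def]
      exact ENNReal.toReal_pos (fun h => by simp [h] at h0) (measure_ne_top _ _)
    have hPB : 0 < P.real B := by
      rw [measureReal_def]
      exact ENNReal.toReal_pos (fun h => by simp [h] at h0) (measure_ne_top _ _)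
    have hAm := pastSigma_le hV.measurable _ hA
    rw [show (ProbabilityTheory.cond P A).real B = (P.real A)⁻¹ * P.real (A ∩ B) by
      rw [measureReal_def, cond_apply hAm, ENNReal.toReal_mul, ENNReal.toReal_inv]; rfl] at h1
    have e : P.real (A ∩ B) - P.real A * P.real B =
        -((1 - (P.real A)⁻¹ * P.real (A ∩ B) / P.real B) * (P.real A * P.real B)) := by
      field_simp
      ring
    rw [e, abs_neg, abs_mul, abs_of_pos (mul_pos hPA hPB)]
    exact mul_le_mul_of_nonneg_right h1 (by positivity)
  -- Null events are excluded from the supremum, but for them both sides vanish.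
  · have h2 : P A * P B = 0 := not_lt.1 h0 |>.antisymm bot_le
    have h3 : P.real A * P.real B = 0 := by
      rw [measureReal_def, measureReal_def, ← ENNReal.toReal_mul, h2, ENNReal.toReal_zero]
    have h4 : P.real (A ∩ B) = 0 := by
      rcases mul_eq_zero.1 h3 with h | h
      · exact le_antisymm (h ▸ measureReal_mono inter_subset_left) measureReal_nonneg
      · exact le_antisymm (h ▸ measureReal_mono inter_subset_right) measureReal_nonneg
    rw [h3, h4]
    simp

/-! ### Independence bookkeeping -/

/-- If `A ⟂ B` and `C ⟂ (A, B)` then `B ⟂ (A, C)`. -/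
lemma indepFun_prodMk_of_indepFun {Ω 𝒜 ℬ 𝒞 : Type*} [MeasurableSpace Ω] [MeasurableSpace 𝒜]
    [MeasurableSpace ℬ] [MeasurableSpace 𝒞] {P : Measure Ω} [IsProbabilityMeasure P]
    {A : Ω → 𝒜} {B : Ω → ℬ} {C : Ω → 𝒞} (hA : Measurable A) (hB : Measurable B)
    (hC : Measurable C) (hAB : IndepFun A B P) (hCAB : IndepFun C (fun ω => (A ω, B ω)) P) :
    IndepFun B (fun ω => (A ω, C ω)) P := by
  have hCA : IndepFun C A P := hCAB.comp measurable_id measurable_fst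
  have e1 := (indepFun_iff_map_prod_eq_prod_map_map hA.aemeasurable hB.aemeasurable).1 hAB
  have e2 := (indepFun_iff_map_prod_eq_prod_map_map hC.aemeasurable
    (hA.prodMk hB).aemeasurable).1 hCAB
  have e3 := (indepFun_iff_map_prod_eq_prod_map_map hC.aemeasurable hA.aemeasurable).1 hCA
  have : IsProbabilityMeasure (P.map A) := Measure.isProbabilityMeasure_map hA.aemeasurable
  have : IsProbabilityMeasure (P.map B) := Measure.isProbabilityMeasure_map hB.aemeasurable
  have : IsProbabilityMeasure (P.map C) := Measure.isProbabilityMeasure_map hC.aemeasurable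
  have e4 : P.map (fun ω => (A ω, C ω)) = (P.map A).prod (P.map C) := by
    rw [← Measure.prod_swap, ← e3, Measure.map_map measurable_swap (hC.prodMk hA)]
    rfl
  rw [indepFun_iff_map_prod_eq_prod_map_map hB.aemeasurable (hA.prodMk hC).aemeasurable, e4]
  have hf : Measurable (fun x : 𝒞 × 𝒜 × ℬ => (x.2.2, x.2.1, x.1)) := by fun_prop
  have e5 : P.map (fun ω => (B ω, A ω, C ω)) =
      ((P.map C).prod ((P.map A).prod (P.map B))).map (fun x => (x.2.2, x.2.1, x.1)) := by
    rw [← e1, ← e2, Measure.map_map hf (hC.prodMk (hA.prodMk hB))]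
    rfl
  rw [e5]
  exact ((measurePreserving_prodAssoc (P.map B) (P.map A) (P.map C)).comp
    (Measure.measurePreserving_swap.comp
      ((MeasurePreserving.id (P.map C)).prod Measure.measurePreserving_swap))).map_eq

/-- Conditioning on an independent design: the expectation of a nonnegative function of `(T, D)`
is computed by freezing `D`. -/
lemma lintegral_indepFun_eq {Ω 𝒯 𝒟 : Type*} [MeasurableSpace Ω] [MeasurableSpace 𝒯]
    [MeasurableSpace 𝒟] {P : Measure Ω} [IsProbabilityMeasure P] {T : Ω → 𝒯} {D : Ω → 𝒟}
    (hT : Measurable T) (hD : Measurable D) (h : IndepFun T D P) {Φ : 𝒯 → 𝒟 → ℝ≥0∞}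
    (hΦ : Measurable (Function.uncurry Φ)) :
    ∫⁻ ω, Φ (T ω) (D ω) ∂P = ∫⁻ ω, ∫⁻ ω', Φ (T ω') (D ω) ∂P ∂P := by
  have e := (indepFun_iff_map_prod_eq_prod_map_map hT.aemeasurable hD.aemeasurable).1 h
  have : IsProbabilityMeasure (P.map T) := Measure.isProbabilityMeasure_map hT.aemeasurable
  have : IsProbabilityMeasure (P.map D) := Measure.isProbabilityMeasure_map hD.aemeasurable
  have e1 : ∫⁻ ω, Φ (T ω) (D ω) ∂P =
      ∫⁻ z, Function.uncurry Φ z ∂(P.map fun ω => (T ω, D ω)) := by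
    rw [lintegral_map hΦ (hT.prodMk hD)]; rfl
  rw [e1, e, lintegral_prod_symm _ hΦ.aemeasurable, lintegral_map _ hD]
  · refine lintegral_congr fun ω => ?_
    exact lintegral_map (hΦ.comp measurable_prodMk_right) hT
  · exact hΦ.lintegral_prod_left'

/-! ### Second moments of the noise in products of observations -/

/-- A stationary sequence `V` with polynomially decaying relative dependence, together with an
independent array of centred i.i.d. errors. -/
structure LatentModel {Ω E : Type*} [MeasurableSpace Ω] [MeasurableSpace E] (P : Measure Ω)
    (V : ℤ → Ω → E) (η : ℤ → ℕ → Ω → ℝ) (lam c Mη : ℝ) : Prop where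
  measurable : ∀ t, Measurable (V t)
  stationary : StrictlyStationary P V
  lam_pos : 0 < lam
  c_nonneg : 0 ≤ c
  rel : ∀ l : ℕ, 1 ≤ l → RelIndep (pastSigma V) (futureSigma V l) P (c * (l : ℝ) ^ (-lam))
  η_measurable : ∀ t i, Measurable (η t i)
  η_indep : iIndepFun (fun p : ℤ × ℕ => η p.1 p.2) P
  η_mean : ∀ t i, ∫ ω, η t i ω ∂P = 0
  η_memLp : ∀ t i, MemLp (η t i) 2 P
  η_sq : ∀ t i, ∫ ω, η t i ω ^ 2 ∂P ≤ Mη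
  indep : IndepFun (fun ω (t : ℤ) (i : ℕ) => η t i ω) (fun ω (t : ℤ) => V t ω) P

/-- `α` evaluated along the latent sequence has second moment at most `M`. -/
structure SqBounded {Ω E : Type*} [MeasurableSpace Ω] [MeasurableSpace E] (P : Measure Ω)
    (V : ℤ → Ω → E) (α : E → ℝ) (M : ℝ) : Prop where
  measurable : Measurable α
  memLp : MemLp (fun ω => α (V 0 ω)) 2 P
  sq : ∫ ω, α (V 0 ω) ^ 2 ∂P ≤ M

/-- Product of a noisy reading of `V t` and a noisy reading of `V (t + k)`. -/
def noisyProd {Ω E : Type*} (V : ℤ → Ω → E) (η : ℤ → ℕ → Ω → ℝ) (k : ℕ) (σ₁ σ₂ : ℝ)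
    (α β : E → ℝ) (t : ℤ) (i j : ℕ) (ω : Ω) : ℝ :=
  (α (V t ω) + σ₁ * η t i ω) * (β (V (t + k) ω) + σ₂ * η (t + k) j ω)

section Latent

variable {Ω E : Type*} [MeasurableSpace Ω] [MeasurableSpace E] {P : Measure Ω}
  {V : ℤ → Ω → E} {η : ℤ → ℕ → Ω → ℝ} {lam c Mη : ℝ}

/-- Stationarity equates the laws of whole paths, so any functional of the path can be moved in
time; moment assumptions are then needed at time `0` only. -/
lemma integral_shift (hV : ∀ t, Measurable (V t)) (hs : StrictlyStationary P V)
    {Φ : (ℤ → E) → ℝ} (hΦ : Measurable Φ) (h : ℤ) :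
    ∫ ω, Φ (fun t => V (t + h) ω) ∂P = ∫ ω, Φ (fun t => V t ω) ∂P := by
  have m1 : Measurable (fun ω (t : ℤ) => V (t + h) ω) := measurable_pi_lambda _ fun t => hV _
  have m2 : Measurable (fun ω (t : ℤ) => V t ω) := measurable_pi_lambda _ fun t => hV _
  rw [← integral_map m1.aemeasurable hΦ.aestronglyMeasurable,
    ← integral_map m2.aemeasurable hΦ.aestronglyMeasurable, hs h]

lemma integrable_shift (hV : ∀ t, Measurable (V t)) (hs : StrictlyStationary P V)
    {Φ : (ℤ → E) → ℝ} (hΦ : Measurable Φ) (h : ℤ) :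
    Integrable (fun ω => Φ (fun t => V (t + h) ω)) P ↔
      Integrable (fun ω => Φ (fun t => V t ω)) P := by
  have m1 : Measurable (fun ω (t : ℤ) => V (t + h) ω) := measurable_pi_lambda _ fun t => hV _
  have m2 : Measurable (fun ω (t : ℤ) => V t ω) := measurable_pi_lambda _ fun t => hV _
  have e1 := integrable_map_measure (μ := P) (f := fun ω (t : ℤ) => V (t + h) ω) (g := Φ)
    hΦ.aestronglyMeasurable m1.aemeasurable
  have e2 := integrable_map_measure (μ := P) (f := fun ω (t : ℤ) => V t ω) (g := Φ)
    hΦ.aestronglyMeasurable m2.aemeasurable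
  rw [hs h] at e1
  exact e1.symm.trans e2

lemma SqBounded.memLp_shift {α : E → ℝ} {M : ℝ} (hα : SqBounded P V α M)
    (hV : ∀ t, Measurable (V t)) (hs : StrictlyStationary P V) (t : ℤ) :
    MemLp (fun ω => α (V t ω)) 2 P := by
  have hm := hα.measurable
  refine (memLp_two_iff_integrable_sq (hm.comp (hV t)).aestronglyMeasurable).2 ?_
  have := (integrable_shift hV hs (Φ := fun v => α (v 0) ^ 2) (by fun_prop) t).2
    hα.memLp.integrable_sq
  simpa using this

lemma SqBounded.sq_shift {α : E → ℝ} {M : ℝ} (hα : SqBounded P V α M)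
    (hV : ∀ t, Measurable (V t)) (hs : StrictlyStationary P V) (t : ℤ) :
    ∫ ω, α (V t ω) ^ 2 ∂P ≤ M := by
  have hm := hα.measurable
  have := integral_shift (P := P) hV hs (Φ := fun v => α (v 0) ^ 2) (by fun_prop) t
  simp only [zero_add] at this
  rw [this]
  exact hα.sq

lemma measurable_pastSigma {α : E → ℝ} (hα : Measurable α) {t : ℤ} (ht : t ≤ 0) :
    Measurable[pastSigma V] (fun ω => α (V t ω)) :=
  hα.comp ((comap_measurable (V t)).mono (le_iSup (fun t : {t : ℤ // t ≤ 0} =>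
    MeasurableSpace.comap (V t.1) inferInstance) ⟨t, ht⟩) le_rfl)

lemma measurable_futureSigma {α : E → ℝ} (hα : Measurable α) {l t : ℤ} (ht : l ≤ t) :
    Measurable[futureSigma V l] (fun ω => α (V t ω)) :=
  hα.comp ((comap_measurable (V t)).mono (le_iSup (fun t : {t : ℤ // l ≤ t} =>
    MeasurableSpace.comap (V t.1) inferInstance) ⟨t, ht⟩) le_rfl)

variable [IsProbabilityMeasure P]

namespace LatentModel

/-- The σ-algebra of everything but the error at `p`. -/
@[reducible]
def others (V : ℤ → Ω → E) (η : ℤ → ℕ → Ω → ℝ) (p : ℤ × ℕ) : MeasurableSpace Ω :=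
  MeasurableSpace.comap (fun ω => ((fun q : {q : ℤ × ℕ // q ≠ p} => η q.1.1 q.1.2 ω),
    fun t : ℤ => V t ω)) inferInstance

lemma measurable_latent_others {α : E → ℝ} (hα : Measurable α) (p : ℤ × ℕ) (t : ℤ) :
    Measurable[others V η p] (fun ω => α (V t ω)) :=
  (show Measurable (fun x : ({q : ℤ × ℕ // q ≠ p} → ℝ) × (ℤ → E) => α (x.2 t)) by
    fun_prop).comp (comap_measurable (fun ω => ((fun q : {q : ℤ × ℕ // q ≠ p} => η q.1.1 q.1.2 ω), fun t : ℤ => V t ω)))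

lemma measurable_error_others {p : ℤ × ℕ} {t : ℤ} {i : ℕ} (hp : (t, i) ≠ p) :
    Measurable[others V η p] (η t i) :=
  ((measurable_pi_apply (⟨(t, i), hp⟩ : {q : ℤ × ℕ // q ≠ p})).comp measurable_fst).comp
    (comap_measurable
    (fun ω => ((fun q : {q : ℤ × ℕ // q ≠ p} => η q.1.1 q.1.2 ω), fun t : ℤ => V t ω)))

/-- Combines independence within the error array with independence of the array from the latent
sequence. It allows one error at a time to be integrated out against everything else. -/
lemma indepFun_others (h : LatentModel P V η lam c Mη) (p : ℤ × ℕ) :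
    IndepFun (η p.1 p.2) (fun ω => ((fun q : {q : ℤ × ℕ // q ≠ p} => η q.1.1 q.1.2 ω),
      fun t : ℤ => V t ω)) P := by
  have mA : Measurable (fun ω (q : {q : ℤ × ℕ // q ≠ p}) => η q.1.1 q.1.2 ω) :=
    measurable_pi_lambda _ fun q => h.η_measurable _ _
  refine indepFun_prodMk_of_indepFun mA (h.η_measurable _ _)
    (measurable_pi_lambda _ fun t => h.measurable t) ?_ ?_
  · have h1 := (iIndepFun_iff_iIndep _ _ _).1 h.η_indep
    have h2 := indep_iSup_of_disjoint (fun q => (h.η_measurable q.1 q.2).comap_le) h1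
      (S := {p}ᶜ) (T := {p}) disjoint_compl_left
    refine indep_of_indep_of_le_left (indep_of_indep_of_le_right h2 ?_) ?_
    · simp
    · rw [← measurable_iff_comap_le]
      refine @measurable_pi_lambda _ _ _ (_) _ _ fun q => ?_
      exact (comap_measurable (η q.1.1 q.1.2)).mono (le_iSup₂_of_le
        (f := fun (q : ℤ × ℕ) (_ : q ∈ ({p}ᶜ : Set (ℤ × ℕ))) =>
          MeasurableSpace.comap (η q.1 q.2) inferInstance) q.1 q.2 le_rfl) le_rfl
  · refine h.indep.symm.comp measurable_id (ψ := fun e : ℤ → ℕ → ℝ =>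
      ((fun q : {q : ℤ × ℕ // q ≠ p} => e q.1.1 q.1.2), e p.1 p.2)) ?_
    fun_prop

lemma integral_error_mul (h : LatentModel P V η lam c Mη) {p : ℤ × ℕ} {G : Ω → ℝ}
    (hG : Measurable[others V η p] G) :
    ∫ ω, η p.1 p.2 ω * G ω ∂P = 0 := by
  have hle : others V η p ≤ ‹MeasurableSpace Ω› := by
    refine Measurable.comap_le ?_
    exact (measurable_pi_lambda _ fun q => h.η_measurable _ _).prodMk
      (measurable_pi_lambda _ fun t => h.measurable t)
  have hi : IndepFun (η p.1 p.2) G P :=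
    indep_of_indep_of_le_right (h.indepFun_others p) (measurable_iff_comap_le.1 hG)
  rw [hi.integral_fun_mul_eq_mul_integral (h.η_measurable _ _).aestronglyMeasurable
    (hG.mono hle le_rfl).aestronglyMeasurable, h.η_mean, zero_mul]

/-- An error may be dropped from a product with variables not involving it. -/
lemma integral_add_error_mul (h : LatentModel P V η lam c Mη) {p : ℤ × ℕ} {f G : Ω → ℝ} (sg : ℝ)
    (hG : Measurable[others V η p] G) (hfG : Integrable (fun ω => f ω * G ω) P)
    (hG1 : Integrable G P) :
    ∫ ω, (f ω + sg * η p.1 p.2 ω) * G ω ∂P = ∫ ω, f ω * G ω ∂P := by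
  have hi : IndepFun (η p.1 p.2) G P :=
    indep_of_indep_of_le_right (h.indepFun_others p) (measurable_iff_comap_le.1 hG)
  have hη : Integrable (fun ω => sg * (η p.1 p.2 ω * G ω)) P :=
    (hi.integrable_mul ((h.η_memLp p.1 p.2).integrable (by norm_num)) hG1).const_mul sg
  have e : ∀ ω, (f ω + sg * η p.1 p.2 ω) * G ω = f ω * G ω + sg * (η p.1 p.2 ω * G ω) :=
    fun ω => by ring
  simp only [e]
  rw [integral_add hfG hη, integral_const_mul, h.integral_error_mul hG]
  simp

lemma indepFun_latent_error (h : LatentModel P V η lam c Mη) {α : E → ℝ} (hα : Measurable α)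
    (t t' : ℤ) (i : ℕ) : IndepFun (fun ω => α (V t ω)) (η t' i) P :=
  (h.indep.symm.comp (φ := fun v : ℤ → E => α (v t)) (ψ := fun e : ℤ → ℕ → ℝ => e t' i)
    (by fun_prop) (by fun_prop))

lemma memLp_mul_of_indepFun {X Y : Ω → ℝ} (hX : MemLp X 2 P) (hY : MemLp Y 2 P)
    (hXY : IndepFun X Y P) :
    MemLp (fun ω => X ω * Y ω) 2 P ∧
      ∫ ω, (X ω * Y ω) ^ 2 ∂P = (∫ ω, X ω ^ 2 ∂P) * ∫ ω, Y ω ^ 2 ∂P := by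
  have hi : IndepFun (fun ω => X ω ^ 2) (fun ω => Y ω ^ 2) P :=
    hXY.comp (φ := fun x => x ^ 2) (ψ := fun x => x ^ 2) (by fun_prop) (by fun_prop)
  have e : ∀ ω, (X ω * Y ω) ^ 2 = X ω ^ 2 * Y ω ^ 2 := fun ω => by ring
  constructor
  · refine (memLp_two_iff_integrable_sq (hX.1.mul hY.1)).2 ?_
    simp only [Pi.mul_apply, e]
    exact hi.integrable_mul hX.integrable_sq hY.integrable_sq
  · simp only [e]
    exact hi.integral_fun_mul_eq_mul_integral (hX.1.pow 2) (hY.1.pow 2)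

lemma rel_const_le (h : LatentModel P V η lam c Mη) {l : ℕ} (hl : 1 ≤ l) :
    c * (l : ℝ) ^ (-lam) ≤ c := by
  have : (l : ℝ) ^ (-lam) ≤ 1 :=
    Real.rpow_le_one_of_one_le_of_nonpos (by exact_mod_cast hl) (by linarith [h.lam_pos])
  nlinarith [h.c_nonneg]

/-- ψ-mixing makes products at distinct times square integrable with second moments only. -/
lemma memLp_latent_mul (h : LatentModel P V η lam c Mη) {k : ℕ} (hk : 1 ≤ k)
    {α β : E → ℝ} {Ma Mb : ℝ} (hα : SqBounded P V α Ma) (hβ : SqBounded P V β Mb) (t : ℤ) :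
    MemLp (fun ω => α (V t ω) * β (V (t + k) ω)) 2 P ∧
      ∫ ω, (α (V t ω) * β (V (t + k) ω)) ^ 2 ∂P ≤ (1 + c) * (Ma * Mb) := by
  have hαm := hα.measurable
  have hβm := hβ.measurable
  have hc := h.c_nonneg
  have hck : 0 ≤ c * (k : ℝ) ^ (-lam) := mul_nonneg hc (Real.rpow_nonneg (by positivity) _)
  have iα := hα.memLp.integrable_sq
  have iβ := (hβ.memLp_shift h.measurable h.stationary k).integrable_sq
  have mα : Measurable[pastSigma V] (fun ω => α (V 0 ω) ^ 2) :=
    measurable_pastSigma (V := V) (α := fun x => α x ^ 2) (by fun_prop) le_rfl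
  have mβ : Measurable[futureSigma V k] (fun ω => β (V k ω) ^ 2) :=
    measurable_futureSigma (V := V) (α := fun x => β x ^ 2) (by fun_prop) le_rfl
  have i0 := (h.rel k hk).integrable_mul hck (pastSigma_le h.measurable)
    (futureSigma_le h.measurable _) mα mβ iα iβ
  have b0 := (abs_le.1 ((h.rel k hk).abs_sub_le_of_nonneg hck (pastSigma_le h.measurable)
    (futureSigma_le h.measurable _) mα mβ iα iβ (fun _ => sq_nonneg _) (fun _ => sq_nonneg _))).2
  have hΦ : Measurable (fun v : ℤ → E => (α (v 0) * β (v k)) ^ 2) := by fun_prop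
  have e1 := integrable_shift (P := P) h.measurable h.stationary hΦ t
  have e2 := integral_shift (P := P) h.measurable h.stationary hΦ t
  simp only [zero_add, mul_pow, add_comm (k : ℤ) t] at e1 e2
  have hA : 0 ≤ ∫ ω, α (V 0 ω) ^ 2 ∂P := integral_nonneg fun _ => sq_nonneg _
  have hB : 0 ≤ ∫ ω, β (V k ω) ^ 2 ∂P := integral_nonneg fun _ => sq_nonneg _
  constructor
  · refine (memLp_two_iff_integrable_sq ((hαm.comp (h.measurable t)).mul
      (hβm.comp (h.measurable (t + k)))).aestronglyMeasurable).2 ?_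
    simp only [Pi.mul_apply, Function.comp_apply, mul_pow]
    exact e1.2 i0
  · simp only [mul_pow]
    rw [e2]
    have hβk := hβ.sq_shift h.measurable h.stationary k
    have := mul_le_mul hα.sq hβk hB (hA.trans hα.sq)
    have h4 := h.rel_const_le hk
    have h5 := mul_nonneg hA hB
    calc _ ≤ (1 + c * (k : ℝ) ^ (-lam)) *
          ((∫ ω, α (V 0 ω) ^ 2 ∂P) * ∫ ω, β (V k ω) ^ 2 ∂P) := by linarith
      _ ≤ (1 + c) * (Ma * Mb) := by gcongr

/-- Bound for the second moment of `noisyProd`. -/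
def noisySq (c Mη Ma Mb σ₁ σ₂ : ℝ) : ℝ :=
  4 * ((1 + c) * (Ma * Mb) + σ₂ ^ 2 * (Ma * Mη) + σ₁ ^ 2 * (Mb * Mη) +
    (σ₁ * σ₂) ^ 2 * (Mη * Mη))

/-- Expand into four products. The purely latent one is controlled by mixing, the three containing
an error by independence; the factor 4 is Cauchy–Schwarz for a sum of four terms. Since `k ≥ 1`, the
two errors are distinct. -/
lemma memLp_noisyProd (h : LatentModel P V η lam c Mη) {k : ℕ} (hk : 1 ≤ k)
    {α β : E → ℝ} {Ma Mb : ℝ} (hα : SqBounded P V α Ma) (hβ : SqBounded P V β Mb) (σ₁ σ₂ : ℝ)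
    (t : ℤ) (i j : ℕ) :
    MemLp (noisyProd V η k σ₁ σ₂ α β t i j) 2 P ∧
      ∫ ω, noisyProd V η k σ₁ σ₂ α β t i j ω ^ 2 ∂P ≤ noisySq c Mη Ma Mb σ₁ σ₂ := by
  have tk : t ≠ t + k := by omega
  have lα := hα.memLp_shift h.measurable h.stationary t
  have lβ := hβ.memLp_shift h.measurable h.stationary (t + k)
  have sα := hα.sq_shift h.measurable h.stationary t
  have sβ := hβ.sq_shift h.measurable h.stationary (t + k)
  have l1 := h.η_memLp t i
  have l2 := h.η_memLp (t + k) j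
  have s1 := h.η_sq t i
  have s2 := h.η_sq (t + k) j
  have nα : 0 ≤ ∫ ω, α (V t ω) ^ 2 ∂P := integral_nonneg fun _ => sq_nonneg _
  have nβ : 0 ≤ ∫ ω, β (V (t + k) ω) ^ 2 ∂P := integral_nonneg fun _ => sq_nonneg _
  have n1 : 0 ≤ ∫ ω, η t i ω ^ 2 ∂P := integral_nonneg fun _ => sq_nonneg _
  have n2 : 0 ≤ ∫ ω, η (t + k) j ω ^ 2 ∂P := integral_nonneg fun _ => sq_nonneg _
  obtain ⟨A1, A2⟩ := h.memLp_latent_mul hk hα hβ t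
  obtain ⟨B1, B2⟩ := memLp_mul_of_indepFun lα l2
    (h.indepFun_latent_error hα.measurable t (t + k) j)
  obtain ⟨C1, C2⟩ := memLp_mul_of_indepFun lβ l1
    (h.indepFun_latent_error hβ.measurable (t + k) t i)
  obtain ⟨D1, D2⟩ := memLp_mul_of_indepFun l1 l2
    (h.η_indep.indepFun (i := (t, i)) (j := (t + k, j)) (by simp [Prod.ext_iff]; omega))
  have e : noisyProd V η k σ₁ σ₂ α β t i j = fun ω => α (V t ω) * β (V (t + k) ω) +
      σ₂ * (α (V t ω) * η (t + k) j ω) + σ₁ * (β (V (t + k) ω) * η t i ω) +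
      (σ₁ * σ₂) * (η t i ω * η (t + k) j ω) := by
    funext ω; unfold noisyProd; ring
  have hm : MemLp (noisyProd V η k σ₁ σ₂ α β t i j) 2 P := by
    rw [e]
    exact ((A1.add (B1.const_mul _)).add (C1.const_mul _)).add (D1.const_mul _)
  refine ⟨hm, ?_⟩
  have i1 : Integrable (fun ω => 4 * (α (V t ω) * β (V (t + k) ω)) ^ 2) P :=
    A1.integrable_sq.const_mul _
  have i2 : Integrable (fun ω => 4 * σ₂ ^ 2 * (α (V t ω) * η (t + k) j ω) ^ 2) P :=
    B1.integrable_sq.const_mul _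
  have i3 : Integrable (fun ω => 4 * σ₁ ^ 2 * (β (V (t + k) ω) * η t i ω) ^ 2) P :=
    C1.integrable_sq.const_mul _
  have i4 : Integrable (fun ω => 4 * (σ₁ * σ₂) ^ 2 * (η t i ω * η (t + k) j ω) ^ 2) P :=
    D1.integrable_sq.const_mul _
  calc ∫ ω, noisyProd V η k σ₁ σ₂ α β t i j ω ^ 2 ∂P
      ≤ ∫ ω, (4 * (α (V t ω) * β (V (t + k) ω)) ^ 2 +
          4 * σ₂ ^ 2 * (α (V t ω) * η (t + k) j ω) ^ 2 +
          4 * σ₁ ^ 2 * (β (V (t + k) ω) * η t i ω) ^ 2 +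
          4 * (σ₁ * σ₂) ^ 2 * (η t i ω * η (t + k) j ω) ^ 2) ∂P := by
        refine integral_mono hm.integrable_sq (((i1.add i2).add i3).add i4) fun ω => ?_
        rw [e]
        simp only
        have : ∀ x y z w : ℝ, (x + y + z + w) ^ 2 ≤ 4 * x ^ 2 + 4 * y ^ 2 + 4 * z ^ 2 + 4 * w ^ 2 := by
          intro x y z w
          nlinarith [sq_nonneg (x - y), sq_nonneg (x - z), sq_nonneg (x - w),
            sq_nonneg (y - z), sq_nonneg (y - w), sq_nonneg (z - w)]
        refine (this _ _ _ _).trans (le_of_eq ?_)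
        ring
    _ = 4 * ∫ ω, (α (V t ω) * β (V (t + k) ω)) ^ 2 ∂P +
          4 * σ₂ ^ 2 * ∫ ω, (α (V t ω) * η (t + k) j ω) ^ 2 ∂P +
          4 * σ₁ ^ 2 * ∫ ω, (β (V (t + k) ω) * η t i ω) ^ 2 ∂P +
          4 * (σ₁ * σ₂) ^ 2 * ∫ ω, (η t i ω * η (t + k) j ω) ^ 2 ∂P := by
        rw [integral_add (by exact (i1.add i2).add i3) i4, integral_add (by exact i1.add i2) i3,
          integral_add i1 i2, integral_const_mul, integral_const_mul, integral_const_mul,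
          integral_const_mul]
    _ ≤ _ := by
        rw [B2, C2, D2]
        have b := mul_le_mul sα s2 n2 (nα.trans sα)
        have cc := mul_le_mul sβ s1 n1 (nβ.trans sβ)
        have d := mul_le_mul s1 s2 n2 (n1.trans s1)
        have b' := mul_le_mul_of_nonneg_left b (sq_nonneg σ₂)
        have c' := mul_le_mul_of_nonneg_left cc (sq_nonneg σ₁)
        have d' := mul_le_mul_of_nonneg_left d (sq_nonneg (σ₁ * σ₂))
        unfold noisySq
        linarith

end LatentModel

end Latent

/-! ### Means and covariances of noisy products. -/

section Latent

variable {Ω E : Type*} [MeasurableSpace Ω] [MeasurableSpace E] {P : Measure Ω}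
  {V : ℤ → Ω → E} {η : ℤ → ℕ → Ω → ℝ} {lam c Mη : ℝ} [IsProbabilityMeasure P]

/-- The common mean of the products `α (V t) β (V (t + k))`. -/
def latentMean (P : Measure Ω) (V : ℤ → Ω → E) (k : ℕ) (α β : E → ℝ) : ℝ :=
  ∫ ω, α (V 0 ω) * β (V k ω) ∂P

namespace LatentModel

lemma integral_latent_mul (h : LatentModel P V η lam c Mη) {k : ℕ} {α β : E → ℝ}
    (hα : Measurable α) (hβ : Measurable β) (t : ℤ) :
    ∫ ω, α (V t ω) * β (V (t + k) ω) ∂P = latentMean P V k α β := by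
  have := integral_shift (P := P) h.measurable h.stationary
    (Φ := fun v => α (v 0) * β (v k)) (by fun_prop) t
  simp only [zero_add, add_comm (k : ℤ) t] at this
  exact this

lemma measurable_noisyProd_others {k : ℕ} {σ₁ σ₂ : ℝ} {α β : E → ℝ}
    (hα : Measurable α) (hβ : Measurable β) {t : ℤ} {i j : ℕ} {p : ℤ × ℕ}
    (h1 : σ₁ = 0 ∨ (t, i) ≠ p) (h2 : σ₂ = 0 ∨ (t + (k : ℤ), j) ≠ p) :
    Measurable[others V η p] (noisyProd V η k σ₁ σ₂ α β t i j) := by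
  have e1 : Measurable[others V η p] (fun ω => σ₁ * η t i ω) := by
    rcases h1 with h1 | h1
    · simp only [h1, zero_mul]; exact measurable_const
    · exact (measurable_error_others h1).const_mul _
  have e2 : Measurable[others V η p] (fun ω => σ₂ * η (t + k) j ω) := by
    rcases h2 with h2 | h2
    · simp only [h2, zero_mul]; exact measurable_const
    · exact (measurable_error_others h2).const_mul _
  exact ((measurable_latent_others hα p t).add e1).mul
    ((measurable_latent_others hβ p (t + k)).add e2)

/-- Removing all errors from the expectation of a product `noisyProd` times something not involving
its errors. -/
lemma integral_noisyProd_mul (h : LatentModel P V η lam c Mη) {k : ℕ} (hk : 1 ≤ k)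
    {α β : E → ℝ} {Ma Mb : ℝ} (hα : SqBounded P V α Ma) (hβ : SqBounded P V β Mb) (σ₁ σ₂ : ℝ)
    (t : ℤ) (i j : ℕ) {G : Ω → ℝ} (hG : MemLp G 2 P)
    (hG1 : Measurable[others V η (t, i)] G) (hG2 : Measurable[others V η (t + (k : ℤ), j)] G) :
    ∫ ω, noisyProd V η k σ₁ σ₂ α β t i j ω * G ω ∂P =
      ∫ ω, α (V t ω) * β (V (t + k) ω) * G ω ∂P := by
  have tk : t ≠ t + k := by omega
  have hβm := hβ.measurable
  have lα := hα.memLp_shift h.measurable h.stationary t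
  have lβ := hβ.memLp_shift h.measurable h.stationary (t + k)
  have l2 : MemLp (fun ω => β (V (t + k) ω) + σ₂ * η (t + k) j ω) 2 P :=
    lβ.add ((h.η_memLp (t + k) j).const_mul _)
  have l0 : MemLp (noisyProd V η k 0 σ₂ α β t i j) 2 P := (h.memLp_noisyProd hk hα hβ 0 σ₂ t i j).1
  have l00 := (h.memLp_latent_mul hk hα hβ t).1
  -- Drop the error at time `t` while the one at `t + k` is still present, then drop the latter.
  have s1 := h.integral_add_error_mul (p := (t, i)) (f := fun ω => α (V t ω))
    (G := fun ω => (β (V (t + k) ω) + σ₂ * η (t + k) j ω) * G ω) σ₁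
    (((measurable_latent_others hβm _ (t + k)).add
      ((measurable_error_others (by simp [Prod.ext_iff]; omega)).const_mul _)).mul hG1)
    (by
      have := l0.integrable_mul hG
      refine this.congr (ae_of_all _ fun ω => ?_)
      simp only [noisyProd, Pi.mul_apply]; ring)
    (l2.integrable_mul hG)
  have s2 := h.integral_add_error_mul (p := (t + (k : ℤ), j)) (f := fun ω => β (V (t + k) ω))
    (G := fun ω => α (V t ω) * G ω) σ₂
    ((measurable_latent_others hα.measurable _ t).mul hG2)
    (by
      have := l00.integrable_mul hG
      refine this.congr (ae_of_all _ fun ω => ?_)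
      simp only [Pi.mul_apply]; ring)
    (lα.integrable_mul hG)
  calc ∫ ω, noisyProd V η k σ₁ σ₂ α β t i j ω * G ω ∂P
      = ∫ ω, (α (V t ω) + σ₁ * η t i ω) *
          ((β (V (t + k) ω) + σ₂ * η (t + k) j ω) * G ω) ∂P := by
        refine integral_congr_ae (ae_of_all _ fun ω => ?_)
        simp only [noisyProd]; ring
    _ = ∫ ω, α (V t ω) * ((β (V (t + k) ω) + σ₂ * η (t + k) j ω) * G ω) ∂P := s1
    _ = ∫ ω, (β (V (t + k) ω) + σ₂ * η (t + k) j ω) * (α (V t ω) * G ω) ∂P := by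
        refine integral_congr_ae (ae_of_all _ fun ω => ?_)
        simp only; ring
    _ = ∫ ω, β (V (t + k) ω) * (α (V t ω) * G ω) ∂P := s2
    _ = _ := by
        refine integral_congr_ae (ae_of_all _ fun ω => ?_)
        simp only; ring

lemma integral_noisyProd (h : LatentModel P V η lam c Mη) {k : ℕ} (hk : 1 ≤ k)
    {α β : E → ℝ} {Ma Mb : ℝ} (hα : SqBounded P V α Ma) (hβ : SqBounded P V β Mb) (σ₁ σ₂ : ℝ)
    (t : ℤ) (i j : ℕ) :
    ∫ ω, noisyProd V η k σ₁ σ₂ α β t i j ω ∂P = latentMean P V k α β := by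
  have := h.integral_noisyProd_mul hk hα hβ σ₁ σ₂ t i j (G := fun _ => 1) (memLp_const 1)
    measurable_const measurable_const
  simp only [mul_one] at this
  rw [this, h.integral_latent_mul hα.measurable hβ.measurable]

lemma integral_abs_latent_mul_le (h : LatentModel P V η lam c Mη) {k : ℕ}
    {α β : E → ℝ} {Ma Mb : ℝ} (hα : SqBounded P V α Ma) (hβ : SqBounded P V β Mb) (t : ℤ) :
    ∫ ω, |α (V t ω) * β (V (t + k) ω)| ∂P ≤ (Ma + Mb) / 2 := by
  have lα := (hα.memLp_shift h.measurable h.stationary t).integrable_sq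
  have lβ := (hβ.memLp_shift h.measurable h.stationary (t + k)).integrable_sq
  have sα := hα.sq_shift h.measurable h.stationary t
  have sβ := hβ.sq_shift h.measurable h.stationary (t + k)
  calc ∫ ω, |α (V t ω) * β (V (t + k) ω)| ∂P
      ≤ ∫ ω, (1 / 2 * α (V t ω) ^ 2 + 1 / 2 * β (V (t + k) ω) ^ 2) ∂P := by
        refine integral_mono_of_nonneg (ae_of_all _ fun _ => abs_nonneg _)
          ((lα.const_mul _).add (lβ.const_mul _)) (ae_of_all _ fun ω => ?_)
        simp only [abs_mul]
        nlinarith [sq_nonneg (|α (V t ω)| - |β (V (t + k) ω)|), sq_abs (α (V t ω)),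
          sq_abs (β (V (t + k) ω))]
    _ ≤ _ := by
        rw [integral_add (lα.const_mul _) (lβ.const_mul _), integral_const_mul, integral_const_mul]
        linarith

/-- Covariances of noiseless products decay with the time gap. -/
lemma abs_integral_latent_sub_le (h : LatentModel P V η lam c Mη) {k : ℕ} (hk : 1 ≤ k)
    {α β α' β' : E → ℝ} {M : ℝ} (hα : SqBounded P V α M) (hβ : SqBounded P V β M)
    (hα' : SqBounded P V α' M) (hβ' : SqBounded P V β' M) (t : ℤ) {l : ℕ} (hl : 1 ≤ l) :
    |∫ ω, (α (V t ω) * β (V (t + k) ω)) * (α' (V (t + k + l) ω) * β' (V (t + k + l + k) ω)) ∂P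
      - latentMean P V k α β * latentMean P V k α' β'| ≤ c * (l : ℝ) ^ (-lam) * (M * M) := by
  have hαm := hα.measurable
  have hβm := hβ.measurable
  have hαm' := hα'.measurable
  have hβm' := hβ'.measurable
  have hc : 0 ≤ c * (l : ℝ) ^ (-lam) := mul_nonneg h.c_nonneg (Real.rpow_nonneg (by positivity) _)
  -- Shifting time by `t + k` places the first product at times `-k` and `0`, in the past, and the
  -- second at `l` and `l + k`, in the future from `l`.
  set f : Ω → ℝ := fun ω => α (V (-k) ω) * β (V (-k + k) ω) with hf
  set g : Ω → ℝ := fun ω => α' (V l ω) * β' (V (l + k) ω) with hg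
  have e : ∫ ω, (α (V t ω) * β (V (t + k) ω)) *
      (α' (V (t + k + l) ω) * β' (V (t + k + l + k) ω)) ∂P = ∫ ω, f ω * g ω ∂P := by
    have := integral_shift (P := P) h.measurable h.stationary
      (Φ := fun v => (α (v (-k)) * β (v (-k + k))) * (α' (v l) * β' (v (l + k)))) (by fun_prop)
      (t + k)
    simp only [show (-k + (t + k) : ℤ) = t by ring, show (-k + k + (t + k) : ℤ) = t + k by ring,
      show (l + (t + k) : ℤ) = t + k + l by ring,
      show (l + k + (t + k) : ℤ) = t + k + l + k by ring] at this
    exact this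
  have ef := h.integral_latent_mul (k := k) hαm hβm (-k)
  have eg := h.integral_latent_mul (k := k) hαm' hβm' l
  have nf : 0 ≤ ∫ ω, |f ω| ∂P := integral_nonneg fun _ => abs_nonneg _
  have ng : 0 ≤ ∫ ω, |g ω| ∂P := integral_nonneg fun _ => abs_nonneg _
  have bf := h.integral_abs_latent_mul_le (k := k) hα hβ (-k)
  have bg := h.integral_abs_latent_mul_le (k := k) hα' hβ' l
  rw [e, ← ef, ← eg]
  have := (h.rel l hl).abs_sub_le hc (pastSigma_le h.measurable) (futureSigma_le h.measurable _)
    (f := f) (g := g)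
    ((measurable_pastSigma hαm (by omega)).mul (measurable_pastSigma hβm (by omega)))
    ((measurable_futureSigma hαm' (by omega)).mul (measurable_futureSigma hβm' (by omega)))
    ((h.memLp_latent_mul hk hα hβ (-k)).1.integrable (by norm_num))
    ((h.memLp_latent_mul hk hα' hβ' l).1.integrable (by norm_num))
  refine this.trans (mul_le_mul_of_nonneg_left ?_ hc)
  have hM : (M + M) / 2 = M := by ring
  rw [hM] at bf bg
  exact mul_le_mul bf bg ng (nf.trans bf)

/-- Covariance bound for centred noisy products as a function of the time gap. -/
def noiseCov (k : ℕ) (lam C₀ C₁ : ℝ) (d : ℤ) : ℝ :=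
  if |d| ≤ k then C₀ else C₁ * ((|d| - k : ℤ) : ℝ) ^ (-lam)

lemma memLp_centred (h : LatentModel P V η lam c Mη) {k : ℕ} (hk : 1 ≤ k)
    {α β : E → ℝ} {M : ℝ} (hα : SqBounded P V α M) (hβ : SqBounded P V β M) (σ₁ σ₂ : ℝ)
    (t : ℤ) (i j : ℕ) :
    MemLp (fun ω => noisyProd V η k σ₁ σ₂ α β t i j ω - latentMean P V k α β) 2 P :=
  (h.memLp_noisyProd hk hα hβ σ₁ σ₂ t i j).1.sub (memLp_const _)

lemma integral_centred_sq_le (h : LatentModel P V η lam c Mη) {k : ℕ} (hk : 1 ≤ k)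
    {α β : E → ℝ} {M : ℝ} (hα : SqBounded P V α M) (hβ : SqBounded P V β M) (σ₁ σ₂ : ℝ)
    (t : ℤ) (i j : ℕ) :
    ∫ ω, (noisyProd V η k σ₁ σ₂ α β t i j ω - latentMean P V k α β) ^ 2 ∂P ≤
      noisySq c Mη M M σ₁ σ₂ := by
  obtain ⟨h1, h2⟩ := h.memLp_noisyProd hk hα hβ σ₁ σ₂ t i j
  have h3 := h.integral_noisyProd hk hα hβ σ₁ σ₂ t i j
  set g := latentMean P V k α β
  have i1 : Integrable (fun ω => 2 * g * noisyProd V η k σ₁ σ₂ α β t i j ω) P :=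
    (h1.integrable (by norm_num)).const_mul _
  have e : ∀ ω, (noisyProd V η k σ₁ σ₂ α β t i j ω - g) ^ 2 =
      noisyProd V η k σ₁ σ₂ α β t i j ω ^ 2 - 2 * g * noisyProd V η k σ₁ σ₂ α β t i j ω + g ^ 2 :=
    fun ω => by ring
  simp only [e]
  rw [integral_add (by exact h1.integrable_sq.sub i1) (integrable_const _),
    integral_sub h1.integrable_sq i1, integral_const_mul, h3]
  simp only [integral_const, probReal_univ, smul_eq_mul, one_mul]
  nlinarith [sq_nonneg g]

/-- When the second product starts after the first has ended, the two share no error. All four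
errors integrate to zero and only the covariance of the latent products remains. -/
lemma abs_integral_centred_of_gap (h : LatentModel P V η lam c Mη) {k : ℕ} (hk : 1 ≤ k)
    {α β α' β' : E → ℝ} {M : ℝ} (hα : SqBounded P V α M) (hβ : SqBounded P V β M)
    (hα' : SqBounded P V α' M) (hβ' : SqBounded P V β' M) (σ₁ σ₂ : ℝ) {t t' : ℤ} (i j i' j' : ℕ)
    (hgap : t + k < t') :
    |∫ ω, (noisyProd V η k σ₁ σ₂ α β t i j ω - latentMean P V k α β) *
      (noisyProd V η k σ₁ σ₂ α' β' t' i' j' ω - latentMean P V k α' β') ∂P| ≤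
      c * ((t' - t - k : ℤ) : ℝ) ^ (-lam) * (M * M) := by
  obtain ⟨l, hl⟩ : ∃ l : ℕ, t' = t + k + l := ⟨(t' - t - k).toNat, by omega⟩
  subst hl
  have hl1 : 1 ≤ l := by omega
  have e0 : ((t + k + l - t - k : ℤ) : ℝ) = l := by push_cast; ring
  rw [e0]
  obtain ⟨h1, -⟩ := h.memLp_noisyProd hk hα hβ σ₁ σ₂ t i j
  obtain ⟨h1', -⟩ := h.memLp_noisyProd hk hα' hβ' σ₁ σ₂ (t + k + l) i' j'
  have m1 := h.integral_noisyProd hk hα hβ σ₁ σ₂ t i j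
  have m1' := h.integral_noisyProd hk hα' hβ' σ₁ σ₂ (t + k + l) i' j'
  have hcross : ∫ ω, noisyProd V η k σ₁ σ₂ α β t i j ω *
      noisyProd V η k σ₁ σ₂ α' β' (t + k + l) i' j' ω ∂P =
      ∫ ω, (α (V t ω) * β (V (t + k) ω)) *
        (α' (V (t + k + l) ω) * β' (V (t + k + l + k) ω)) ∂P := by
    rw [h.integral_noisyProd_mul hk hα hβ σ₁ σ₂ t i j h1'
      (measurable_noisyProd_others hα'.measurable hβ'.measurable
        (.inr (by simp [Prod.ext_iff]; omega)) (.inr (by simp [Prod.ext_iff]; omega)))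
      (measurable_noisyProd_others hα'.measurable hβ'.measurable
        (.inr (by simp [Prod.ext_iff]; omega)) (.inr (by simp [Prod.ext_iff]; omega)))]
    have := h.integral_noisyProd_mul hk hα' hβ' σ₁ σ₂ (t + k + l) i' j'
      (G := fun ω => α (V t ω) * β (V (t + k) ω)) (h.memLp_latent_mul hk hα hβ t).1
      ((measurable_latent_others hα.measurable _ _).mul (measurable_latent_others hβ.measurable _ _))
      ((measurable_latent_others hα.measurable _ _).mul (measurable_latent_others hβ.measurable _ _))
    simp only [mul_comm (α (V t _) * β (V (t + k) _))]
    exact this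
  have key := h.abs_integral_latent_sub_le hk hα hβ hα' hβ' t hl1
  rw [← hcross] at key
  convert key using 2
  set g := latentMean P V k α β
  set g' := latentMean P V k α' β'
  have e : ∀ ω, (noisyProd V η k σ₁ σ₂ α β t i j ω - g) *
      (noisyProd V η k σ₁ σ₂ α' β' (t + k + l) i' j' ω - g') =
      noisyProd V η k σ₁ σ₂ α β t i j ω * noisyProd V η k σ₁ σ₂ α' β' (t + k + l) i' j' ω -
      g' * noisyProd V η k σ₁ σ₂ α β t i j ω -
      g * noisyProd V η k σ₁ σ₂ α' β' (t + k + l) i' j' ω + g * g' := fun ω => by ring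
  simp only [e]
  have j1 := h1.integrable_mul h1'
  have j2 := (h1.integrable (by norm_num)).const_mul g'
  have j3 := (h1'.integrable (by norm_num)).const_mul g
  rw [integral_add (by exact (j1.sub j2).sub j3) (integrable_const _),
    integral_sub (by exact j1.sub j2) j3, integral_sub (by exact j1) j2, integral_const_mul,
    integral_const_mul, m1, m1']
  simp only [integral_const, probReal_univ, smul_eq_mul, one_mul]
  ring

/-- Products whose time spans may interleave or share errors get the bound by second moments, with
no decay; all others are separated in one of the two orders and mixing applies. -/
lemma abs_integral_centred_le (h : LatentModel P V η lam c Mη) {k : ℕ} (hk : 1 ≤ k)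
    {α β α' β' : E → ℝ} {M : ℝ} (hα : SqBounded P V α M) (hβ : SqBounded P V β M)
    (hα' : SqBounded P V α' M) (hβ' : SqBounded P V β' M) (σ₁ σ₂ : ℝ) (t t' : ℤ) (i j i' j' : ℕ) :
    |∫ ω, (noisyProd V η k σ₁ σ₂ α β t i j ω - latentMean P V k α β) *
      (noisyProd V η k σ₁ σ₂ α' β' t' i' j' ω - latentMean P V k α' β') ∂P| ≤
      noiseCov k lam (noisySq c Mη M M σ₁ σ₂) (c * (M * M)) (t - t') := by
  unfold noiseCov
  split_ifs with hd
  · have a1 := h.memLp_centred hk hα hβ σ₁ σ₂ t i j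
    have a2 := h.memLp_centred hk hα' hβ' σ₁ σ₂ t' i' j'
    have b1 := h.integral_centred_sq_le hk hα hβ σ₁ σ₂ t i j
    have b2 := h.integral_centred_sq_le hk hα' hβ' σ₁ σ₂ t' i' j'
    set f := fun ω => noisyProd V η k σ₁ σ₂ α β t i j ω - latentMean P V k α β
    set f' := fun ω => noisyProd V η k σ₁ σ₂ α' β' t' i' j' ω - latentMean P V k α' β'
    have i1 : Integrable (fun ω => 1 / 2 * f ω ^ 2) P := a1.integrable_sq.const_mul _
    have i2 : Integrable (fun ω => 1 / 2 * f' ω ^ 2) P := a2.integrable_sq.const_mul _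
    calc |∫ ω, f ω * f' ω ∂P| ≤ ∫ ω, |f ω * f' ω| ∂P := abs_integral_le_integral_abs
      _ ≤ ∫ ω, (1 / 2 * f ω ^ 2 + 1 / 2 * f' ω ^ 2) ∂P := by
          refine integral_mono_of_nonneg (ae_of_all _ fun _ => abs_nonneg _)
            (i1.add i2) (ae_of_all _ fun ω => ?_)
          simp only [abs_mul]
          nlinarith [sq_nonneg (|f ω| - |f' ω|), sq_abs (f ω), sq_abs (f' ω)]
      _ ≤ _ := by
          rw [integral_add i1 i2, integral_const_mul, integral_const_mul]
          linarith
  · rcases lt_or_ge t t' with hlt | hge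
    · have := h.abs_integral_centred_of_gap hk hα hβ hα' hβ' σ₁ σ₂ i j i' j' (t := t) (t' := t')
        (by rw [abs_of_nonpos (by omega)] at hd; omega)
      rw [abs_of_nonpos (by omega : t - t' ≤ 0)]
      refine this.trans (le_of_eq ?_)
      rw [show -(t - t') - (k : ℤ) = t' - t - k by ring]
      ring
    · have := h.abs_integral_centred_of_gap hk hα' hβ' hα hβ σ₁ σ₂ i' j' i j (t := t') (t' := t)
        (by rw [abs_of_nonneg (by omega)] at hd; omega)
      rw [abs_of_nonneg (by omega : 0 ≤ t - t')]
      simp only [mul_comm (noisyProd V η k σ₁ σ₂ α β t i j _ - _)]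
      refine this.trans (le_of_eq ?_)
      ring

end LatentModel

end Latent

/-! ### Summing noise covariances -/

section NoiseSum

open LatentModel

/-- For `|d| > k` one has `|d| ≤ (k + 1) (|d| - k)`, so the shifted tail is dominated by `(k +
1)^lam |d|^{-lam}`. -/
lemma summable_noiseTail {k : ℕ} {lam : ℝ} (hlam : 1 < lam) :
    Summable fun d : ℤ => if |d| ≤ k then (0 : ℝ) else ((|d| - k : ℤ) : ℝ) ^ (-lam) := by
  have h1 := (Real.summable_abs_int_rpow hlam).mul_left ((k + 1 : ℝ) ^ lam)
  refine Summable.of_nonneg_of_le (fun d => ?_) (fun d => ?_) h1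
  · split_ifs with h
    · exact le_rfl
    · exact Real.rpow_nonneg (by exact_mod_cast (by omega : 0 ≤ |d| - (k : ℤ))) _
  · split_ifs with h
    · exact mul_nonneg (Real.rpow_nonneg (by positivity) _) (Real.rpow_nonneg (abs_nonneg _) _)
    · push Not at h
      have hx : (0 : ℝ) < ((|d| - k : ℤ) : ℝ) := by exact_mod_cast (by omega : 0 < |d| - (k : ℤ))
      have hd : (0 : ℝ) < |(d : ℝ)| := by
        have : (0 : ℤ) < |d| := by omega
        exact_mod_cast this
      have hle : |(d : ℝ)| ≤ (k + 1) * ((|d| - k : ℤ) : ℝ) := by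
        have : |d| ≤ (k + 1) * (|d| - k) := by nlinarith
        exact_mod_cast this
      have hk1 : (0 : ℝ) < k + 1 := by positivity
      calc ((|d| - k : ℤ) : ℝ) ^ (-lam)
          = (k + 1 : ℝ) ^ lam * ((k + 1) * ((|d| - k : ℤ) : ℝ)) ^ (-lam) := by
            rw [Real.mul_rpow hk1.le hx.le, ← mul_assoc, ← Real.rpow_add hk1]
            simp
        _ ≤ (k + 1 : ℝ) ^ lam * |(d : ℝ)| ^ (-lam) := by
            refine mul_le_mul_of_nonneg_left ?_ (Real.rpow_nonneg hk1.le _)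
            exact Real.rpow_le_rpow_of_nonpos hd hle (by linarith)

lemma sum_sub_le_tsum {g : ℤ → ℝ} (hg : Summable g) (h0 : ∀ d, 0 ≤ g d) (F : Finset ℤ) (t : ℤ) :
    ∑ t' ∈ F, g (t - t') ≤ ∑' d, g d := by
  have : ∑ t' ∈ F, g (t - t') = ∑ d ∈ F.map ⟨fun t' => t - t', sub_right_injective⟩, g d := by
    rw [Finset.sum_map]; rfl
  rw [this]
  exact hg.sum_le_tsum _ fun d _ => h0 d

/-- Double sums over times weighted by `noiseCov` grow linearly; pairs of nearby and of distant
times may be bounded separately. -/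
lemma exists_sum_noiseCov_le (k : ℕ) {lam : ℝ} (hlam : 1 < lam) :
    ∃ S : ℝ, 0 ≤ S ∧ ∀ (C₀ C₁ Qn Qf : ℝ) (F : Finset ℤ) (X : ℤ → ℤ → ℝ), 0 ≤ C₀ → 0 ≤ C₁ →
      0 ≤ Qn → 0 ≤ Qf → (∀ t t', X t t' ≤ Qn) → (∀ t t', (k : ℤ) < |t - t'| → X t t' ≤ Qf) →
      ∑ t ∈ F, ∑ t' ∈ F, noiseCov k lam C₀ C₁ (t - t') * X t t' ≤
        F.card * (S * (C₀ * Qn + C₁ * Qf)) := by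
  set g₁ : ℤ → ℝ := fun d => if |d| ≤ k then 1 else 0 with hg₁
  set g₂ : ℤ → ℝ := fun d => if |d| ≤ k then 0 else ((|d| - k : ℤ) : ℝ) ^ (-lam) with hg₂
  have s₁ : Summable g₁ := by
    refine summable_of_ne_finset_zero (s := Finset.Icc (-(k : ℤ)) k) fun d hd => ?_
    rw [hg₁]
    simp only
    rw [if_neg]
    intro h
    exact hd (by rw [Finset.mem_Icc]; exact abs_le.1 h)
  have s₂ : Summable g₂ := summable_noiseTail hlam
  have n₁ : ∀ d, 0 ≤ g₁ d := fun d => by rw [hg₁]; simp only; split_ifs <;> norm_num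
  have n₂ : ∀ d, 0 ≤ g₂ d := fun d => by
    rw [hg₂]; simp only; split_ifs with h
    · exact le_rfl
    · exact Real.rpow_nonneg (by exact_mod_cast (by omega : 0 ≤ |d| - (k : ℤ))) _
  -- One constant for both the number of near gaps and the mass of the mixing tail; it depends on
  -- `k` and `lam` only.
  refine ⟨max (∑' d, g₁ d) (∑' d, g₂ d), le_max_of_le_left (tsum_nonneg n₁), ?_⟩
  intro C₀ C₁ Qn Qf F X h0 h1 hn hf hXn hXf
  set S := max (∑' d, g₁ d) (∑' d, g₂ d)
  have pt : ∀ t t', noiseCov k lam C₀ C₁ (t - t') * X t t' ≤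
      C₀ * Qn * g₁ (t - t') + C₁ * Qf * g₂ (t - t') := by
    intro t t'
    rw [hg₁, hg₂]
    unfold noiseCov
    simp only
    split_ifs with h
    · have := mul_le_mul_of_nonneg_left (hXn t t') h0
      linarith
    · have h2 : 0 ≤ ((|t - t'| - k : ℤ) : ℝ) ^ (-lam) :=
        Real.rpow_nonneg (by exact_mod_cast (by omega : 0 ≤ |t - t'| - (k : ℤ))) _
      have := mul_le_mul_of_nonneg_left (hXf t t' (by omega)) (mul_nonneg h1 h2)
      linarith
  calc _ ≤ ∑ t ∈ F, ∑ t' ∈ F, (C₀ * Qn * g₁ (t - t') + C₁ * Qf * g₂ (t - t')) :=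
        Finset.sum_le_sum fun t _ => Finset.sum_le_sum fun t' _ => pt t t'
    _ = ∑ t ∈ F, (C₀ * Qn * ∑ t' ∈ F, g₁ (t - t') + C₁ * Qf * ∑ t' ∈ F, g₂ (t - t')) := by
        refine Finset.sum_congr rfl fun t _ => ?_
        rw [Finset.sum_add_distrib, Finset.mul_sum, Finset.mul_sum]
    _ ≤ ∑ t ∈ F, (C₀ * Qn * S + C₁ * Qf * S) := by
        refine Finset.sum_le_sum fun t _ => ?_
        have a1 := (sum_sub_le_tsum s₁ n₁ F t).trans (le_max_left _ (∑' d, g₂ d))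
        have a2 := (sum_sub_le_tsum s₂ n₂ F t).trans (le_max_right (∑' d, g₁ d) _)
        have := mul_le_mul_of_nonneg_left a1 (mul_nonneg h0 hn)
        have := mul_le_mul_of_nonneg_left a2 (mul_nonneg h1 hf)
        linarith
    _ = _ := by
        rw [Finset.sum_const, nsmul_eq_mul]; ring

lemma noiseCov_nonneg {k : ℕ} {lam C₀ C₁ : ℝ} (h0 : 0 ≤ C₀) (h1 : 0 ≤ C₁) (d : ℤ) :
    0 ≤ noiseCov k lam C₀ C₁ d := by
  unfold noiseCov
  split_ifs with h
  · exact h0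
  · exact mul_nonneg h1
      (Real.rpow_nonneg (by exact_mod_cast (by omega : 0 ≤ |d| - (k : ℤ))) _)

/-- Second moment of a weighted sum in terms of covariance bounds. -/
lemma lintegral_sum_sq_le {Ω ι : Type*} [MeasurableSpace Ω] {P : Measure Ω} (A : Finset ι)
    (w : ι → ℝ) (ε : ι → Ω → ℝ) (C : ι → ι → ℝ) (hε : ∀ a ∈ A, MemLp (ε a) 2 P)
    (hC : ∀ a ∈ A, ∀ b ∈ A, |∫ ω, ε a ω * ε b ω ∂P| ≤ C a b) :
    ∫⁻ ω, ENNReal.ofReal ((∑ a ∈ A, w a * ε a ω) ^ 2) ∂P ≤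
      ENNReal.ofReal (∑ a ∈ A, ∑ b ∈ A, C a b * (|w a| * |w b|)) := by
  have hm : MemLp (fun ω => ∑ a ∈ A, w a * ε a ω) 2 P :=
    memLp_finsetSum A fun a ha => (hε a ha).const_mul _
  rw [← ofReal_integral_eq_lintegral_ofReal hm.integrable_sq (ae_of_all _ fun _ => sq_nonneg _)]
  refine ENNReal.ofReal_le_ofReal ?_
  have e : ∀ ω, (∑ a ∈ A, w a * ε a ω) ^ 2 =
      ∑ a ∈ A, ∑ b ∈ A, w a * w b * (ε a ω * ε b ω) := by
    intro ω
    rw [sq, Finset.sum_mul_sum]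
    exact Finset.sum_congr rfl fun a _ => Finset.sum_congr rfl fun b _ => by ring
  have hi : ∀ a ∈ A, ∀ b ∈ A, Integrable (fun ω => w a * w b * (ε a ω * ε b ω)) P :=
    fun a ha b hb => ((hε a ha).integrable_mul (hε b hb)).const_mul _
  simp only [e]
  rw [integral_finsetSum _ fun a ha => integrable_finsetSum _ fun b hb => hi a ha b hb]
  refine Finset.sum_le_sum fun a ha => ?_
  rw [integral_finsetSum _ fun b hb => hi a ha b hb]
  refine Finset.sum_le_sum fun b hb => ?_
  rw [integral_const_mul]
  calc _ ≤ |w a * w b * ∫ ω, ε a ω * ε b ω ∂P| := le_abs_self _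
    _ = |w a| * |w b| * |∫ ω, ε a ω * ε b ω ∂P| := by rw [abs_mul, abs_mul]
    _ ≤ |w a| * |w b| * C a b := by gcongr; exact hC a ha b hb
    _ = _ := by ring

end NoiseSum

/-! ### Counts of measurement locations -/

section Counts

variable {Ω : Type*} [m₀ : MeasurableSpace Ω] {P : Measure Ω} {U : ℤ → ℕ → Ω → I}

/-- Number of the first `R` locations of curve `t` which lie in `J`. -/
def count (U : ℤ → ℕ → Ω → I) (R : ℕ) (J : Set I) (t : ℤ) (ω : Ω) : ℝ :=
  ∑ i ∈ Finset.range R, J.indicator (fun _ => (1 : ℝ)) (U t i ω)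

/-- σ-algebra generated by the locations of the curves in `S`. -/
@[reducible]
def designSigma (U : ℤ → ℕ → Ω → I) (S : Set ℤ) : MeasurableSpace Ω :=
  ⨆ p ∈ {p : ℤ × ℕ | p.1 ∈ S}, MeasurableSpace.comap (U p.1 p.2) inferInstance

lemma designSigma_le (hU : ∀ t i, Measurable (U t i)) (S : Set ℤ) : designSigma U S ≤ m₀ :=
  iSup₂_le fun p _ => (hU p.1 p.2).comap_le

lemma indep_designSigma (hU : ∀ t i, Measurable (U t i))
    (hi : iIndepFun (fun p : ℤ × ℕ => U p.1 p.2) P) {S T : Set ℤ} (hST : Disjoint S T) :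
    Indep (designSigma U S) (designSigma U T) P := by
  refine indep_iSup_of_disjoint (m := fun p : ℤ × ℕ => MeasurableSpace.comap (U p.1 p.2)
    inferInstance) (fun p => (hU p.1 p.2).comap_le) ((iIndepFun_iff_iIndep _ _ _).1 hi) ?_
  rw [Set.disjoint_left] at hST ⊢
  exact fun p h1 h2 => hST h1 h2

lemma measurable_count_designSigma {J : Set I} (hJ : MeasurableSet J) (R : ℕ) {t : ℤ} {S : Set ℤ}
    (ht : t ∈ S) : Measurable[designSigma U S] (count U R J t) := by
  refine Finset.measurable_fun_sum _ fun i _ => ?_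
  refine (measurable_const.indicator hJ).comp ((comap_measurable (U t i)).mono ?_ le_rfl)
  exact le_iSup₂_of_le (f := fun (p : ℤ × ℕ) (_ : p ∈ {p : ℤ × ℕ | p.1 ∈ S}) =>
    MeasurableSpace.comap (U p.1 p.2) inferInstance) (t, i) ht le_rfl

lemma measurable_count (hU : ∀ t i, Measurable (U t i)) {J : Set I} (hJ : MeasurableSet J) (R : ℕ)
    (t : ℤ) : Measurable (count U R J t) :=
  (measurable_count_designSigma hJ R (mem_singleton t)).mono (designSigma_le hU _) le_rfl

lemma count_nonneg (R : ℕ) (J : Set I) (t : ℤ) (ω : Ω) : 0 ≤ count U R J t ω :=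
  Finset.sum_nonneg fun _ _ => indicator_nonneg (fun _ _ => zero_le_one) _

lemma count_le (R : ℕ) (J : Set I) (t : ℤ) (ω : Ω) : count U R J t ω ≤ R := by
  calc count U R J t ω ≤ ∑ i ∈ Finset.range R, (1 : ℝ) :=
        Finset.sum_le_sum fun i _ => indicator_le_self' (fun _ _ => zero_le_one) _
    _ = R := by simp

variable [IsProbabilityMeasure P]

lemma integrable_of_designBound {f : Ω → ℝ} (hf : Measurable f) {B : ℝ}
    (h0 : ∀ ω, 0 ≤ f ω) (hB : ∀ ω, f ω ≤ B) : Integrable f P :=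
  Integrable.of_bound hf.aestronglyMeasurable B
    (ae_of_all _ fun ω => by rw [Real.norm_of_nonneg (h0 ω)]; exact hB ω)

lemma integral_mul_designSigma (hU : ∀ t i, Measurable (U t i))
    (hi : iIndepFun (fun p : ℤ × ℕ => U p.1 p.2) P) {S T : Set ℤ} (hST : Disjoint S T)
    {f g : Ω → ℝ} (hf : Measurable[designSigma U S] f) (hg : Measurable[designSigma U T] g) :
    ∫ ω, f ω * g ω ∂P = (∫ ω, f ω ∂P) * ∫ ω, g ω ∂P := by
  have : IndepFun f g P := indep_of_indep_of_le_left (indep_of_indep_of_le_right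
    (indep_designSigma hU hi hST) (measurable_iff_comap_le.1 hg)) (measurable_iff_comap_le.1 hf)
  exact this.integral_fun_mul_eq_mul_integral
    (hf.mono (designSigma_le hU _) le_rfl).aestronglyMeasurable
    (hg.mono (designSigma_le hU _) le_rfl).aestronglyMeasurable

variable {J : Set I} {p : ℝ}

lemma integral_indicator_location (hU : ∀ t i, Measurable (U t i)) (hJ : MeasurableSet J)
    (hp : ∀ t i, P.real (U t i ⁻¹' J) = p) (t : ℤ) (i : ℕ) :
    ∫ ω, J.indicator (fun _ => (1 : ℝ)) (U t i ω) ∂P = p := by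
  have : (fun ω => J.indicator (fun _ => (1 : ℝ)) (U t i ω)) =
      (U t i ⁻¹' J).indicator (fun _ => 1) := rfl
  rw [this, integral_indicator_const _ (hU t i hJ), hp]
  simp

lemma integrable_indicator_location (hU : ∀ t i, Measurable (U t i)) (hJ : MeasurableSet J)
    (t : ℤ) (i : ℕ) : Integrable (fun ω => J.indicator (fun _ => (1 : ℝ)) (U t i ω)) P :=
  integrable_of_designBound ((measurable_const.indicator hJ).comp (hU t i)) (B := 1)
    (fun _ => indicator_nonneg (fun _ _ => zero_le_one) _)
    (fun _ => indicator_le_self' (fun _ _ => zero_le_one) _)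

lemma integral_count (hU : ∀ t i, Measurable (U t i)) (hJ : MeasurableSet J)
    (hp : ∀ t i, P.real (U t i ⁻¹' J) = p) (R : ℕ) (t : ℤ) :
    ∫ ω, count U R J t ω ∂P = R * p := by
  unfold count
  rw [integral_finsetSum _ fun i _ => integrable_indicator_location hU hJ t i]
  simp [integral_indicator_location hU hJ hp]

/-- The diagonal contributes `R p`, since an indicator equals its square. Independence gives `p²`
off the diagonal, and `R² p²` bounds all of those terms. -/
lemma integral_count_sq_le (hU : ∀ t i, Measurable (U t i))
    (hi : iIndepFun (fun p : ℤ × ℕ => U p.1 p.2) P) (hJ : MeasurableSet J)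
    (hp : ∀ t i, P.real (U t i ⁻¹' J) = p) (R : ℕ) (t : ℤ) :
    ∫ ω, count U R J t ω ^ 2 ∂P ≤ R * p + (R * p) ^ 2 := by
  set f : ℕ → Ω → ℝ := fun i ω => J.indicator (fun _ => (1 : ℝ)) (U t i ω) with hf
  have f0 : ∀ i ω, 0 ≤ f i ω := fun i ω => indicator_nonneg (fun _ _ => zero_le_one) _
  have f1 : ∀ i ω, f i ω ≤ 1 := fun i ω => indicator_le_self' (fun _ _ => zero_le_one) _
  have fm : ∀ i, Measurable (f i) := fun i => (measurable_const.indicator hJ).comp (hU t i)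
  have fi : ∀ i j, Integrable (fun ω => f i ω * f j ω) P := fun i j =>
    integrable_of_designBound ((fm i).mul (fm j)) (B := 1)
      (fun ω => mul_nonneg (f0 i ω) (f0 j ω)) (fun ω => mul_le_one₀ (f1 i ω) (f0 j ω) (f1 j ω))
  have p0 : 0 ≤ p := by rw [← hp t 0]; exact measureReal_nonneg
  have e : ∀ ω, count U R J t ω ^ 2 =
      ∑ i ∈ Finset.range R, ∑ j ∈ Finset.range R, f i ω * f j ω := by
    intro ω; unfold count; rw [sq, Finset.sum_mul_sum]
  simp only [e]
  rw [integral_finsetSum _ fun i _ => integrable_finsetSum _ fun j _ => fi i j]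
  have hb : ∀ i j, ∫ ω, f i ω * f j ω ∂P ≤ (if i = j then p else 0) + p * p := by
    intro i j
    split_ifs with hij
    · subst hij
      have : ∀ ω, f i ω * f i ω = f i ω := by
        intro ω
        by_cases h : U t i ω ∈ J <;> simp [hf, h]
      simp only [this]
      rw [hf]
      simp only
      rw [integral_indicator_location hU hJ hp]
      nlinarith
    · have hind : IndepFun (f i) (f j) P :=
        (hi.indepFun (i := (t, i)) (j := (t, j)) (by simp [hij])).comp
          (φ := J.indicator (fun _ => (1 : ℝ))) (ψ := J.indicator (fun _ => (1 : ℝ)))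
          (measurable_const.indicator hJ) (measurable_const.indicator hJ)
      rw [hind.integral_fun_mul_eq_mul_integral (fm i).aestronglyMeasurable
        (fm j).aestronglyMeasurable, hf]
      simp only
      rw [integral_indicator_location hU hJ hp, integral_indicator_location hU hJ hp, zero_add]
  calc _ ≤ ∑ i ∈ Finset.range R, ∑ j ∈ Finset.range R, ((if i = j then p else 0) + p * p) := by
        refine Finset.sum_le_sum fun i _ => ?_
        rw [integral_finsetSum _ fun j _ => fi i j]
        exact Finset.sum_le_sum fun j _ => hb i j
    _ = _ := by
        simp only [Finset.sum_add_distrib, Finset.sum_ite_eq, Finset.sum_const, nsmul_eq_mul,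
          Finset.card_range]
        rw [Finset.sum_congr rfl (g := fun _ => p) fun i hi => by rw [if_pos hi]]
        simp only [Finset.sum_const, nsmul_eq_mul, Finset.card_range]
        ring

end Counts

/-! ### Moments and lower tails of counts in sets of given probability. -/

section Counts

variable {Ω : Type*} [m₀ : MeasurableSpace Ω] {P : Measure Ω} {U : ℤ → ℕ → Ω → I}
  [IsProbabilityMeasure P]

/-- Bound for the second moment of a count with mean `x`. -/
def countSq (x : ℝ) : ℝ := x + x ^ 2

/-- A family of locations with common hitting probabilities. -/
structure Locations (P : Measure Ω) (U : ℤ → ℕ → Ω → I) (J : Set I) (p : ℝ) : Prop where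
  measurable : ∀ t i, Measurable (U t i)
  indep : iIndepFun (fun q : ℤ × ℕ => U q.1 q.2) P
  set : MeasurableSet J
  prob : ∀ t i, P.real (U t i ⁻¹' J) = p

namespace Locations

variable {J₁ J₂ : Set I} {p₁ p₂ : ℝ}

lemma nonneg (h₁ : Locations P U J₁ p₁) : 0 ≤ p₁ := by
  rw [← h₁.prob 0 0]; exact measureReal_nonneg

lemma integral_mul (h₁ : Locations P U J₁ p₁) (h₂ : Locations P U J₂ p₂) (R₁ R₂ : ℕ) {t t' : ℤ}
    (ht : t ≠ t') : ∫ ω, count U R₁ J₁ t ω * count U R₂ J₂ t' ω ∂P = (R₁ * p₁) * (R₂ * p₂) := by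
  rw [integral_mul_designSigma h₁.measurable h₁.indep (S := {t}) (T := {t'}) (by simpa using ht)
    (measurable_count_designSigma h₁.set R₁ rfl) (measurable_count_designSigma h₂.set R₂ rfl),
    integral_count h₁.measurable h₁.set h₁.prob, integral_count h₁.measurable h₂.set h₂.prob]

lemma integral_sq_le (h₁ : Locations P U J₁ p₁) (R : ℕ) (t : ℤ) :
    ∫ ω, count U R J₁ t ω ^ 2 ∂P ≤ countSq (R * p₁) :=
  integral_count_sq_le h₁.measurable h₁.indep h₁.set h₁.prob R t

lemma integral_mul_sq_le (h₁ : Locations P U J₁ p₁) (h₂ : Locations P U J₂ p₂) (R₁ R₂ : ℕ) {t t' : ℤ}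
    (ht : t ≠ t') : ∫ ω, (count U R₁ J₁ t ω * count U R₂ J₂ t' ω) ^ 2 ∂P ≤
      countSq (R₁ * p₁) * countSq (R₂ * p₂) := by
  simp only [mul_pow]
  rw [integral_mul_designSigma h₁.measurable h₁.indep (S := {t}) (T := {t'}) (by simpa using ht)
    (f := fun ω => count U R₁ J₁ t ω ^ 2) (g := fun ω => count U R₂ J₂ t' ω ^ 2)
    ((measurable_count_designSigma h₁.set R₁ (mem_singleton t)).pow_const 2)
    ((measurable_count_designSigma h₂.set R₂ (mem_singleton t')).pow_const 2)]
  exact mul_le_mul (h₁.integral_sq_le R₁ t) (h₂.integral_sq_le R₂ t')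
    (integral_nonneg fun _ => sq_nonneg _)
    ((integral_nonneg fun _ => sq_nonneg _).trans (h₁.integral_sq_le R₁ t))

lemma integral_le_half {f g : Ω → ℝ} {Q : ℝ} (hf : Integrable (fun ω => f ω ^ 2) P)
    (hg : Integrable (fun ω => g ω ^ 2) P) (hf0 : ∀ ω, 0 ≤ f ω) (hg0 : ∀ ω, 0 ≤ g ω)
    (hfQ : ∫ ω, f ω ^ 2 ∂P ≤ Q) (hgQ : ∫ ω, g ω ^ 2 ∂P ≤ Q) : ∫ ω, f ω * g ω ∂P ≤ Q := by
  calc ∫ ω, f ω * g ω ∂P ≤ ∫ ω, (1 / 2 * f ω ^ 2 + 1 / 2 * g ω ^ 2) ∂P := by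
        refine integral_mono_of_nonneg (ae_of_all _ fun ω => mul_nonneg (hf0 ω) (hg0 ω))
          ((hf.const_mul _).add (hg.const_mul _)) (ae_of_all _ fun ω => ?_)
        simp only
        nlinarith [sq_nonneg (f ω - g ω)]
    _ ≤ Q := by
        rw [integral_add (hf.const_mul _) (hg.const_mul _), integral_const_mul, integral_const_mul]
        linarith

lemma integrable_prod_sq (h₁ : Locations P U J₁ p₁) (h₂ : Locations P U J₂ p₂) (R₁ R₂ : ℕ)
    (t t' : ℤ) : Integrable (fun ω => (count U R₁ J₁ t ω * count U R₂ J₂ t' ω) ^ 2) P :=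
  integrable_of_designBound (((measurable_count h₁.measurable h₁.set R₁ t).mul
    (measurable_count h₁.measurable h₂.set R₂ t')).pow_const 2) (B := ((R₁ : ℝ) * R₂) ^ 2)
    (fun _ => sq_nonneg _) fun _ => pow_le_pow_left₀
      (mul_nonneg (count_nonneg _ _ _ _) (count_nonneg _ _ _ _))
      (mul_le_mul (count_le _ _ _ _) (count_le _ _ _ _) (count_nonneg _ _ _ _) (by positivity)) 2

/-- Without separation of `t` and `t'` the two pairs may use the same curve, so the product is
bounded by the mean of its squares; within each pair the curves differ because `k ≥ 1`. -/
lemma integral_four_le (h₁ : Locations P U J₁ p₁) (h₂ : Locations P U J₂ p₂) (R₁ R₂ : ℕ) {k : ℕ}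
    (hk : 1 ≤ k) (t t' : ℤ) :
    ∫ ω, (count U R₁ J₁ t ω * count U R₂ J₂ (t + k) ω) *
      (count U R₁ J₁ t' ω * count U R₂ J₂ (t' + k) ω) ∂P ≤ countSq (R₁ * p₁) * countSq (R₂ * p₂) :=
  integral_le_half (f := fun ω => count U R₁ J₁ t ω * count U R₂ J₂ (t + k) ω)
    (g := fun ω => count U R₁ J₁ t' ω * count U R₂ J₂ (t' + k) ω) (h₁.integrable_prod_sq h₂ R₁ R₂ _ _) (h₁.integrable_prod_sq h₂ R₁ R₂ _ _)
    (fun _ => mul_nonneg (count_nonneg _ _ _ _) (count_nonneg _ _ _ _))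
    (fun _ => mul_nonneg (count_nonneg _ _ _ _) (count_nonneg _ _ _ _))
    (h₁.integral_mul_sq_le h₂ R₁ R₂ (by omega)) (h₁.integral_mul_sq_le h₂ R₁ R₂ (by omega))

/-- A gap larger than `k` makes all four curves distinct, so the expectation factorises. -/
lemma integral_four_of_gap (h₁ : Locations P U J₁ p₁) (h₂ : Locations P U J₂ p₂) (R₁ R₂ : ℕ) {k : ℕ}
    (hk : 1 ≤ k) {t t' : ℤ} (hgap : (k : ℤ) < |t - t'|) :
    ∫ ω, (count U R₁ J₁ t ω * count U R₂ J₂ (t + k) ω) *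
      (count U R₁ J₁ t' ω * count U R₂ J₂ (t' + k) ω) ∂P = ((R₁ * p₁) * (R₂ * p₂)) ^ 2 := by
  have hd : Disjoint ({t, t + (k : ℤ)} : Set ℤ) {t', t' + (k : ℤ)} := by
    rw [Set.disjoint_left]
    rcases abs_cases (t - t') with h | h
    · rintro x (rfl | rfl) (h' | h') <;> first | omega | (rw [Set.mem_singleton_iff] at h'; omega)
    · rintro x (rfl | rfl) (h' | h') <;> first | omega | (rw [Set.mem_singleton_iff] at h'; omega)
  rw [integral_mul_designSigma h₁.measurable h₁.indep hd
    (f := fun ω => count U R₁ J₁ t ω * count U R₂ J₂ (t + k) ω)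
    (g := fun ω => count U R₁ J₁ t' ω * count U R₂ J₂ (t' + k) ω)
    ((measurable_count_designSigma h₁.set R₁ (by simp)).mul
      (measurable_count_designSigma h₂.set R₂ (by simp)))
    ((measurable_count_designSigma h₁.set R₁ (by simp)).mul
      (measurable_count_designSigma h₂.set R₂ (by simp))),
    h₁.integral_mul h₂ R₁ R₂ (by omega), h₁.integral_mul h₂ R₁ R₂ (by omega), sq]

/-- Lower tail of the total number of locations in `J₁` over the curves in `F`. -/
lemma sum_lower_tail (h₁ : Locations P U J₁ p₁) (hp : 0 < p₁) (R : ℕ) (F : Finset ℤ) :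
    P.real {ω | ∑ t ∈ F, count U R J₁ t ω ≤ F.card * (R * p₁) / 2} ≤
      Real.exp (-(F.card * (R * p₁) / 8)) := by
  set ξ : ℤ × ℕ → Ω → ℝ := fun q ω => J₁.indicator (fun _ => (1 : ℝ)) (U q.1 q.2 ω) with hξ
  have ξm : ∀ q, Measurable (ξ q) :=
    fun q => (measurable_const.indicator h₁.set).comp (h₁.measurable q.1 q.2)
  have ξi : iIndepFun ξ P := h₁.indep.comp (fun _ => J₁.indicator (fun _ => (1 : ℝ)))
    fun _ => measurable_const.indicator h₁.set
  have ξ1 : ∀ q, ∫ ω, ξ q ω ∂P = p₁ := fun q =>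
    integral_indicator_location h₁.measurable h₁.set h₁.prob q.1 q.2
  -- The locations themselves are the independent summands. For an indicator the second moment
  -- equals the mean, so `μ² / m₂` reduces to `p₁`.
  have := lower_tail P (F ×ˢ Finset.range R) ξ ξm
    (fun q ω => indicator_nonneg (fun _ _ => zero_le_one) _) 1
    (fun q ω => indicator_le_self' (fun _ _ => zero_le_one) _)
    (fun τ => ξi.mgf_sum ξm _) p₁ p₁ hp.le hp (fun q _ => (ξ1 q).ge) (fun q _ => by
      have e : ∀ ω, ξ q ω ^ 2 = ξ q ω := fun ω => by
        by_cases hq : U q.1 q.2 ω ∈ J₁ <;> simp [hξ, hq]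
      simp only [e]
      exact (ξ1 q).le)
  simp only [Finset.sum_product, Finset.card_product, Finset.card_range] at this
  have e1 : p₁ ^ 2 / p₁ = p₁ := by field_simp
  rw [e1] at this
  convert this using 3
  · push_cast; ring_nf; rfl
  · push_cast; ring

/-- Lower tail of the number of pairs of locations in `J₁ × J₂`, over well separated times. -/
lemma pair_lower_tail (h₁ : Locations P U J₁ p₁) (h₂ : Locations P U J₂ p₂) (R : ℕ) {k : ℕ}
    (hk : 1 ≤ k) (N : ℕ) (hp₁ : 0 < R * p₁) (hp₂ : 0 < R * p₂) :
    P.real {ω | ∑ r ∈ Finset.range N,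
        count U R J₁ (1 + 2 * k * r) ω * count U R J₂ (1 + 2 * k * r + k) ω ≤
        N * ((R * p₁) * (R * p₂)) / 2} ≤
      Real.exp (-(N * (((R * p₁) * (R * p₂)) ^ 2 / (countSq (R * p₁) * countSq (R * p₂))) / 8)) := by
  set ξ : ℕ → Ω → ℝ := fun r ω =>
    count U R J₁ (1 + 2 * k * r) ω * count U R J₂ (1 + 2 * k * r + k) ω with hξ
  have ξm : ∀ r, Measurable (ξ r) := fun r =>
    (measurable_count h₁.measurable h₁.set R _).mul (measurable_count h₁.measurable h₂.set R _)
  -- Times `2k` apart give disjoint pairs of curves, so the products are independent. Induction on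
  -- the number of blocks: those with index below `M` only use curves before time `1 + 2kM`.
  have hmgf : ∀ (M : ℕ) (τ : ℝ), mgf (∑ r ∈ Finset.range M, ξ r) P τ =
      ∏ r ∈ Finset.range M, mgf (ξ r) P τ := by
    intro M τ
    induction M with
    | zero => simp [mgf_zero_fun]
    | succ M ih =>
      have hd : Disjoint {x : ℤ | x < 1 + 2 * k * M} {x : ℤ | 1 + 2 * k * M ≤ x} := by
        rw [Set.disjoint_left]; intro x h h'; simp only [mem_ofPred_eq] at h h'; omega
      have hI : IndepFun (∑ r ∈ Finset.range M, ξ r) (ξ M) P := by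
        refine indep_of_indep_of_le_left (indep_of_indep_of_le_right
          (indep_designSigma h₁.measurable h₁.indep hd) (measurable_iff_comap_le.1 ?_))
          (measurable_iff_comap_le.1 ?_)
        · exact (measurable_count_designSigma h₁.set R (by simp)).mul
            (measurable_count_designSigma h₂.set R (by simp))
        · rw [Finset.sum_fn]
          refine Finset.measurable_fun_sum _ fun r hr => ?_
          have hr' : r < M := Finset.mem_range.1 hr
          have h3 : 2 * (k : ℤ) * r + 2 * k ≤ 2 * k * M := by
            have : (r : ℤ) + 1 ≤ M := by exact_mod_cast hr'
            nlinarith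
          exact (measurable_count_designSigma h₁.set R (by simp only [mem_ofPred_eq]; omega)).mul
            (measurable_count_designSigma h₂.set R (by simp only [mem_ofPred_eq]; omega))
      rw [Finset.sum_range_succ, Finset.prod_range_succ, hI.mgf_add, ih]
      · have : Measurable (∑ r ∈ Finset.range M, ξ r) := by
          rw [Finset.sum_fn]; exact Finset.measurable_fun_sum _ fun r _ => ξm r
        exact (this.const_mul τ).exp.aestronglyMeasurable
      · exact ((ξm M).const_mul τ).exp.aestronglyMeasurable
  have := lower_tail P (Finset.range N) ξ ξm
    (fun r ω => mul_nonneg (count_nonneg _ _ _ _) (count_nonneg _ _ _ _)) (R * R)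
    (fun r ω => mul_le_mul (count_le _ _ _ _) (count_le _ _ _ _) (count_nonneg _ _ _ _)
      (by positivity))
    (hmgf N) ((R * p₁) * (R * p₂)) (countSq (R * p₁) * countSq (R * p₂)) (by positivity)
    (by unfold countSq; positivity)
    (fun r _ => (h₁.integral_mul h₂ R R (by omega)).ge)
    (fun r _ => h₁.integral_mul_sq_le h₂ R R (by omega))
  simpa only [Finset.card_range] using this

/-- Two bounds for two regimes. The Bernstein bound is the useful one for small `z`, but it
saturates at `exp(-N/8)` and so does not improve as the number of locations per curve grows. The
other one asks every single count to exceed half its mean, whose failure probability decays in `z`;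
products of two such counts exceed `z²/4`, whence the constant. -/
lemma pair_lower_tail_min (h₁ : Locations P U J₁ p₁) (h₂ : Locations P U J₂ p₂) (R : ℕ) {k : ℕ}
    (hk : 1 ≤ k) {N : ℕ} (hN : 0 < N) {z : ℝ} (hz : 0 < z) (hz₁ : z ≤ R * p₁) (hz₂ : z ≤ R * p₂) :
    P.real {ω | ∑ r ∈ Finset.range N,
        count U R J₁ (1 + 2 * k * r) ω * count U R J₂ (1 + 2 * k * r + k) ω ≤ N * z ^ 2 / 4} ≤
      min (Real.exp (-(N * (z / (1 + z)) ^ 2 / 8))) (2 * N * Real.exp (-(z / 8))) := by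
  have hx₁ : 0 < R * p₁ := hz.trans_le hz₁
  have hx₂ : 0 < R * p₂ := hz.trans_le hz₂
  have hzz : z ^ 2 ≤ (R * p₁) * (R * p₂) := by rw [sq]; exact mul_le_mul hz₁ hz₂ hz.le hx₁.le
  refine le_min ?_ ?_
  · refine (measureReal_mono ?_).trans
      ((h₁.pair_lower_tail h₂ R hk N hx₁ hx₂).trans (Real.exp_le_exp.2 ?_))
    · intro ω hω
      simp only [mem_ofPred_eq] at hω ⊢
      refine hω.trans ?_
      have : (N : ℝ) * z ^ 2 ≤ N * ((R * p₁) * (R * p₂)) := by gcongr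
      have : 0 ≤ (N : ℝ) * z ^ 2 := by positivity
      linarith
    · have hmono : ∀ x : ℝ, z ≤ x → z / (1 + z) ≤ x / (1 + x) := by
        intro x hx
        rw [div_le_div_iff₀ (by positivity) (by linarith)]
        nlinarith
      have e : ((R * p₁) * (R * p₂)) ^ 2 / (countSq (R * p₁) * countSq (R * p₂)) =
          ((R * p₁) / (1 + R * p₁)) * ((R * p₂) / (1 + R * p₂)) := by
        unfold countSq
        field_simp
      have h4 : (z / (1 + z)) ^ 2 ≤
          ((R * p₁) / (1 + R * p₁)) * ((R * p₂) / (1 + R * p₂)) := by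
        rw [sq]
        exact mul_le_mul (hmono _ hz₁) (hmono _ hz₂) (by positivity) (by positivity)
      rw [e]
      have : (N : ℝ) * (z / (1 + z)) ^ 2 ≤
          N * (((R * p₁) / (1 + R * p₁)) * ((R * p₂) / (1 + R * p₂))) := by gcongr
      linarith
  · have hp₁ : 0 < p₁ := pos_of_mul_pos_right hx₁ (by positivity)
    have hp₂ : 0 < p₂ := pos_of_mul_pos_right hx₂ (by positivity)
    have key : ∀ {J : Set I} {p : ℝ}, Locations P U J p → 0 < p → z ≤ R * p → ∀ t : ℤ,
        P.real {ω | count U R J t ω ≤ R * p / 2} ≤ Real.exp (-(z / 8)) := by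
      intro J p h hp hzp t
      have := h.sum_lower_tail hp R {t}
      simp only [Finset.sum_singleton, Finset.card_singleton, Nat.cast_one, one_mul] at this
      exact this.trans (Real.exp_le_exp.2 (by linarith))
    have hsub : {ω | ∑ r ∈ Finset.range N,
        count U R J₁ (1 + 2 * k * r) ω * count U R J₂ (1 + 2 * k * r + k) ω ≤ N * z ^ 2 / 4} ⊆
        ⋃ r ∈ Finset.range N, ({ω | count U R J₁ (1 + 2 * k * r) ω ≤ R * p₁ / 2} ∪
          {ω | count U R J₂ (1 + 2 * k * r + k) ω ≤ R * p₂ / 2}) := by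
      intro ω hω
      by_contra hcon
      simp only [mem_iUnion, mem_union, mem_ofPred_eq, not_exists, not_or, not_le] at hcon
      have hlt : ∑ _r ∈ Finset.range N, z ^ 2 / 4 < ∑ r ∈ Finset.range N,
          count U R J₁ (1 + 2 * k * r) ω * count U R J₂ (1 + 2 * k * r + k) ω := by
        refine Finset.sum_lt_sum_of_nonempty (Finset.nonempty_range_iff.2 hN.ne') fun r hr => ?_
        obtain ⟨c1, c2⟩ := hcon r hr
        nlinarith
      simp only [Finset.sum_const, Finset.card_range, nsmul_eq_mul] at hlt
      have := hω.out
      linarith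
    refine (measureReal_mono hsub (measure_ne_top _ _)).trans ((measureReal_biUnion_finset_le _ _).trans ?_)
    calc _ ≤ ∑ _r ∈ Finset.range N, (Real.exp (-(z / 8)) + Real.exp (-(z / 8))) :=
          Finset.sum_le_sum fun r _ => (measureReal_union_le _ _).trans
            (add_le_add (key h₁ hp₁ hz₁ _) (key h₂ hp₂ hz₂ _))
      _ = _ := by
          simp only [Finset.sum_const, Finset.card_range, nsmul_eq_mul]; ring

end Locations

end Counts

/-! ### Deterministic bounds for local linear fits -/

/-- Error of a weighted least squares fit, relative to any approximate fit `β`. -/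
lemma leastSquares_error {ι : Type*} (s : Finset ι) {d : ℕ} (w : ι → ℝ) (X : ι → Fin d → ℝ)
    (y ε r : ι → ℝ) (b β : Fin d → ℝ) {c : ℝ} (hc : 0 < c) (hw : ∀ a ∈ s, 0 ≤ w a)
    (hdes : c * ∑ p, (b p - β p) ^ 2 ≤ ∑ a ∈ s, w a * (∑ p, (b p - β p) * X a p) ^ 2)
    (hmin : ∑ a ∈ s, w a * (y a - ∑ p, b p * X a p) ^ 2 ≤
      ∑ a ∈ s, w a * (y a - ∑ p, β p * X a p) ^ 2)
    (hy : ∀ a ∈ s, y a = ∑ p, β p * X a p + ε a + r a) :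
    ∑ p, (b p - β p) ^ 2 ≤
      16 / c ^ 2 * ∑ p, (∑ a ∈ s, w a * X a p * ε a) ^ 2 + 8 / c * ∑ a ∈ s, w a * r a ^ 2 := by
  set Δ := ∑ p, (b p - β p) ^ 2
  set ℓ : ι → ℝ := fun a => ∑ p, (b p - β p) * X a p with hℓ
  set D := ∑ a ∈ s, w a * ℓ a ^ 2
  set T := ∑ a ∈ s, w a * r a ^ 2
  have hb : ∀ a, ∑ p, b p * X a p = ∑ p, β p * X a p + ℓ a := by
    intro a
    rw [hℓ, ← Finset.sum_add_distrib]
    exact Finset.sum_congr rfl fun p _ => by ring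
  -- The basic inequality: expand the loss of the minimizer around the loss of `β`.
  have h1 : D ≤ 2 * ∑ a ∈ s, w a * (ε a * ℓ a) + 2 * ∑ a ∈ s, w a * (r a * ℓ a) := by
    have e : ∑ a ∈ s, w a * (y a - ∑ p, b p * X a p) ^ 2 =
        ∑ a ∈ s, w a * (y a - ∑ p, β p * X a p) ^ 2 + D -
          (2 * ∑ a ∈ s, w a * (ε a * ℓ a) + 2 * ∑ a ∈ s, w a * (r a * ℓ a)) := by
      rw [Finset.mul_sum, Finset.mul_sum, ← Finset.sum_add_distrib, ← Finset.sum_add_distrib,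
        ← Finset.sum_sub_distrib]
      refine Finset.sum_congr rfl fun a ha => ?_
      rw [hb, hy a ha]
      ring
    linarith
  have h2 : 2 * ∑ a ∈ s, w a * (r a * ℓ a) ≤ D / 2 + 2 * T := by
    rw [Finset.mul_sum, Finset.mul_sum, Finset.sum_div, ← Finset.sum_add_distrib]
    refine Finset.sum_le_sum fun a ha => ?_
    nlinarith [mul_nonneg (hw a ha) (sq_nonneg (ℓ a - 2 * r a))]
  have h3 : ∑ a ∈ s, w a * (ε a * ℓ a) =
      ∑ p, (b p - β p) * ∑ a ∈ s, w a * X a p * ε a := by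
    simp only [hℓ, Finset.mul_sum]
    rw [Finset.sum_comm]
    exact Finset.sum_congr rfl fun p _ => Finset.sum_congr rfl fun a _ => by ring
  have h4 : 2 * ∑ a ∈ s, w a * (ε a * ℓ a) ≤
      c / 4 * Δ + 4 / c * ∑ p, (∑ a ∈ s, w a * X a p * ε a) ^ 2 := by
    rw [h3, Finset.mul_sum, Finset.mul_sum, Finset.mul_sum, ← Finset.sum_add_distrib]
    refine Finset.sum_le_sum fun p _ => ?_
    set x := b p - β p
    set z := ∑ a ∈ s, w a * X a p * ε a
    have : c / 4 * x ^ 2 + 4 / c * z ^ 2 - 2 * (x * z) = 1 / (4 * c) * (c * x - 4 * z) ^ 2 := by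
      field_simp; ring
    have h5 : 0 ≤ 1 / (4 * c) * (c * x - 4 * z) ^ 2 := by positivity
    linarith
  set S := ∑ p, (∑ a ∈ s, w a * X a p * ε a) ^ 2
  -- Half of `D` is absorbed by the remainder term. The other half is at least `c/2 * Δ`, of which
  -- `c/4 * Δ` absorbs the noise term.
  have h6 : c / 4 * Δ ≤ 4 / c * S + 2 * T := by linarith
  calc Δ = 4 / c * (c / 4 * Δ) := by field_simp
    _ ≤ 4 / c * (4 / c * S + 2 * T) := by gcongr
    _ = _ := by field_simp; ring

/-- Uniform second-order Taylor bound for a function of class `C²` on a compact convex set. -/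
lemma exists_taylor_bound {E : Type*} [NormedAddCommGroup E] [NormedSpace ℝ E] {s : Set E}
    (hs : Convex ℝ s) (hc : IsCompact s) (hu : UniqueDiffOn ℝ s) {g : E → ℝ}
    (hg : ContDiffOn ℝ 2 g s) :
    ∃ M : ℝ, 0 ≤ M ∧ ∀ p ∈ s, ∃ l : E →L[ℝ] ℝ, ∀ q ∈ s,
      |g q - g p - l (q - p)| ≤ M * ‖q - p‖ ^ 2 := by
  have hg1 : ContDiffOn ℝ 1 (fderivWithin ℝ g s) s := hg.fderivWithin hu (by norm_num)
  have hcont : ContinuousOn (fderivWithin ℝ (fderivWithin ℝ g s) s) s :=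
    hg1.continuousOn_fderivWithin hu (by norm_num)
  obtain ⟨M, hM⟩ := hc.exists_bound_of_continuousOn (E := E →L[ℝ] E →L[ℝ] ℝ) hcont
  have hM0 : ∀ x ∈ s, ‖fderivWithin ℝ (fderivWithin ℝ g s) s x‖ ≤ max M 0 :=
    fun x hx => (hM x hx).trans (le_max_left _ _)
  have hlip : ∀ x ∈ s, ∀ y ∈ s, ‖fderivWithin ℝ g s y - fderivWithin ℝ g s x‖ ≤
      max M 0 * ‖y - x‖ := fun x hx y hy =>
    hs.norm_image_sub_le_of_norm_fderivWithin_le (hg1.differentiableOn (by norm_num)) hM0 hx hy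
  refine ⟨max M 0, le_max_right _ _, fun p hp => ⟨fderivWithin ℝ g s p, fun q hq => ?_⟩⟩
  have hseg : segment ℝ p q ⊆ s := hs.segment_subset hp hq
  have hd : DifferentiableOn ℝ g s := hg.differentiableOn (by norm_num)
  -- Mean value inequality on the segment, along which the derivative stays within `M ‖q - p‖` of
  -- its value at `p`.
  have := (convex_segment p q).norm_image_sub_le_of_norm_hasFDerivWithin_le'
    (f := g) (f' := fderivWithin ℝ g s) (φ := fderivWithin ℝ g s p) (C := max M 0 * ‖q - p‖)
    (fun x hx => ((hd x (hseg hx)).hasFDerivWithinAt).mono hseg)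
    (fun x hx => by
      refine (hlip p hp x (hseg hx)).trans ?_
      gcongr
      obtain ⟨a, b, ha, hb, hab, rfl⟩ := hx
      have : a • p + b • q - p = b • (q - p) := by
        have : a = 1 - b := by linarith
        rw [this, sub_smul, smul_sub, one_smul]; abel
      rw [this, norm_smul, Real.norm_of_nonneg hb]
      exact mul_le_of_le_one_left (norm_nonneg _) (by linarith))
    (left_mem_segment ℝ p q) (right_mem_segment ℝ p q)
  rw [Real.norm_eq_abs] at this
  refine this.trans (le_of_eq ?_)
  ring

/-- A smoothing kernel is bounded, and bounded below on an interval and its mirror image. -/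
lemma IsSmoothingKernel.exists_bounds {K : ℝ → ℝ} (hK : IsSmoothingKernel K) :
    (∃ B : ℝ, 0 < B ∧ ∀ x, K x ≤ B) ∧
    ∃ α δ κ : ℝ, 0 ≤ α ∧ 0 < δ ∧ α + 6 * δ ≤ 1 ∧ 0 < κ ∧
      ∀ x, α ≤ x → x ≤ α + 6 * δ → κ ≤ K x ∧ κ ≤ K (-x) := by
  obtain ⟨c, hc⟩ := hK.lipschitz
  constructor
  -- The kernel vanishes at `2`, and every point of `[-1, 1]` is within distance `3` of it.
  · refine ⟨3 * c + 1, by positivity, fun x => ?_⟩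
    by_cases hx : 1 < |x|
    · rw [hK.support x hx]; positivity
    · have h1 := hc.dist_le_mul x 2
      rw [hK.support 2 (by norm_num), Real.dist_eq, Real.dist_eq, sub_zero] at h1
      have h2 : |x - 2| ≤ 3 := by
        have := abs_le.1 (not_lt.1 hx)
        rw [abs_le]; constructor <;> linarith [this.1, this.2]
      have h3 : (c : ℝ) * |x - 2| ≤ c * 3 := by gcongr
      linarith [le_abs_self (K x)]
  · obtain ⟨x, hx⟩ : ∃ x, 0 < K x := by
      by_contra hcon
      push Not at hcon
      have h0 : ∀ x, K x = 0 := fun x => le_antisymm (hcon x) (hK.nonneg x)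
      have := hK.integral
      simp [h0] at this
    wlog hx0 : 0 ≤ x generalizing x
    · exact this (-x) (by rw [hK.symm]; exact hx) (by linarith)
    have hcont : Continuous K := hc.continuous
    have hev : ∀ᶠ y in 𝓝 x, K x / 2 < K y := hcont.continuousAt.eventually_const_lt (by linarith)
    obtain ⟨e, he, hball⟩ := Metric.eventually_nhds_iff.1 hev
    have hpos : ∀ y, x ≤ y → y ≤ x + e / 2 → K x / 2 < K y := fun y h1 h2 =>
      hball (by rw [Real.dist_eq, abs_of_nonneg (by linarith)]; linarith)
    -- Length `6 δ` leaves room for two slots of length `2 δ`, each containing a grid cell after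
    -- scaling, with a gap `2 δ` between them.
    refine ⟨x, e / 12, K x / 2, hx0, by positivity, ?_, by positivity, fun y h1 h2 => ?_⟩
    · by_contra hcon
      push Not at hcon
      -- The interval stays inside `[0, 1]` because the kernel is positive at its right end.
      have h1 := hpos (x + 6 * (e / 12)) (by linarith) (by linarith)
      rw [hK.support (x + 6 * (e / 12)) (by rw [abs_of_nonneg (by positivity)]; exact hcon)] at h1
      linarith
    · have := hpos y h1 (by linarith)
      rw [hK.symm]
      exact ⟨this.le, this.le⟩

/-! ### Grid cells inside smoothing windows -/

/-- The `j`-th cell of mesh `d`. -/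
def cell (d : ℝ) (j : ℕ) : Set I := {x | j * d ≤ (x : ℝ) ∧ (x : ℝ) ≤ (j + 1) * d}

lemma cell_end_le {d : ℝ} (hd : 0 < d) {j : ℕ} (hj : j < ⌊1 / d⌋₊) : (j + 1) * d ≤ 1 := by
  have h1 : ((j + 1 : ℕ) : ℝ) ≤ 1 / d := (Nat.le_floor_iff (by positivity)).1 hj
  rw [le_div_iff₀ hd] at h1
  exact_mod_cast h1

lemma exists_cell {d x₀ : ℝ} (hd : 0 < d) (h0 : 0 ≤ x₀) (h1 : x₀ + 2 * d ≤ 1) :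
    ∃ j < ⌊1 / d⌋₊, x₀ ≤ j * d ∧ (j + 1) * d ≤ x₀ + 2 * d := by
  have h2 := Nat.le_ceil (x₀ / d)
  have h3 := Nat.ceil_lt_add_one (a := x₀ / d) (by positivity)
  rw [div_le_iff₀ hd] at h2
  have h4 : (⌈x₀ / d⌉₊ + 1) * d ≤ x₀ + 2 * d := by
    have : (⌈x₀ / d⌉₊ : ℝ) * d ≤ (x₀ / d + 1) * d := by gcongr
    have e : (x₀ / d + 1) * d = x₀ + d := by field_simp
    linarith
  refine ⟨⌈x₀ / d⌉₊, ?_, h2, h4⟩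
  rw [Nat.lt_iff_add_one_le, Nat.le_floor_iff (by positivity), le_div_iff₀ hd]
  push_cast
  linarith

lemma cell_diff {d : ℝ} {j : ℕ} {x y : I} (hx : x ∈ cell d j) (hy : y ∈ cell d j) :
    |(y : ℝ) - x| ≤ d := by
  have h1 := hx.1; have h2 := hx.2; have h3 := hy.1; have h4 := hy.2
  rw [abs_le]
  constructor <;> linarith

/-- Every smoothing window contains two well separated grid cells on which the kernel is bounded
below. -/
lemma exists_cells {K : ℝ → ℝ} {α δ κ : ℝ} (hα : 0 ≤ α) (hδ : 0 < δ) (hα1 : α + 6 * δ ≤ 1)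
    (hκ : ∀ x, α ≤ x → x ≤ α + 6 * δ → κ ≤ K x ∧ κ ≤ K (-x)) {h : ℝ} (hh : 0 < h)
    (hh2 : h ≤ 1 / 2) (u : I) :
    ∃ j₁ < ⌊1 / (δ * h)⌋₊, ∃ j₂ < ⌊1 / (δ * h)⌋₊,
      (∀ x ∈ cell (δ * h) j₁, κ ≤ K ((x - u) / h) ∧ |((x : ℝ) - u) / h| ≤ 1) ∧
      (∀ x ∈ cell (δ * h) j₂, κ ≤ K ((x - u) / h) ∧ |((x : ℝ) - u) / h| ≤ 1) ∧
      ∀ x ∈ cell (δ * h) j₁, ∀ y ∈ cell (δ * h) j₂,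
        2 * δ ≤ |((y : ℝ) - u) / h - (x - u) / h| := by
  have hd : 0 < δ * h := by positivity
  have u0 : (0 : ℝ) ≤ u := u.2.1
  have u1 : (u : ℝ) ≤ 1 := u.2.2
  have hα1h : (α + 6 * δ) * h ≤ 1 * h := by gcongr
  have hαh : 0 ≤ α * h := by positivity
  -- Use only the half of the window pointing to the interior of `[0, 1]`: with `h ≤ 1/2` it never
  -- leaves the interval, so boundary points need no separate treatment.
  rcases le_total (u : ℝ) (1 / 2) with hu | hu
  · obtain ⟨j₁, hj₁, a1, a2⟩ := exists_cell hd (x₀ := u + α * h) (by linarith) (by linarith)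
    obtain ⟨j₂, hj₂, b1, b2⟩ := exists_cell hd (x₀ := u + (α + 4 * δ) * h) (by nlinarith)
      (by linarith)
    refine ⟨j₁, hj₁, j₂, hj₂, fun x hx => ?_, fun x hx => ?_, fun x hx y hy => ?_⟩
    · have h1 := hx.1; have h2 := hx.2
      have l1 : α ≤ ((x : ℝ) - u) / h := by rw [le_div_iff₀ hh]; linarith
      have l2 : ((x : ℝ) - u) / h ≤ α + 6 * δ := by rw [div_le_iff₀ hh]; linarith
      exact ⟨(hκ _ l1 l2).1, by rw [abs_of_nonneg (by linarith)]; linarith⟩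
    · have h1 := hx.1; have h2 := hx.2
      have l1 : α ≤ ((x : ℝ) - u) / h := by rw [le_div_iff₀ hh]; linarith
      have l2 : ((x : ℝ) - u) / h ≤ α + 6 * δ := by rw [div_le_iff₀ hh]; linarith
      exact ⟨(hκ _ l1 l2).1, by rw [abs_of_nonneg (by linarith)]; linarith⟩
    · have h2 := hx.2; have h3 := hy.1
      refine le_trans ?_ (le_abs_self _)
      rw [← sub_div, le_div_iff₀ hh]
      linarith
  · obtain ⟨j₁, hj₁, a1, a2⟩ := exists_cell hd (x₀ := u - (α + 6 * δ) * h) (by linarith)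
      (by nlinarith)
    obtain ⟨j₂, hj₂, b1, b2⟩ := exists_cell hd (x₀ := u - (α + 2 * δ) * h) (by nlinarith)
      (by linarith)
    refine ⟨j₁, hj₁, j₂, hj₂, fun x hx => ?_, fun x hx => ?_, fun x hx y hy => ?_⟩
    · have h1 := hx.1; have h2 := hx.2
      have l1 : α ≤ -(((x : ℝ) - u) / h) := by rw [← neg_div, le_div_iff₀ hh]; linarith
      have l2 : -(((x : ℝ) - u) / h) ≤ α + 6 * δ := by rw [← neg_div, div_le_iff₀ hh]; linarith
      have := (hκ _ l1 l2).2
      rw [neg_neg] at this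
      exact ⟨this, by rw [abs_of_nonpos (by linarith)]; linarith⟩
    · have h1 := hx.1; have h2 := hx.2
      have l1 : α ≤ -(((x : ℝ) - u) / h) := by rw [← neg_div, le_div_iff₀ hh]; linarith
      have l2 : -(((x : ℝ) - u) / h) ≤ α + 6 * δ := by rw [← neg_div, div_le_iff₀ hh]; linarith
      have := (hκ _ l1 l2).2
      rw [neg_neg] at this
      exact ⟨this, by rw [abs_of_nonpos (by linarith)]; linarith⟩
    · have h2 := hx.2; have h3 := hy.1
      refine le_trans ?_ (le_abs_self _)
      rw [← sub_div, le_div_iff₀ hh]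
      linarith

/-! ### Nondegeneracy of local linear designs -/

/-- On a subset of total weight at least `M * κ` a function attains a value controlled by its
weighted sum of squares. -/
lemma exists_mul_sq_le {ι : Type*} {s S : Finset ι} (hS : S ⊆ s) {w : ι → ℝ} (f : ι → ℝ)
    (hw : ∀ a ∈ s, 0 ≤ w a) {M κ : ℝ} (hM : 0 < M) (hκ : 0 ≤ κ) (hcard : M ≤ S.card)
    (hwS : ∀ a ∈ S, κ ≤ w a) :
    ∃ a ∈ S, M * κ * f a ^ 2 ≤ ∑ a ∈ s, w a * f a ^ 2 := by
  have hne : S.Nonempty := by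
    rw [← Finset.card_pos]
    exact_mod_cast hM.trans_le hcard
  obtain ⟨a, ha, hmin⟩ := S.exists_min_image (fun a => f a ^ 2) hne
  refine ⟨a, ha, ?_⟩
  calc M * κ * f a ^ 2 ≤ S.card * κ * f a ^ 2 := by gcongr
    _ = ∑ _b ∈ S, κ * f a ^ 2 := by rw [Finset.sum_const, nsmul_eq_mul]; ring
    _ ≤ ∑ b ∈ S, w b * f b ^ 2 := by
        refine Finset.sum_le_sum fun b hb => ?_
        exact mul_le_mul (hwS b hb) (hmin b hb) (sq_nonneg _) (hκ.trans (hwS b hb))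
    _ ≤ _ := Finset.sum_le_sum_of_subset_of_nonneg hS fun b hb _ =>
        mul_nonneg (hw b hb) (sq_nonneg _)

lemma sq_add_sq_add_sq_le_sq_add {a b c : ℝ} (ha : 0 ≤ a) (hb : 0 ≤ b) (hc : 0 ≤ c) :
    a ^ 2 + b ^ 2 + c ^ 2 ≤ (a + (b + c)) ^ 2 := by
  nlinarith [mul_nonneg ha hb, mul_nonneg ha hc, mul_nonneg hb hc]

lemma sq_add_add_le (a b c : ℝ) : (a + b + c) ^ 2 ≤ 3 * (a ^ 2 + b ^ 2 + c ^ 2) := by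
  nlinarith [sq_nonneg (a - b), sq_nonneg (a - c), sq_nonneg (b - c)]

/-- Each of the three groups contains a point where the affine function is controlled by the
weighted sum of squares. The groups form an L: from the first to the second mainly `x` changes, from
the first to the third mainly `y`. The differences thus determine the slopes, and then the value at
the corner determines the intercept. The factor 9 is 3 from squaring a sum of three values times 3
for the three groups. -/
lemma surface_design_bound {ι : Type*} {s S₁ S₂ S₃ : Finset ι} (h₁ : S₁ ⊆ s) (h₂ : S₂ ⊆ s)
    (h₃ : S₃ ⊆ s) {w x y : ι → ℝ} (hw : ∀ a ∈ s, 0 ≤ w a) {M κ δ : ℝ} (hM : 0 < M) (hκ : 0 ≤ κ)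
    (hδ : 0 < δ) (c₁ : M ≤ S₁.card) (c₂ : M ≤ S₂.card) (c₃ : M ≤ S₃.card)
    (w₁ : ∀ a ∈ S₁, κ ≤ w a) (w₂ : ∀ a ∈ S₂, κ ≤ w a) (w₃ : ∀ a ∈ S₃, κ ≤ w a)
    (hx : ∀ a ∈ S₁, |x a| ≤ 1) (hy : ∀ a ∈ S₁, |y a| ≤ 1)
    (h12 : ∀ a ∈ S₁, ∀ b ∈ S₂, 2 * δ ≤ |x b - x a| ∧ |y b - y a| ≤ δ)
    (h13 : ∀ a ∈ S₁, ∀ b ∈ S₃, |x b - x a| ≤ δ ∧ 2 * δ ≤ |y b - y a|) (b₀ b₁ b₂ : ℝ) :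
    M * κ / (9 * (1 + 4 / δ) ^ 2) * (b₀ ^ 2 + b₁ ^ 2 + b₂ ^ 2) ≤
      ∑ a ∈ s, w a * (b₀ + b₁ * x a + b₂ * y a) ^ 2 := by
  set f : ι → ℝ := fun a => b₀ + b₁ * x a + b₂ * y a with hf
  obtain ⟨a₁, m₁, q₁⟩ := exists_mul_sq_le h₁ f hw hM hκ c₁ w₁
  obtain ⟨a₂, m₂, q₂⟩ := exists_mul_sq_le h₂ f hw hM hκ c₂ w₂
  obtain ⟨a₃, m₃, q₃⟩ := exists_mul_sq_le h₃ f hw hM hκ c₃ w₃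
  set D := ∑ a ∈ s, w a * f a ^ 2
  have e2 : b₁ * (x a₂ - x a₁) = f a₂ - f a₁ - b₂ * (y a₂ - y a₁) := by simp only [hf]; ring
  have e3 : b₂ * (y a₃ - y a₁) = f a₃ - f a₁ - b₁ * (x a₃ - x a₁) := by simp only [hf]; ring
  have k2 : |b₁| * (2 * δ) ≤ |f a₂| + |f a₁| + |b₂| * δ := by
    calc |b₁| * (2 * δ) ≤ |b₁| * |x a₂ - x a₁| := by gcongr; exact (h12 a₁ m₁ a₂ m₂).1
      _ = |f a₂ - f a₁ - b₂ * (y a₂ - y a₁)| := by rw [← abs_mul, e2]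
      _ ≤ |f a₂| + |f a₁| + |b₂| * |y a₂ - y a₁| := by
          rw [← abs_mul]
          exact (abs_sub _ _).trans (add_le_add_left (abs_sub _ _) _)
      _ ≤ _ := by gcongr; exact (h12 a₁ m₁ a₂ m₂).2
  have k3 : |b₂| * (2 * δ) ≤ |f a₃| + |f a₁| + |b₁| * δ := by
    calc |b₂| * (2 * δ) ≤ |b₂| * |y a₃ - y a₁| := by gcongr; exact (h13 a₁ m₁ a₃ m₃).2
      _ = |f a₃ - f a₁ - b₁ * (x a₃ - x a₁)| := by rw [← abs_mul, e3]
      _ ≤ |f a₃| + |f a₁| + |b₁| * |x a₃ - x a₁| := by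
          rw [← abs_mul]
          exact (abs_sub _ _).trans (add_le_add_left (abs_sub _ _) _)
      _ ≤ _ := by gcongr; exact (h13 a₁ m₁ a₃ m₃).1
  set T := |f a₁| + |f a₂| + |f a₃| with hT
  have n1 := abs_nonneg (f a₁)
  have n2 := abs_nonneg (f a₂)
  have n3 := abs_nonneg (f a₃)
  -- The system for the slopes is diagonally dominant, `2 δ` against `δ`, so adding the two
  -- estimates and absorbing leaves `δ (|b₁| + |b₂|) ≤ 2 T`.
  have k4 : |b₁| + |b₂| ≤ 2 * T / δ := by
    rw [le_div_iff₀ hδ]; linarith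
  have k0 : |b₀| ≤ T + (|b₁| + |b₂|) := by
    have e : b₀ = f a₁ - b₁ * x a₁ - b₂ * y a₁ := by simp only [hf]; ring
    have hx1 : |b₁ * x a₁| ≤ |b₁| := by
      rw [abs_mul]; exact mul_le_of_le_one_right (abs_nonneg _) (hx a₁ m₁)
    have hy1 : |b₂ * y a₁| ≤ |b₂| := by
      rw [abs_mul]; exact mul_le_of_le_one_right (abs_nonneg _) (hy a₁ m₁)
    have t1 := abs_sub (f a₁ - b₁ * x a₁) (b₂ * y a₁)
    have t2 := abs_sub (f a₁) (b₁ * x a₁)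
    rw [← e] at t1
    linarith
  have k5 : |b₀| + (|b₁| + |b₂|) ≤ T * (1 + 4 / δ) := by
    have : T * (1 + 4 / δ) = T + 2 * (2 * T / δ) := by ring
    linarith
  have k6 : b₀ ^ 2 + b₁ ^ 2 + b₂ ^ 2 ≤ (T * (1 + 4 / δ)) ^ 2 := by
    have m0 := abs_nonneg b₀
    have m1 := abs_nonneg b₁
    have m2 := abs_nonneg b₂
    have : (|b₀| + (|b₁| + |b₂|)) ^ 2 ≤ (T * (1 + 4 / δ)) ^ 2 :=
      pow_le_pow_left₀ (by positivity) k5 2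
    rw [← sq_abs b₀, ← sq_abs b₁, ← sq_abs b₂]
    exact (sq_add_sq_add_sq_le_sq_add m0 m1 m2).trans this
  have k7 : T ^ 2 ≤ 3 * (f a₁ ^ 2 + f a₂ ^ 2 + f a₃ ^ 2) := by
    rw [← sq_abs (f a₁), ← sq_abs (f a₂), ← sq_abs (f a₃)]
    exact sq_add_add_le _ _ _
  have hA : 0 < (1 + 4 / δ) ^ 2 := by positivity
  rw [div_mul_eq_mul_div, div_le_iff₀ (by positivity)]
  have hMκ : 0 ≤ M * κ := by positivity
  calc M * κ * (b₀ ^ 2 + b₁ ^ 2 + b₂ ^ 2) ≤ M * κ * (T * (1 + 4 / δ)) ^ 2 := by gcongr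
    _ = (M * κ * T ^ 2) * (1 + 4 / δ) ^ 2 := by ring
    _ ≤ (M * κ * (3 * (f a₁ ^ 2 + f a₂ ^ 2 + f a₃ ^ 2))) * (1 + 4 / δ) ^ 2 := by gcongr
    _ ≤ (9 * D) * (1 + 4 / δ) ^ 2 := by
        refine mul_le_mul_of_nonneg_right ?_ hA.le
        linarith
    _ = _ := by ring

/-- Two separated groups determine one slope and the intercept. The constant has the form of the one
for surfaces and is larger than necessary. -/
lemma line_design_bound {ι : Type*} {s S₁ S₂ : Finset ι} (h₁ : S₁ ⊆ s) (h₂ : S₂ ⊆ s)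
    {w x : ι → ℝ} (hw : ∀ a ∈ s, 0 ≤ w a) {M κ δ : ℝ} (hM : 0 < M) (hκ : 0 ≤ κ)
    (hδ : 0 < δ) (c₁ : M ≤ S₁.card) (c₂ : M ≤ S₂.card)
    (w₁ : ∀ a ∈ S₁, κ ≤ w a) (w₂ : ∀ a ∈ S₂, κ ≤ w a)
    (hx : ∀ a ∈ S₁, |x a| ≤ 1) (h12 : ∀ a ∈ S₁, ∀ b ∈ S₂, 2 * δ ≤ |x b - x a|) (b₀ b₁ : ℝ) :
    M * κ / (9 * (1 + 4 / δ) ^ 2) * (b₀ ^ 2 + b₁ ^ 2) ≤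
      ∑ a ∈ s, w a * (b₀ + b₁ * x a) ^ 2 := by
  set f : ι → ℝ := fun a => b₀ + b₁ * x a with hf
  obtain ⟨a₁, m₁, q₁⟩ := exists_mul_sq_le h₁ f hw hM hκ c₁ w₁
  obtain ⟨a₂, m₂, q₂⟩ := exists_mul_sq_le h₂ f hw hM hκ c₂ w₂
  set D := ∑ a ∈ s, w a * f a ^ 2
  have e2 : b₁ * (x a₂ - x a₁) = f a₂ - f a₁ := by simp only [hf]; ring
  have k2 : |b₁| * (2 * δ) ≤ |f a₂| + |f a₁| := by
    calc |b₁| * (2 * δ) ≤ |b₁| * |x a₂ - x a₁| := by gcongr; exact h12 a₁ m₁ a₂ m₂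
      _ = |f a₂ - f a₁| := by rw [← abs_mul, e2]
      _ ≤ |f a₂| + |f a₁| := abs_sub _ _
  set T := |f a₁| + |f a₂| with hT
  have n1 := abs_nonneg (f a₁)
  have n2 := abs_nonneg (f a₂)
  have k4 : |b₁| ≤ 2 * T / δ := by
    rw [le_div_iff₀ hδ]; linarith
  have k0 : |b₀| ≤ T + |b₁| := by
    have e : b₀ = f a₁ - b₁ * x a₁ := by simp only [hf]; ring
    have hx1 : |b₁ * x a₁| ≤ |b₁| := by
      rw [abs_mul]; exact mul_le_of_le_one_right (abs_nonneg _) (hx a₁ m₁)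
    have t2 := abs_sub (f a₁) (b₁ * x a₁)
    rw [← e] at t2
    linarith
  have k5 : |b₀| + |b₁| ≤ T * (1 + 4 / δ) := by
    have : T * (1 + 4 / δ) = T + 2 * (2 * T / δ) := by ring
    linarith
  have k6 : b₀ ^ 2 + b₁ ^ 2 ≤ (T * (1 + 4 / δ)) ^ 2 := by
    have m0 := abs_nonneg b₀
    have m1 := abs_nonneg b₁
    have : (|b₀| + |b₁|) ^ 2 ≤ (T * (1 + 4 / δ)) ^ 2 :=
      pow_le_pow_left₀ (by positivity) k5 2
    rw [← sq_abs b₀, ← sq_abs b₁]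
    nlinarith [mul_nonneg m0 m1]
  have k7 : T ^ 2 ≤ 3 * (f a₁ ^ 2 + f a₂ ^ 2) := by
    rw [← sq_abs (f a₁), ← sq_abs (f a₂)]
    nlinarith [sq_nonneg (|f a₁| - |f a₂|)]
  have hA : 0 < (1 + 4 / δ) ^ 2 := by positivity
  have hD : 0 ≤ D := Finset.sum_nonneg fun a ha => mul_nonneg (hw a ha) (sq_nonneg _)
  rw [div_mul_eq_mul_div, div_le_iff₀ (by positivity)]
  have hMκ : 0 ≤ M * κ := by positivity
  calc M * κ * (b₀ ^ 2 + b₁ ^ 2) ≤ M * κ * (T * (1 + 4 / δ)) ^ 2 := by gcongr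
    _ = (M * κ * T ^ 2) * (1 + 4 / δ) ^ 2 := by ring
    _ ≤ (M * κ * (3 * (f a₁ ^ 2 + f a₂ ^ 2))) * (1 + 4 / δ) ^ 2 := by gcongr
    _ ≤ (9 * D) * (1 + 4 / δ) ^ 2 := by
        refine mul_le_mul_of_nonneg_right ?_ hA.le
        linarith
    _ = _ := by ring

/-! ### Location probabilities -/

section LocationDesign

variable {Ω : Type*} [MeasurableSpace Ω] {P : Measure Ω} [IsProbabilityMeasure P]
  {U : ℤ → ℕ → Ω → I}

lemma IsLocationDesign.exists_bounds (hU : IsLocationDesign P U) :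
    ∃ a b : ℝ, 0 < a ∧ 0 < b ∧ ∀ B : Set ℝ, MeasurableSet B →
      ∃ p, Locations P U ((fun x : I => (x : ℝ)) ⁻¹' B) p ∧
        a * volume.real (B ∩ Icc 0 1) ≤ p ∧ p ≤ b * volume.real (B ∩ Icc 0 1) := by
  obtain ⟨f, -, ⟨a, b, ha, hab⟩, hmap⟩ := hU.density
  have hb : 0 < b := ha.trans_le ((hab 0 ⟨le_rfl, zero_le_one⟩).1.trans
    (hab 0 ⟨le_rfl, zero_le_one⟩).2)
  refine ⟨a, b, ha, hb, fun B hB => ?_⟩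
  set μ := (volume.restrict (Icc (0 : ℝ) 1)).withDensity (fun x => ENNReal.ofReal (f x))
  have hprob : ∀ t i, P.real (U t i ⁻¹' ((fun x : I => (x : ℝ)) ⁻¹' B)) = μ.real B := by
    intro t i
    have hm : Measurable (fun ω => (U t i ω : ℝ)) := measurable_subtype_coe.comp (hU.measurable t i)
    rw [measureReal_def, measureReal_def, ← hmap t i, Measure.map_apply hm hB]
    rfl
  have hμ : μ B = ∫⁻ x in B ∩ Icc 0 1, ENNReal.ofReal (f x) := by
    rw [withDensity_apply _ hB, Measure.restrict_restrict hB]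
  have hBI : MeasurableSet (B ∩ Icc (0 : ℝ) 1) := hB.inter measurableSet_Icc
  have hfin : volume (B ∩ Icc (0 : ℝ) 1) ≠ ∞ :=
    ((measure_mono inter_subset_right).trans_lt measure_Icc_lt_top).ne
  have hlow : ENNReal.ofReal (a * volume.real (B ∩ Icc 0 1)) ≤ μ B := by
    rw [hμ, ENNReal.ofReal_mul ha.le, ofReal_measureReal hfin, ← setLIntegral_const]
    exact setLIntegral_mono' hBI fun x hx => ENNReal.ofReal_le_ofReal (hab x hx.2).1
  have hup : μ B ≤ ENNReal.ofReal (b * volume.real (B ∩ Icc 0 1)) := by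
    rw [hμ, ENNReal.ofReal_mul hb.le, ofReal_measureReal hfin, ← setLIntegral_const]
    exact setLIntegral_mono' hBI fun x hx => ENNReal.ofReal_le_ofReal (hab x hx.2).2
  have hμfin : μ B ≠ ∞ := (hup.trans_lt ENNReal.ofReal_lt_top).ne
  refine ⟨μ.real B, ⟨hU.measurable, hU.indep, measurable_subtype_coe hB, hprob⟩, ?_, ?_⟩
  · rw [← ofReal_measureReal hμfin, ENNReal.ofReal_le_ofReal_iff measureReal_nonneg] at hlow
    exact hlow
  · rw [← ofReal_measureReal hμfin, ENNReal.ofReal_le_ofReal_iff (by positivity)] at hup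
    exact hup

/-- The smoothing window of half-width `h` around `u`. -/
def window (u : I) (h : ℝ) : Set I := {x | |(x : ℝ) - u| ≤ h}

/-- The density bounds are used in opposite directions: cells, which lie inside `[0, 1]`, must be
likely enough for the design bound, whereas windows, which may stick out, must not be too likely for
the noise moments. -/
lemma IsLocationDesign.exists_cell_window (hU : IsLocationDesign P U) :
    ∃ a b : ℝ, 0 < a ∧ 0 < b ∧
      (∀ d : ℝ, 0 < d → ∀ j < ⌊1 / d⌋₊, ∃ p, Locations P U (cell d j) p ∧ a * d ≤ p) ∧
      (∀ (u : I) (h : ℝ), 0 < h → ∃ p, Locations P U (window u h) p ∧ p ≤ b * h) := by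
  obtain ⟨a, b, ha, hb, H⟩ := hU.exists_bounds
  refine ⟨a, 2 * b, ha, by positivity, fun d hd j hj => ?_, fun u h hh => ?_⟩
  · obtain ⟨p, hp, h1, -⟩ := H (Icc (j * d) ((j + 1) * d)) measurableSet_Icc
    refine ⟨p, hp, ?_⟩
    have hle := cell_end_le hd hj
    rw [inter_eq_left.2 (Icc_subset_Icc (by positivity) hle), Real.volume_real_Icc_of_le
      (by nlinarith)] at h1
    calc a * d = a * ((j + 1) * d - j * d) := by ring
      _ ≤ p := h1
  · obtain ⟨p, hp, -, h2⟩ := H (Icc (u - h) (u + h)) measurableSet_Icc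
    have hset : (fun x : I => (x : ℝ)) ⁻¹' Icc (u - h) (u + h) = window u h := by
      ext x
      simp only [window, mem_preimage, mem_Icc, mem_ofPred_eq, abs_le]
      constructor <;> rintro ⟨h1, h2⟩ <;> constructor <;> linarith
    rw [hset] at hp
    refine ⟨p, hp, h2.trans ?_⟩
    have : volume.real (Icc ((u : ℝ) - h) (u + h) ∩ Icc 0 1) ≤ 2 * h := by
      refine (measureReal_mono inter_subset_left measure_Icc_lt_top.ne).trans ?_
      rw [Real.volume_real_Icc_of_le (by linarith)]
      linarith
    nlinarith

/-- In the one-dimensional problem this is the first window of a pair, so that both estimators are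
handled by the same statements about pairs of locations. -/
lemma locations_univ (hU : IsLocationDesign P U) : Locations P U univ 1 :=
  ⟨hU.measurable, hU.indep, MeasurableSet.univ, fun t i => by simp⟩

end LocationDesign

/-! ### Second moment of weighted noise sums -/

section NoiseMoment

open LatentModel

variable {Ω E : Type*} [MeasurableSpace Ω] [MeasurableSpace E] {P : Measure Ω}
  {V : ℤ → Ω → E} {η : ℤ → ℕ → Ω → ℝ} {lam c Mη : ℝ} [IsProbabilityMeasure P]

/-- Bound for the second moment of weighted noise sums over `N` times, given the expected numbers
`x₁`, `x₂` of locations in the two windows. -/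
def noiseBound (S C₀ C₁ x₁ x₂ : ℝ) (N : ℕ) : ℝ :=
  N * (S * (C₀ * (countSq x₁ * countSq x₂) + C₁ * (x₁ * x₂) ^ 2))

lemma sum_count_mul {U : ℤ → ℕ → Ω → I} {k R₁ R₂ : ℕ} {J₁ J₂ : Set I} (t : ℤ) (ω : Ω) :
    ∑ q ∈ Finset.range R₁ ×ˢ Finset.range R₂, J₁.indicator (fun _ => (1 : ℝ)) (U t q.1 ω) *
      J₂.indicator (fun _ => (1 : ℝ)) (U (t + k) q.2 ω) =
    count U R₁ J₁ t ω * count U R₂ J₂ (t + k) ω := by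
  unfold count
  rw [Finset.sum_mul_sum, Finset.sum_product]

lemma sum_sum_product {ι κ : Type*} (F : Finset ι) (s : Finset κ) (n : ι → ι → ℝ) (q : ι × κ → ℝ) :
    ∑ a ∈ F ×ˢ s, ∑ b ∈ F ×ˢ s, n a.1 b.1 * (q a * q b) =
      ∑ t ∈ F, ∑ t' ∈ F, n t t' * ((∑ p ∈ s, q (t, p)) * ∑ p ∈ s, q (t', p)) := by
  rw [Finset.sum_product]
  refine Finset.sum_congr rfl fun t _ => ?_
  simp only [Finset.sum_product (s := F)]
  rw [Finset.sum_comm]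
  refine Finset.sum_congr rfl fun t' _ => ?_
  rw [Finset.sum_mul_sum, Finset.mul_sum]
  exact Finset.sum_congr rfl fun p _ => by rw [Finset.mul_sum]

/-- With the design frozen, the second moment is a double sum of covariances weighted by the `g`'s.
Bounding those by indicators turns the sum over locations into products of four counts per pair of
times, and averaging over the design uses one bound for close times and another for distant ones. -/
lemma lintegral_noise_sq_le (h : LatentModel P V η lam c Mη) {k : ℕ} (hk : 1 ≤ k)
    {α β : I → E → ℝ} {M : ℝ} (hα : ∀ x, SqBounded P V (α x) M) (hβ : ∀ x, SqBounded P V (β x) M)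
    {Fα Fβ : ℤ → E × I → ℝ} (mFα : ∀ t, Measurable (Fα t)) (mFβ : ∀ t, Measurable (Fβ t))
    (eFα : ∀ t ω x, Fα t (V t ω, x) = α x (V t ω)) (eFβ : ∀ t ω x, Fβ t (V t ω, x) = β x (V t ω))
    {G : I × I → ℝ} (mG : Measurable G) (eG : ∀ x y, G (x, y) = latentMean P V k (α x) (β y))
    (hMη : 0 ≤ Mη) (hM : 0 ≤ M)
    {U : ℤ → ℕ → Ω → I} {m : ℤ → Ω → ℕ} (hm : ∀ t, Measurable (m t))
    (hind : IndepFun (fun ω => ((fun t : ℤ => V t ω), fun (t : ℤ) (i : ℕ) => η t i ω))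
      (fun ω => ((fun (t : ℤ) (i : ℕ) => U t i ω), fun t : ℤ => m t ω)) P)
    {J₁ J₂ : Set I} {p₁ p₂ : ℝ} (h₁ : Locations P U J₁ p₁) (h₂ : Locations P U J₂ p₂)
    (σ₁ : ℝ) (R₁ R₂ : ℕ) (F : Finset ℤ) {S : ℝ}
    (hsum : ∀ (C₀ C₁ Qn Qf : ℝ) (F : Finset ℤ) (X : ℤ → ℤ → ℝ), 0 ≤ C₀ → 0 ≤ C₁ →
      0 ≤ Qn → 0 ≤ Qf → (∀ t t', X t t' ≤ Qn) → (∀ t t', (k : ℤ) < |t - t'| → X t t' ≤ Qf) →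
      ∑ t ∈ F, ∑ t' ∈ F, noiseCov k lam C₀ C₁ (t - t') * X t t' ≤
        F.card * (S * (C₀ * Qn + C₁ * Qf)))
    {B : ℝ} (hB : 0 ≤ B) (g : (ℤ → ℕ → I) × (ℤ → ℕ) → ℤ × ℕ × ℕ → ℝ)
    (mg : ∀ a, Measurable fun d => g d a)
    (hg : ∀ d a, |g d a| ≤ B * (J₁.indicator (fun _ => (1 : ℝ)) (d.1 a.1 a.2.1) *
      J₂.indicator (fun _ => (1 : ℝ)) (d.1 (a.1 + k) a.2.2))) :
    ∫⁻ ω, ENNReal.ofReal ((∑ a ∈ F ×ˢ (Finset.range R₁ ×ˢ Finset.range R₂),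
      g ((fun t i => U t i ω), fun t => m t ω) a *
        (noisyProd V η k σ₁ 1 (α (U a.1 a.2.1 ω)) (β (U (a.1 + k) a.2.2 ω)) a.1 a.2.1 a.2.2 ω -
          G (U a.1 a.2.1 ω, U (a.1 + k) a.2.2 ω))) ^ 2) ∂P ≤
      ENNReal.ofReal (B ^ 2 * noiseBound S (noisySq c Mη M M σ₁ 1) (c * (M * M))
        (R₁ * p₁) (R₂ * p₂) F.card) := by
  set A := F ×ˢ (Finset.range R₁ ×ˢ Finset.range R₂) with hA
  set C₀ := noisySq c Mη M M σ₁ 1 with hC₀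
  set C₁ := c * (M * M) with hC₁
  have hc := h.c_nonneg
  have nC₀ : 0 ≤ C₀ := by rw [hC₀]; unfold noisySq; positivity
  have nC₁ : 0 ≤ C₁ := by positivity
  set D : Ω → (ℤ → ℕ → I) × (ℤ → ℕ) := fun ω => ((fun t i => U t i ω), fun t => m t ω) with hD
  set T : Ω → (ℤ → E) × (ℤ → ℕ → ℝ) := fun ω => ((fun t => V t ω), fun t i => η t i ω) with hT
  have mD : Measurable D := (measurable_pi_lambda _ fun t => measurable_pi_lambda _ fun i =>
    h₁.measurable t i).prodMk (measurable_pi_lambda _ fun t => hm t)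
  have mT : Measurable T := (measurable_pi_lambda _ fun t => h.measurable t).prodMk
    (measurable_pi_lambda _ fun t => measurable_pi_lambda _ fun i => h.η_measurable t i)
  -- Evaluation of a curve at a random location is jointly measurable only through the
  -- representatives `Fα`, `Fβ`; on actual curves they agree with `α`, `β`.
  set Φ : (ℤ → E) × (ℤ → ℕ → ℝ) → (ℤ → ℕ → I) × (ℤ → ℕ) → ℝ≥0∞ := fun τ d =>
    ENNReal.ofReal ((∑ a ∈ A, g d a *
      ((Fα a.1 (τ.1 a.1, d.1 a.1 a.2.1) + σ₁ * τ.2 a.1 a.2.1) *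
        (Fβ (a.1 + k) (τ.1 (a.1 + k), d.1 (a.1 + k) a.2.2) + 1 * τ.2 (a.1 + k) a.2.2) -
        G (d.1 a.1 a.2.1, d.1 (a.1 + k) a.2.2))) ^ 2) with hΦ
  have mΦ : Measurable (Function.uncurry Φ) := by
    refine ENNReal.measurable_ofReal.comp (Measurable.pow_const (Finset.measurable_fun_sum _
      fun a _ => ?_) 2)
    refine ((mg a).comp measurable_snd).mul (Measurable.sub (Measurable.mul ?_ ?_) ?_)
    · exact ((mFα a.1).comp (by fun_prop : Measurable
        fun p : ((ℤ → E) × (ℤ → ℕ → ℝ)) × (ℤ → ℕ → I) × (ℤ → ℕ) =>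
          (p.1.1 a.1, p.2.1 a.1 a.2.1))).add (by fun_prop)
    · exact ((mFβ (a.1 + k)).comp (by fun_prop : Measurable
        fun p : ((ℤ → E) × (ℤ → ℕ → ℝ)) × (ℤ → ℕ → I) × (ℤ → ℕ) =>
          (p.1.1 (a.1 + k), p.2.1 (a.1 + k) a.2.2))).add (by fun_prop)
    · exact mG.comp (by fun_prop)
  have e1 : ∀ ω ω', Φ (T ω') (D ω) = ENNReal.ofReal ((∑ a ∈ A, g (D ω) a *
        (noisyProd V η k σ₁ 1 (α (U a.1 a.2.1 ω)) (β (U (a.1 + k) a.2.2 ω)) a.1 a.2.1 a.2.2 ω' -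
          latentMean P V k (α (U a.1 a.2.1 ω)) (β (U (a.1 + k) a.2.2 ω)))) ^ 2) := by
    intro ω ω'
    simp only [hΦ, hT, hD, eFα, eFβ, eG, noisyProd]
  have e2 : ∀ ω, ENNReal.ofReal ((∑ a ∈ A, g (D ω) a *
        (noisyProd V η k σ₁ 1 (α (U a.1 a.2.1 ω)) (β (U (a.1 + k) a.2.2 ω)) a.1 a.2.1 a.2.2 ω -
          G (U a.1 a.2.1 ω, U (a.1 + k) a.2.2 ω))) ^ 2) = Φ (T ω) (D ω) := by
    intro ω
    rw [e1]
    simp only [eG]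
  refine (le_of_eq (lintegral_congr e2)).trans ?_
  rw [lintegral_indepFun_eq mT mD hind mΦ]
  set X : ℤ → ℤ → Ω → ℝ := fun t t' ω =>
    (count U R₁ J₁ t ω * count U R₂ J₂ (t + k) ω) *
      (count U R₁ J₁ t' ω * count U R₂ J₂ (t' + k) ω) with hX
  have X0 : ∀ t t' ω, 0 ≤ X t t' ω := fun t t' ω =>
    mul_nonneg (mul_nonneg (count_nonneg _ _ _ _) (count_nonneg _ _ _ _))
      (mul_nonneg (count_nonneg _ _ _ _) (count_nonneg _ _ _ _))
  have mX : ∀ t t', Measurable (X t t') := fun t t' =>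
    ((measurable_count h₁.measurable h₁.set _ _).mul (measurable_count h₁.measurable h₂.set _ _)).mul
    ((measurable_count h₁.measurable h₁.set _ _).mul (measurable_count h₁.measurable h₂.set _ _))
  have iX : ∀ t t', Integrable (X t t') P := by
    intro t t'
    refine integrable_of_designBound (mX t t') (B := (R₁ * R₂ : ℝ) * (R₁ * R₂)) (X0 t t')
      fun ω => ?_
    exact mul_le_mul (mul_le_mul (count_le _ _ _ _) (count_le _ _ _ _) (count_nonneg _ _ _ _)
      (by positivity)) (mul_le_mul (count_le _ _ _ _) (count_le _ _ _ _) (count_nonneg _ _ _ _)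
      (by positivity)) (mul_nonneg (count_nonneg _ _ _ _) (count_nonneg _ _ _ _)) (by positivity)
  have step : ∀ ω, ∫⁻ ω', Φ (T ω') (D ω) ∂P ≤ ENNReal.ofReal
      (B ^ 2 * ∑ t ∈ F, ∑ t' ∈ F, noiseCov k lam C₀ C₁ (t - t') * X t t' ω) := by
    intro ω
    simp only [e1]
    refine (lintegral_sum_sq_le A (fun a => g (D ω) a) (fun a ω' =>
      noisyProd V η k σ₁ 1 (α (U a.1 a.2.1 ω)) (β (U (a.1 + k) a.2.2 ω)) a.1 a.2.1 a.2.2 ω' -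
          latentMean P V k (α (U a.1 a.2.1 ω)) (β (U (a.1 + k) a.2.2 ω)))
      (fun a b => noiseCov k lam C₀ C₁ (a.1 - b.1))
      (fun a _ => h.memLp_centred hk (hα _) (hβ _) σ₁ 1 a.1 a.2.1 a.2.2)
      (fun a _ b _ => h.abs_integral_centred_le hk (hα _) (hβ _) (hα _) (hβ _) σ₁ 1
        a.1 b.1 a.2.1 a.2.2 b.2.1 b.2.2)).trans (ENNReal.ofReal_le_ofReal ?_)
    set q : ℤ × ℕ × ℕ → ℝ := fun a => J₁.indicator (fun _ => (1 : ℝ)) (U a.1 a.2.1 ω) *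
      J₂.indicator (fun _ => (1 : ℝ)) (U (a.1 + k) a.2.2 ω) with hq
    have q0 : ∀ a, 0 ≤ q a := fun a => mul_nonneg (indicator_nonneg (fun _ _ => zero_le_one) _)
      (indicator_nonneg (fun _ _ => zero_le_one) _)
    have b1 : ∀ a b, noiseCov k lam C₀ C₁ (a.1 - b.1) * (|g (D ω) a| * |g (D ω) b|) ≤
        B ^ 2 * (noiseCov k lam C₀ C₁ (a.1 - b.1) * (q a * q b)) := by
      intro a b
      have h3 := mul_le_mul (hg (D ω) a) (hg (D ω) b) (abs_nonneg _) (mul_nonneg hB (q0 a))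
      have := mul_le_mul_of_nonneg_left h3 (noiseCov_nonneg (k := k) (lam := lam) nC₀ nC₁
        (a.1 - b.1))
      refine this.trans (le_of_eq ?_)
      simp only [hq, hD]
      ring
    refine (Finset.sum_le_sum fun a _ => Finset.sum_le_sum fun b _ => b1 a b).trans (le_of_eq ?_)
    simp only [← Finset.mul_sum]
    congr 1
    rw [hA, sum_sum_product F _ (fun t t' => noiseCov k lam C₀ C₁ (t - t')) q]
    simp only [hq, hX, sum_count_mul]
  refine (lintegral_mono step).trans ?_
  have iS : Integrable (fun ω => B ^ 2 * ∑ t ∈ F, ∑ t' ∈ F,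
      noiseCov k lam C₀ C₁ (t - t') * X t t' ω) P :=
    (integrable_finsetSum _ fun t _ => integrable_finsetSum _ fun t' _ =>
      (iX t t').const_mul _).const_mul _
  rw [← ofReal_integral_eq_lintegral_ofReal iS (ae_of_all _ fun ω => mul_nonneg (sq_nonneg _)
    (Finset.sum_nonneg fun t _ => Finset.sum_nonneg fun t' _ =>
      mul_nonneg (noiseCov_nonneg nC₀ nC₁ _) (X0 t t' ω)))]
  refine ENNReal.ofReal_le_ofReal ?_
  rw [integral_const_mul]
  refine mul_le_mul_of_nonneg_left ?_ (sq_nonneg _)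
  rw [integral_finsetSum _ fun t _ => integrable_finsetSum _ fun t' _ => (iX t t').const_mul _]
  have e4 : ∀ t ∈ F, ∫ ω, ∑ t' ∈ F, noiseCov k lam C₀ C₁ (t - t') * X t t' ω ∂P =
      ∑ t' ∈ F, noiseCov k lam C₀ C₁ (t - t') * ∫ ω, X t t' ω ∂P := by
    intro t _
    rw [integral_finsetSum _ fun t' _ => (iX t t').const_mul _]
    simp only [integral_const_mul]
  rw [Finset.sum_congr rfl e4]
  have hp₁ := h₁.nonneg
  have hp₂ := h₂.nonneg
  exact hsum C₀ C₁ (countSq (R₁ * p₁) * countSq (R₂ * p₂)) (((R₁ * p₁) * (R₂ * p₂)) ^ 2) F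
    (fun t t' => ∫ ω, X t t' ω ∂P) nC₀ nC₁ (by unfold countSq; positivity) (by positivity)
    (fun t t' => h₁.integral_four_le h₂ R₁ R₂ hk t t')
    (fun t t' hgap => (h₁.integral_four_of_gap h₂ R₁ R₂ hk hgap).le)

end NoiseMoment

/-! ### Consequences of the sampling model -/

section ModelFacts

variable {Ω : Type*} [MeasurableSpace Ω] {P : Measure Ω} [IsProbabilityMeasure P]

/-- The product σ-algebra is generated by `(ω, u) ↦ (W t ω, u)`, so this is the Doob–Dynkin
factorisation. Evaluation itself is not assumed measurable on the full path space `I → ℝ`. -/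
lemma MeasurableCurves.exists_factor {W : ℤ → Ω → I → ℝ} (h : MeasurableCurves W) (t : ℤ) :
    ∃ F : (I → ℝ) × I → ℝ, Measurable F ∧ ∀ ω x, F (W t ω, x) = W t ω x := by
  have e : @Prod.instMeasurableSpace Ω I (MeasurableSpace.comap (W t) inferInstance) inferInstance =
      MeasurableSpace.comap (Prod.map (W t) (id : I → I)) inferInstance := by
    simp only [Prod.instMeasurableSpace, MeasurableSpace.prod, MeasurableSpace.comap_sup,
      MeasurableSpace.comap_comp]
    rfl
  have hm := h t
  rw [e] at hm
  obtain ⟨F, mF, hF⟩ := Measurable.exists_eq_measurable_comp hm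
  exact ⟨F, mF, fun ω x => (congrFun hF (ω, x)).symm⟩

/-- Pointwise `x² ≤ 1 + x^q` for `q ≥ 2`. -/
lemma memLp_two_of_lintegral_rpow_le {f : Ω → ℝ} (hf : AEStronglyMeasurable f P) {q : ℝ}
    (hq : 2 ≤ q) {M : ℝ≥0} (hM : ∫⁻ ω, ‖f ω‖ₑ ^ q ∂P ≤ M) :
    MemLp f 2 P ∧ ∫ ω, f ω ^ 2 ∂P ≤ 1 + M := by
  have h1 : ∫⁻ ω, ‖f ω‖ₑ ^ (2 : ℝ) ∂P ≤ 1 + M := by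
    calc ∫⁻ ω, ‖f ω‖ₑ ^ (2 : ℝ) ∂P ≤ ∫⁻ ω, (1 + ‖f ω‖ₑ ^ q) ∂P := by
          refine lintegral_mono fun ω => ?_
          rcases le_total ‖f ω‖ₑ 1 with h | h
          · exact (ENNReal.rpow_le_one h (by norm_num)).trans le_self_add
          · exact (ENNReal.rpow_le_rpow_of_exponent_le h hq).trans le_add_self
      _ = 1 + ∫⁻ ω, ‖f ω‖ₑ ^ q ∂P := by
          rw [lintegral_add_left measurable_const]; simp
      _ ≤ 1 + M := by gcongr
  have hfin : (1 + M : ℝ≥0∞) < ∞ := by simp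
  have hL : MemLp f 2 P := by
    refine ⟨hf, ?_⟩
    rw [eLpNorm_lt_top_iff_lintegral_rpow_enorm_lt_top (by norm_num) (by norm_num)]
    simpa using h1.trans_lt hfin
  refine ⟨hL, ?_⟩
  rw [integral_eq_lintegral_of_nonneg_ae (ae_of_all _ fun ω => sq_nonneg _) (hf.pow 2)]
  have h2 : ∫⁻ ω, ENNReal.ofReal (f ω ^ 2) ∂P ≤ 1 + M := by
    refine (lintegral_mono fun ω => ?_).trans h1
    rw [← sq_abs, ENNReal.ofReal_pow (abs_nonneg _), ← Real.norm_eq_abs, ofReal_norm]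
    simp
  have := ENNReal.toReal_mono hfin.ne h2
  simpa [ENNReal.toReal_add] using this

lemma IsMixingSequence.exists_latentModel {E : Type*} [MeasurableSpace E] {V : ℤ → Ω → E}
    {η : ℤ → ℕ → Ω → ℝ} {lam q : ℝ} (hV : IsMixingSequence P V lam) (hlam : 0 < lam)
    (hη : IsMeasurementError P η q) (hq : 2 ≤ q)
    (hind : IndepFun (fun ω (t : ℤ) (i : ℕ) => η t i ω) (fun ω (t : ℤ) => V t ω) P) :
    ∃ c Mη : ℝ, 0 ≤ Mη ∧ LatentModel P V η lam c Mη := by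
  obtain ⟨c, hc, hrel⟩ := hV.exists_relIndep
  have hL : ∀ t i, MemLp (η t i) 2 P := fun t i => (hη.moment t i).mono_exponent (by
    rw [← ENNReal.ofReal_ofNat]
    exact ENNReal.ofReal_le_ofReal hq)
  refine ⟨c, ∫ ω, η 0 0 ω ^ 2 ∂P, integral_nonneg fun ω => sq_nonneg _,
    hV.measurable, hV.stationary, hlam, hc, hrel, hη.measurable, hη.indep, hη.mean, hL,
    fun t i => le_of_eq ?_, hind⟩
  exact ((hη.identDistrib t i 0 0).comp (measurable_id.pow_const 2)).integral_eq

/-- Regroups the chain of independences so that everything random in the values stands against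
everything random in the design, as conditioning on the design requires. -/
lemma IsIndependentDesign.indepFun_latent_design {E : Type*} [MeasurableSpace E] {V : ℤ → Ω → E}
    {U : ℤ → ℕ → Ω → I} {η : ℤ → ℕ → Ω → ℝ} {m : ℕ → ℤ → Ω → ℕ}
    (h : IsIndependentDesign P V U η m) (mV : ∀ t, Measurable (V t))
    (mU : ∀ t i, Measurable (U t i)) (mη : ∀ t i, Measurable (η t i))
    (mm : ∀ n t, Measurable (m n t)) (n : ℕ) :
    IndepFun (fun ω => ((fun t : ℤ => V t ω), fun (t : ℤ) (i : ℕ) => η t i ω))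
      (fun ω => ((fun (t : ℤ) (i : ℕ) => U t i ω), fun t : ℤ => m n t ω)) P := by
  have m1 : Measurable fun ω => (fun t : ℤ => V t ω) := measurable_pi_lambda _ mV
  have m2 : Measurable fun ω => (fun (t : ℤ) (i : ℕ) => U t i ω) :=
    measurable_pi_lambda _ fun t => measurable_pi_lambda _ (mU t)
  have m3 : Measurable fun ω => (fun (t : ℤ) (i : ℕ) => η t i ω) :=
    measurable_pi_lambda _ fun t => measurable_pi_lambda _ (mη t)
  have m4 : Measurable fun ω => (fun t : ℤ => m n t ω) := measurable_pi_lambda _ (mm n)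
  have h1 := indepFun_prodMk_of_indepFun m1 m2 m3 h.locations.symm h.errors
  have h2 := (h.counts n).comp measurable_id
    (by fun_prop : Measurable fun p : (ℤ → E) × (ℤ → ℕ → I) × (ℤ → ℕ → ℝ) => (p.2.1, p.1, p.2.2))
  exact indepFun_prodMk_of_indepFun m2 (m1.prodMk m3) m4 h1 h2

/-- The ratio lives in a bounded range, so almost surely all counts of one sample lie between two
fixed multiples of `ρ n`, and this sandwich is all the analysis uses. A count is a positive integer
not exceeding `M ρ n`, which keeps `ρ n` away from zero. -/
lemma IsCountDesign.exists_bounds {m : ℕ → ℤ → Ω → ℕ} {ρ : ℕ → ℝ} (h : IsCountDesign P m ρ) :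
    ∃ M : ℝ, 1 ≤ M ∧ (∀ n, 1 / M ≤ ρ n) ∧
      ∀ n, ∀ᵐ ω ∂P, ∀ t, ρ n ≤ m n t ω ∧ (m n t ω : ℝ) ≤ M * ρ n := by
  obtain ⟨mc, M, hmc, hb, -, hid⟩ := h.law
  have hne : Nonempty Ω := nonempty_of_isProbabilityMeasure P
  have hM1 : 1 ≤ M := (hb hne.some).1.trans (hb hne.some).2
  have hM : (1 : ℝ) ≤ M := by exact_mod_cast hM1
  have key : ∀ n, ∀ᵐ ω ∂P, ∀ t, ρ n ≤ m n t ω ∧ (m n t ω : ℝ) ≤ M * ρ n := by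
    intro n
    rw [ae_all_iff]
    intro t
    have h1 : ∀ᵐ ω ∂P, (m n t ω : ℝ) / ρ n ∈ Icc (1 : ℝ) M :=
      (hid n t).symm.ae_mem_snd measurableSet_Icc (ae_of_all _ fun ω =>
        ⟨by exact_mod_cast (hb ω).1, by exact_mod_cast (hb ω).2⟩)
    filter_upwards [h1] with ω hω
    rw [mem_Icc, le_div_iff₀ (h.pos n), div_le_iff₀ (h.pos n), one_mul] at hω
    exact hω
  refine ⟨M, hM, fun n => ?_, key⟩
  obtain ⟨ω, hω⟩ := (key n).exists
  obtain ⟨h1, h2⟩ := hω 0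
  have h3 : 0 < (m n 0 ω : ℝ) := (h.pos n).trans_le h1
  have h4 : (1 : ℝ) ≤ m n 0 ω := by
    have : 0 < m n 0 ω := by exact_mod_cast h3
    exact_mod_cast this
  rw [div_le_iff₀ (by linarith)]
  linarith

end ModelFacts

/-! ### The noise of products of observations -/

section ProductNoise

variable {Ω : Type*} [MeasurableSpace Ω] {P : Measure Ω} [IsProbabilityMeasure P]

/-- Second moments of sums of `ε a`, `a = (t, i, j)`, with weights that depend on the design and
vanish unless the `i`-th location of curve `t` lies in `J₁` and the `j`-th location of curve
`t + k` lies in `J₂`, are at most of the order suggested by the expected numbers of locations. -/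
def NoiseSumBound (P : Measure Ω) (U : ℤ → ℕ → Ω → I) (m : ℕ → ℤ → Ω → ℕ) (k : ℕ)
    (ε : ℤ × ℕ × ℕ → Ω → ℝ) (C : ℝ) : Prop :=
  ∀ (n : ℕ) (J₁ J₂ : Set I) (p₁ p₂ : ℝ), Locations P U J₁ p₁ → Locations P U J₂ p₂ →
    ∀ (R₁ R₂ : ℕ) (F : Finset ℤ) (B : ℝ), 0 ≤ B →
    ∀ g : (ℤ → ℕ → I) × (ℤ → ℕ) → ℤ × ℕ × ℕ → ℝ, (∀ a, Measurable fun d => g d a) →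
    (∀ d a, |g d a| ≤ B * (J₁.indicator (fun _ => (1 : ℝ)) (d.1 a.1 a.2.1) *
      J₂.indicator (fun _ => (1 : ℝ)) (d.1 (a.1 + k) a.2.2))) →
    ∫⁻ ω, ENNReal.ofReal ((∑ a ∈ F ×ˢ (Finset.range R₁ ×ˢ Finset.range R₂),
      g ((fun t i => U t i ω), fun t => m n t ω) a * ε a ω) ^ 2) ∂P ≤
      ENNReal.ofReal (B ^ 2 * (F.card * (C * (countSq (R₁ * p₁) * countSq (R₂ * p₂) +
        ((R₁ * p₁) * (R₂ * p₂)) ^ 2))))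

lemma LatentModel.exists_noiseSumBound {E : Type*} [MeasurableSpace E] {V : ℤ → Ω → E}
    {η : ℤ → ℕ → Ω → ℝ} {lam c Mη : ℝ} (h : LatentModel P V η lam c Mη) (hlam : 1 < lam)
    {k : ℕ} (hk : 1 ≤ k) {α β : I → E → ℝ} {M : ℝ}
    (hα : ∀ x, SqBounded P V (α x) M) (hβ : ∀ x, SqBounded P V (β x) M)
    {Fα Fβ : ℤ → E × I → ℝ} (mFα : ∀ t, Measurable (Fα t)) (mFβ : ∀ t, Measurable (Fβ t))
    (eFα : ∀ t ω x, Fα t (V t ω, x) = α x (V t ω)) (eFβ : ∀ t ω x, Fβ t (V t ω, x) = β x (V t ω))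
    {G : I × I → ℝ} (mG : Measurable G) (eG : ∀ x y, G (x, y) = latentMean P V k (α x) (β y))
    (hMη : 0 ≤ Mη) (hM : 0 ≤ M) {U : ℤ → ℕ → Ω → I} {m : ℕ → ℤ → Ω → ℕ}
    (hm : ∀ n t, Measurable (m n t))
    (hind : ∀ n, IndepFun (fun ω => ((fun t : ℤ => V t ω), fun (t : ℤ) (i : ℕ) => η t i ω))
      (fun ω => ((fun (t : ℤ) (i : ℕ) => U t i ω), fun t : ℤ => m n t ω)) P) (σ₁ : ℝ) :
    ∃ C : ℝ, 0 ≤ C ∧ NoiseSumBound P U m k (fun a ω =>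
      noisyProd V η k σ₁ 1 (α (U a.1 a.2.1 ω)) (β (U (a.1 + k) a.2.2 ω)) a.1 a.2.1 a.2.2 ω -
        G (U a.1 a.2.1 ω, U (a.1 + k) a.2.2 ω)) C := by
  obtain ⟨S, hS, hsum⟩ := exists_sum_noiseCov_le k hlam
  have hc := h.c_nonneg
  have nC₀ : 0 ≤ noisySq c Mη M M σ₁ 1 := by unfold noisySq; positivity
  have nC₁ : 0 ≤ c * (M * M) := by positivity
  refine ⟨S * (noisySq c Mη M M σ₁ 1 + c * (M * M)), by positivity,
    fun n J₁ J₂ p₁ p₂ h₁ h₂ R₁ R₂ F B hB g mg hg => ?_⟩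
  refine (lintegral_noise_sq_le h hk hα hβ mFα mFβ eFα eFβ mG eG hMη hM (hm n) (hind n) h₁ h₂ σ₁
    R₁ R₂ F hsum hB g mg hg).trans (ENNReal.ofReal_le_ofReal ?_)
  have hp₁ := h₁.nonneg
  have hp₂ := h₂.nonneg
  have q1 : 0 ≤ countSq (R₁ * p₁) * countSq (R₂ * p₂) := by unfold countSq; positivity
  have q2 : 0 ≤ ((R₁ * p₁) * (R₂ * p₂)) ^ 2 := by positivity
  unfold noiseBound
  refine mul_le_mul_of_nonneg_left (mul_le_mul_of_nonneg_left ?_ (by positivity)) (by positivity)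
  rw [mul_assoc S]
  refine mul_le_mul_of_nonneg_left ?_ hS
  nlinarith [mul_nonneg nC₀ q2, mul_nonneg nC₁ q1]

variable {W X e : ℤ → Ω → I → ℝ} {Y : ℤ → Ω → ℝ} {U : ℤ → ℕ → Ω → I} {η : ℤ → ℕ → Ω → ℝ}
  {m : ℕ → ℤ → Ω → ℕ} {ρ : ℕ → ℝ} {k : ℕ} {s lam : ℝ}

lemma IsC2Square.continuous {g : I → I → ℝ} (h : IsC2Square g) :
    Continuous fun p : I × I => g p.1 p.2 := by
  have h1 := h.continuousOn.comp_continuous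
    (f := fun p : I × I => ((p.1 : ℝ), (p.2 : ℝ))) (by fun_prop) (fun p => ⟨p.1.2, p.2.2⟩)
  simpa [Function.comp_def] using h1

lemma IsC2.continuous {g : I → ℝ} (h : IsC2 g) : Continuous g := by
  have h1 := h.continuousOn.comp_continuous
    (f := fun p : I => (p : ℝ)) (by fun_prop) (fun p => p.2)
  simpa [Function.comp_def] using h1

lemma ContaminationModel.memLp (h : ContaminationModel P W X e) (t : ℤ) (u : I) :
    MemLp (fun ω => W t ω u) 2 P := by
  simp only [h.decomp]
  exact (h.memLp_X t u).add (h.memLp_e t u)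

lemma ContaminationModel.mean (h : ContaminationModel P W X e) (t : ℤ) (u : I) :
    ∫ ω, W t ω u ∂P = 0 := by
  simp only [h.decomp]
  rw [integral_add ((h.memLp_X t u).integrable (by norm_num))
    ((h.memLp_e t u).integrable (by norm_num)), h.mean_X, h.mean_e, add_zero]

/-- At a nonzero lag the white noise is uncorrelated with itself and with the signal, so the
observed curves have the signal's autocovariance; centring removes the product of means. -/
lemma ContaminationModel.autocov_eq (h : ContaminationModel P W X e) (hk : 1 ≤ k) (u v : I) :
    autocov P X k u v = latentMean P W k (fun w => w u) (fun w => w v) := by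
  have hX := fun t u => h.memLp_X t u
  have he := fun t u => h.memLp_e t u
  have e0 : ∀ t u, (fun ω => W t ω u) = (fun ω => X t ω u) + fun ω => e t ω u := fun t u =>
    funext fun ω => h.decomp t ω u
  have e1 : covariance (fun ω => W 0 ω u) (fun ω => W k ω v) P = autocov P X k u v := by
    rw [e0, e0, covariance_add_left (hX _ _) (he _ _) ((hX _ _).add (he _ _)),
      covariance_add_right (hX _ _) (hX _ _) (he _ _),
      covariance_add_right (he _ _) (hX _ _) (he _ _), h.uncorrelated, h.white 0 k (by omega),
      covariance_comm (fun ω => e 0 ω u), h.uncorrelated]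
    simp [autocov]
  rw [← e1, covariance_eq_sub (h.memLp _ _) (h.memLp _ _), h.mean, h.mean]
  simp [latentMean]

/-- Centring of the curve alone removes the product of means; the response may have any mean. -/
lemma ContaminationModel.crosscov_eq (h : ContaminationModel P W X e) (hY : ∀ t, MemLp (Y t) 2 P)
    (u : I) : crosscov P Y W k u =
      latentMean P (fun t ω => (W t ω, Y t ω)) k Prod.snd (fun w => w.1 u) := by
  rw [crosscov, covariance_eq_sub (hY _) (h.memLp _ _), h.mean]
  simp [latentMean]

/-- The noise in the products of two observations. -/
def surfaceNoise (P : Measure Ω) (W X : ℤ → Ω → I → ℝ) (U : ℤ → ℕ → Ω → I) (η : ℤ → ℕ → Ω → ℝ)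
    (k : ℕ) (a : ℤ × ℕ × ℕ) (ω : Ω) : ℝ :=
  obs W U η ω a.1 a.2.1 * obs W U η ω (a.1 + k) a.2.2 -
    autocov P X k (U a.1 a.2.1 ω) (U (a.1 + k) a.2.2 ω)

/-- The noise in the products of a response and an observation. -/
def lineNoise (P : Measure Ω) (W : ℤ → Ω → I → ℝ) (Y : ℤ → Ω → ℝ) (U : ℤ → ℕ → Ω → I)
    (η : ℤ → ℕ → Ω → ℝ) (k : ℕ) (a : ℤ × ℕ × ℕ) (ω : Ω) : ℝ :=
  Y a.1 ω * obs W U η ω (a.1 + k) a.2.2 - crosscov P Y W k (U (a.1 + k) a.2.2 ω)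

lemma exists_noiseSumBound_surface (hs : 2 < s) (hlam : 1 < lam) (hk : 1 ≤ k)
    (hmodel : ContaminationModel P W X e) (hWmeas : MeasurableCurves W)
    (hWmix : IsMixingSequence P W lam) (hWmom : BoundedMoments P W (2 * s))
    (hη : IsMeasurementError P η (2 * s)) (hU : IsLocationDesign P U) (hm : IsCountDesign P m ρ)
    (hindep : IsIndependentDesign P W U η m) (hC : IsC2Square (autocov P X k)) :
    ∃ C : ℝ, 0 ≤ C ∧ NoiseSumBound P U m k (surfaceNoise P W X U η k) C := by
  obtain ⟨c, Mη, hMη, hL⟩ := hWmix.exists_latentModel (by linarith) hη (by linarith)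
    (hindep.errors.comp measurable_id measurable_fst)
  obtain ⟨M, hM⟩ := hWmom
  choose F mF eF using hWmeas.exists_factor
  have hα : ∀ x : I, SqBounded P W (fun w => w x) (1 + M) := fun x => by
    obtain ⟨h1, h2⟩ := memLp_two_of_lintegral_rpow_le (hmodel.memLp 0 x).aestronglyMeasurable
      (by linarith) (hM 0 x)
    exact ⟨measurable_pi_apply x, h1, h2⟩
  obtain ⟨C, hC0, hb⟩ := hL.exists_noiseSumBound hlam hk hα hα mF mF eF eF hC.continuous.measurable
    (fun x y => hmodel.autocov_eq hk x y) hMη (by positivity) hm.measurable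
    (hindep.indepFun_latent_design hWmix.measurable hU.measurable hη.measurable hm.measurable) 1
  refine ⟨C, hC0, ?_⟩
  convert hb using 3
  simp [surfaceNoise, noisyProd, obs]

lemma exists_noiseSumBound_line (hs : 2 < s) (hlam : 1 < lam) (hk : 1 ≤ k)
    (hmodel : ContaminationModel P W X e) (hWmeas : MeasurableCurves W)
    (hWmom : BoundedMoments P W (2 * s)) (hY : ∀ t, MemLp (Y t) 2 P)
    (hmix : IsMixingSequence P (fun t ω => (W t ω, Y t ω)) lam)
    (hη : IsMeasurementError P η (2 * s)) (hU : IsLocationDesign P U) (hm : IsCountDesign P m ρ)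
    (hindep : IsIndependentDesign P (fun t ω => (W t ω, Y t ω)) U η m)
    (hC : IsC2 (crosscov P Y W k)) :
    ∃ C : ℝ, 0 ≤ C ∧ NoiseSumBound P U m k (lineNoise P W Y U η k) C := by
  obtain ⟨c, Mη, hMη, hL⟩ := hmix.exists_latentModel (by linarith) hη (by linarith)
    (hindep.errors.comp measurable_id measurable_fst)
  obtain ⟨M, hM⟩ := hWmom
  choose F mF eF using hWmeas.exists_factor
  set M' : ℝ := 1 + M + ∫ ω, Y 0 ω ^ 2 ∂P with hM'
  have hY0 : 0 ≤ ∫ ω, Y 0 ω ^ 2 ∂P := integral_nonneg fun ω => sq_nonneg _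
  have hM0 : 0 ≤ (M : ℝ) := M.2
  have hβ : ∀ x : I, SqBounded P (fun t ω => (W t ω, Y t ω)) (fun w => w.1 x) M' := fun x => by
    obtain ⟨h1, h2⟩ := memLp_two_of_lintegral_rpow_le (hmodel.memLp 0 x).aestronglyMeasurable
      (by linarith) (hM 0 x)
    exact ⟨(measurable_pi_apply x).comp measurable_fst, h1, h2.trans (by linarith)⟩
  have hα : ∀ _ : I, SqBounded P (fun t ω => (W t ω, Y t ω)) Prod.snd M' := fun _ =>
    ⟨measurable_snd, hY 0, by show ∫ ω, Y 0 ω ^ 2 ∂P ≤ M'; linarith⟩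
  -- The response plays the role of the first reading. It does not depend on a location and carries
  -- no measurement error, hence the final argument `σ₁ = 0`.
  obtain ⟨C, hC0, hb⟩ := hL.exists_noiseSumBound hlam hk hα hβ
    (Fα := fun _ p => p.1.2) (Fβ := fun t p => F t (p.1.1, p.2))
    (fun t => by fun_prop) (fun t => (mF t).comp (by fun_prop)) (fun t ω x => rfl)
    (fun t ω x => eF t ω x) (G := fun p => crosscov P Y W k p.2)
    (hC.continuous.measurable.comp measurable_snd)
    (fun x y => hmodel.crosscov_eq hY y) hMη (by positivity) hm.measurable
    (hindep.indepFun_latent_design hmix.measurable hU.measurable hη.measurable hm.measurable) 0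
  refine ⟨C, hC0, ?_⟩
  convert hb using 3
  simp [lineNoise, noisyProd, obs]

end ProductNoise

/-! ### Uniform lower bounds for the numbers of locations in the grid cells -/

section Tails

lemma tendsto_rpow_mul_exp_neg_rpow (C p : ℝ) {c ε : ℝ} (hc : 0 < c) (hε : 0 < ε) :
    Tendsto (fun x : ℝ => C * (x ^ p * Real.exp (-(c * x ^ ε)))) atTop (𝓝 0) := by
  have h1 := (tendsto_rpow_mul_exp_neg_mul_atTop_nhds_zero (p / ε) c hc).comp
    (tendsto_rpow_atTop hε)
  rw [← mul_zero C]
  refine (h1.congr' ?_).const_mul C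
  filter_upwards [eventually_ge_atTop 0] with x hx
  simp only [Function.comp_apply]
  rw [← Real.rpow_mul hx, mul_div_cancel₀ _ hε.ne', neg_mul]

/-- If `log x / (x ^ θ * y) → 0` and `x → ∞` then eventually `1 / y ≤ x ^ θ`. -/
lemma eventually_one_le_rpow_mul {x y : ℕ → ℝ} {θ : ℝ} (hx : Tendsto x atTop atTop)
    (hy : ∀ n, 0 < y n)
    (h : Tendsto (fun n => Real.log (x n) / (x n ^ θ * y n)) atTop (𝓝 0)) :
    ∀ᶠ n in atTop, 1 ≤ x n ^ θ * y n := by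
  filter_upwards [h.eventually_lt_const one_pos, hx.eventually_ge_atTop (Real.exp 1)] with n h1 h2
  have h0 : 0 < x n := (Real.exp_pos 1).trans_le h2
  have hpos : 0 < x n ^ θ * y n := mul_pos (Real.rpow_pos_of_pos h0 _) (hy n)
  rw [div_lt_one hpos] at h1
  have : 1 ≤ Real.log (x n) := by
    rw [Real.le_log_iff_exp_le h0]; exact h2
  linarith

/-- The number of disjoint time blocks of length `2k` is of order `n` despite both roundings. -/
lemma div_sub_lower {n L k : ℕ} (hk : 1 ≤ k) (hn : 4 * L + 8 * k ≤ n) :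
    (n : ℝ) / (8 * k) ≤ ((n - L) / (2 * k) : ℕ) := by
  have h1 : n - L < 2 * k * ((n - L) / (2 * k) + 1) := Nat.lt_mul_div_succ _ (by omega)
  have h2 : n ≤ (n - L) / (2 * k) * (8 * k) := by
    have : (n - L) / (2 * k) * (8 * k) = 4 * (2 * k * ((n - L) / (2 * k))) := by ring
    rw [this]
    rw [mul_add] at h1
    omega
  rw [div_le_iff₀ (by positivity)]
  exact_mod_cast h2

/-- With `x = n ρ²`, the number of pairs of cells is at most `x / δ²`. If `z ≥ x^ε`, the bound
through single counts is already of order `x exp(-x^ε / 8)`. If `z ≤ x^ε`, then `(1 + z)² ≤ 4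
x^{2ε}` and `n z² = b² x h² ≥ b² x^{1-θ} = b² x^{4ε}`, so the Bernstein exponent is still at least
of order `x^{2ε}`. This explains the choice `4 ε = 1 - θ`. -/
lemma surface_tail_le {θ ε b δ ρ₀ ρ h : ℝ} {n N k : ℕ} (hε : 1 - θ = 4 * ε)
    (hε0 : 0 < ε) (hb : 0 < b) (hδ : 0 < δ) (hρ₀ : 0 < ρ₀) (hρ : ρ₀ ≤ ρ) (hh : 0 < h)
    (hk : 1 ≤ k) (hN : (n : ℝ) / (8 * k) ≤ N) (hNn : N ≤ n) (hx1 : 1 ≤ n * ρ ^ 2)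
    (hxh : 1 ≤ (n * ρ ^ 2) ^ θ * h ^ 2) :
    (1 / (δ * h)) ^ 2 * min (Real.exp (-(N * (b * ρ * h / (1 + b * ρ * h)) ^ 2 / 8)))
        (2 * N * Real.exp (-(b * ρ * h / 8))) ≤
      1 / δ ^ 2 * ((n * ρ ^ 2) ^ (1 : ℝ) *
          Real.exp (-(b ^ 2 / (256 * k) * (n * ρ ^ 2) ^ (2 * ε)))) +
        2 / (δ ^ 2 * ρ₀ ^ 2) * ((n * ρ ^ 2) ^ (2 : ℝ) *
          Real.exp (-(1 / 8 * (n * ρ ^ 2) ^ ε))) := by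
  have hρ0 : 0 < ρ := hρ₀.trans_le hρ
  set x := n * ρ ^ 2 with hx
  have x0 : 0 < x := by linarith
  set z := b * ρ * h with hz
  have z0 : 0 < z := by positivity
  have hk0 : (0 : ℝ) < k := by exact_mod_cast hk
  have hinv : (1 / (δ * h)) ^ 2 ≤ 1 / δ ^ 2 * x := by
    have h1 : 1 ≤ x * h ^ 2 := hxh.trans (by
      gcongr
      calc x ^ θ ≤ x ^ (1 : ℝ) := Real.rpow_le_rpow_of_exponent_le hx1 (by linarith)
        _ = x := Real.rpow_one x)
    rw [div_pow, one_pow, mul_pow, one_div_mul_eq_div, div_le_div_iff₀ (by positivity)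
      (by positivity)]
    nlinarith [sq_nonneg δ]
  have t1 : 0 ≤ 1 / δ ^ 2 * (x ^ (1 : ℝ) * Real.exp (-(b ^ 2 / (256 * k) * x ^ (2 * ε)))) := by
    positivity
  have t2 : 0 ≤ 2 / (δ ^ 2 * ρ₀ ^ 2) * (x ^ (2 : ℝ) * Real.exp (-(1 / 8 * x ^ ε))) := by
    positivity
  rcases le_total (x ^ ε) z with hcase | hcase
  · refine le_trans ?_ (le_add_of_nonneg_left t1)
    have hNx : (N : ℝ) ≤ x / ρ₀ ^ 2 := by
      rw [le_div_iff₀ (by positivity)]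
      have : (N : ℝ) ≤ n := by exact_mod_cast hNn
      rw [hx]
      gcongr
    calc _ ≤ (1 / δ ^ 2 * x) * (2 * (x / ρ₀ ^ 2) * Real.exp (-(1 / 8 * x ^ ε))) := by
          refine mul_le_mul hinv ((min_le_right _ _).trans ?_) (by positivity) (by positivity)
          gcongr
          linarith
      _ = _ := by
          rw [Real.rpow_two]
          field_simp
  · refine le_trans ?_ (le_add_of_nonneg_right t2)
    rw [Real.rpow_one, ← mul_assoc]
    refine mul_le_mul hinv ((min_le_left _ _).trans (Real.exp_le_exp.2 (neg_le_neg ?_)))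
      (by positivity) (by positivity)
    have hxε : 1 ≤ x ^ ε := Real.one_le_rpow hx1 hε0.le
    have h2 : 1 + z ≤ 2 * x ^ ε := by linarith
    have h3 : b ^ 2 * x ^ (2 * ε) * x ^ (2 * ε) ≤ n * z ^ 2 := by
      have e : x ^ (2 * ε) * x ^ (2 * ε) * x ^ θ = x := by
        rw [← Real.rpow_add x0, ← Real.rpow_add x0]
        rw [show 2 * ε + 2 * ε + θ = 1 by linarith, Real.rpow_one]
      calc b ^ 2 * x ^ (2 * ε) * x ^ (2 * ε) = b ^ 2 * (x ^ (2 * ε) * x ^ (2 * ε)) * 1 := by ring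
        _ ≤ b ^ 2 * (x ^ (2 * ε) * x ^ (2 * ε)) * (x ^ θ * h ^ 2) := by gcongr
        _ = b ^ 2 * (x ^ (2 * ε) * x ^ (2 * ε) * x ^ θ) * h ^ 2 := by ring
        _ = n * z ^ 2 := by rw [e, hx, hz]; ring
    have h4 : (1 + z) ^ 2 ≤ 4 * x ^ (2 * ε) := by
      have e : x ^ (2 * ε) = x ^ ε * x ^ ε := by rw [← Real.rpow_add x0]; ring_nf
      rw [e]
      nlinarith
    have h5 : b ^ 2 / (32 * k) * x ^ (2 * ε) ≤ N * (z / (1 + z)) ^ 2 := by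
      calc b ^ 2 / (32 * k) * x ^ (2 * ε) =
            (b ^ 2 * x ^ (2 * ε) * x ^ (2 * ε)) / (8 * k) / (4 * x ^ (2 * ε)) := by
            field_simp; ring
        _ ≤ (n * z ^ 2) / (8 * k) / (1 + z) ^ 2 := by gcongr
        _ = (n / (8 * k)) * (z / (1 + z)) ^ 2 := by rw [div_pow]; ring
        _ ≤ _ := by gcongr
    calc b ^ 2 / (256 * k) * x ^ (2 * ε) = b ^ 2 / (32 * k) * x ^ (2 * ε) / 8 := by
          field_simp; ring
      _ ≤ _ := by gcongr

lemma tendsto_surface_tail {θ b δ ρ₀ : ℝ} {ρ h : ℕ → ℝ} {k : ℕ} (L : ℕ) (hθ1 : θ < 1)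
    (hb : 0 < b) (hδ : 0 < δ) (hρ₀ : 0 < ρ₀) (hρ : ∀ n, ρ₀ ≤ ρ n) (hh : ∀ n, 0 < h n) (hk : 1 ≤ k)
    (hlog : Tendsto (fun n : ℕ => Real.log (n * ρ n ^ 2) / ((n * ρ n ^ 2) ^ θ * h n ^ 2)) atTop
      (𝓝 0)) :
    Tendsto (fun n : ℕ => (1 / (δ * h n)) ^ 2 *
      min (Real.exp (-(((n - L) / (2 * k) : ℕ) * (b * ρ n * h n / (1 + b * ρ n * h n)) ^ 2 / 8)))
        (2 * ((n - L) / (2 * k) : ℕ) * Real.exp (-(b * ρ n * h n / 8)))) atTop (𝓝 0) := by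
  have hx : Tendsto (fun n : ℕ => (n : ℝ) * ρ n ^ 2) atTop atTop := by
    refine tendsto_atTop_mono (fun n => ?_)
      (tendsto_natCast_atTop_atTop.atTop_mul_const (by positivity : 0 < ρ₀ ^ 2))
    have := hρ n
    gcongr
  have hk0 : (0 : ℝ) < k := by exact_mod_cast hk
  have hlim := ((tendsto_rpow_mul_exp_neg_rpow (1 / δ ^ 2) 1
    (by positivity : 0 < b ^ 2 / (256 * k)) (by linarith : 0 < 2 * ((1 - θ) / 4))).add
    (tendsto_rpow_mul_exp_neg_rpow (2 / (δ ^ 2 * ρ₀ ^ 2)) 2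
    (by norm_num : (0 : ℝ) < 1 / 8) (by linarith : 0 < (1 - θ) / 4))).comp hx
  rw [add_zero] at hlim
  refine squeeze_zero' ?_ ?_ hlim
  · filter_upwards with n
    have := hh n
    have := hρ₀.trans_le (hρ n)
    positivity
  · filter_upwards [hx.eventually_ge_atTop 1, eventually_ge_atTop (4 * L + 8 * k),
      eventually_one_le_rpow_mul hx (fun n => pow_pos (hh n) 2) hlog] with n h1 h2 h3
    exact surface_tail_le (by ring) (by linarith) hb hδ hρ₀ (hρ n) (hh n) hk
      (div_sub_lower hk h2) ((Nat.div_le_self _ _).trans (Nat.sub_le _ _)) h1 h3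

/-- Single locations are independent across all curves, so the exponent is the expected total count.
That is of order `n ρ h ≥ (n ρ)^{1-θ}`, and no second regime is needed. -/
lemma tendsto_line_tail {θ b δ ρ₀ : ℝ} {ρ h : ℕ → ℝ} (L : ℕ) (hθ1 : θ < 1)
    (hb : 0 < b) (hδ : 0 < δ) (hρ₀ : 0 < ρ₀) (hρ : ∀ n, ρ₀ ≤ ρ n) (hh : ∀ n, 0 < h n)
    (hlog : Tendsto (fun n : ℕ => Real.log (n * ρ n) / ((n * ρ n) ^ θ * h n)) atTop (𝓝 0)) :
    Tendsto (fun n : ℕ => 1 / (δ * h n) * Real.exp (-((n - L : ℕ) * (b * ρ n * h n) / 8))) atTop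
      (𝓝 0) := by
  have hx : Tendsto (fun n : ℕ => (n : ℝ) * ρ n) atTop atTop := by
    refine tendsto_atTop_mono (fun n => ?_) (tendsto_natCast_atTop_atTop.atTop_mul_const hρ₀)
    have := hρ n
    gcongr
  have hlim := (tendsto_rpow_mul_exp_neg_rpow (1 / δ) 1
    (by positivity : 0 < b / 16) (by linarith : 0 < 1 - θ)).comp hx
  refine squeeze_zero' ?_ ?_ hlim
  · filter_upwards with n
    have := hh n
    positivity
  · filter_upwards [hx.eventually_ge_atTop 1, eventually_ge_atTop (2 * L),
      eventually_one_le_rpow_mul hx hh hlog] with n h1 h2 h3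
    have hρn := hρ₀.trans_le (hρ n)
    have hhn := hh n
    simp only [Function.comp_apply]
    set x := (n : ℝ) * ρ n with hxdef
    have x0 : 0 < x := by linarith
    rw [Real.rpow_one, ← mul_assoc (1 / δ)]
    refine mul_le_mul ?_ (Real.exp_le_exp.2 (neg_le_neg ?_)) (by positivity) (by positivity)
    · have h4 : 1 ≤ x * h n := h3.trans (by
        gcongr
        calc x ^ θ ≤ x ^ (1 : ℝ) := Real.rpow_le_rpow_of_exponent_le h1 (by linarith)
          _ = x := Real.rpow_one x)
      rw [one_div_mul_eq_div, div_le_div_iff₀ (by positivity) hδ]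
      nlinarith
    · have e : x ^ (1 - θ) ≤ x * h n := by
        calc x ^ (1 - θ) = x ^ (1 - θ) * 1 := (mul_one _).symm
          _ ≤ x ^ (1 - θ) * (x ^ θ * h n) := by gcongr
          _ = x ^ (1 - θ) * x ^ θ * h n := by ring
          _ = x * h n := by rw [← Real.rpow_add x0]; simp
      have hn2 : (n : ℝ) / 2 ≤ (n - L : ℕ) := by
        rw [Nat.cast_sub (by omega)]
        have : (2 * L : ℝ) ≤ n := by exact_mod_cast h2
        linarith
      calc b / 16 * x ^ (1 - θ) ≤ b / 16 * (x * h n) := by gcongr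
        _ = (n / 2) * (b * ρ n * h n) / 8 := by rw [hxdef]; ring
        _ ≤ _ := by gcongr

end Tails

/-! ### Union bounds over all grid cells. -/

section CellCounts

variable {Ω : Type*} [MeasurableSpace Ω] {P : Measure Ω} [IsProbabilityMeasure P]
  {U : ℤ → ℕ → Ω → I} {ρ h : ℕ → ℝ} {θ δ ρ₀ : ℝ} {k : ℕ}

lemma floor_one_div_le {d : ℝ} (hd : 0 < d) : (⌊1 / d⌋₊ : ℝ) ≤ 1 / d :=
  Nat.floor_le (by positivity)

lemma sum_separated_le (f : ℤ → ℝ) (hf : ∀ t, 0 ≤ f t) {n L : ℕ} (hk : 1 ≤ k) :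
    ∑ r ∈ Finset.range ((n - L) / (2 * k)), f (1 + 2 * k * r) ≤
      ∑ t ∈ Finset.Icc (1 : ℤ) ((n : ℤ) - L), f t := by
  have hinj : Function.Injective fun r : ℕ => (1 : ℤ) + 2 * k * r := by
    intro r r' hrr
    have hk' : (2 * k : ℤ) ≠ 0 := by positivity
    have h1 : (2 * k : ℤ) * r = 2 * k * r' := by simpa using hrr
    exact_mod_cast mul_left_cancel₀ hk' h1
  refine (Finset.sum_map (Finset.range ((n - L) / (2 * k))) ⟨_, hinj⟩ f).symm.trans_le ?_
  refine Finset.sum_le_sum_of_subset_of_nonneg (fun t ht => ?_) fun t _ _ => hf t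
  obtain ⟨r, hr, rfl⟩ := Finset.mem_map.1 ht
  have hr' := Finset.mem_range.1 hr
  have h1 : 2 * k * (r + 1) ≤ n - L :=
    (Nat.mul_le_mul_left _ hr').trans (Nat.mul_div_le _ _)
  have h3 : 0 < 2 * k * (r + 1) := by positivity
  have h2 : (2 * k * (r + 1) : ℤ) ≤ (n : ℤ) - L := by
    have : (2 * k * (r + 1) : ℕ) + L ≤ n := by omega
    have : ((2 * k * (r + 1) : ℕ) + L : ℤ) ≤ n := by exact_mod_cast this
    push_cast at this
    linarith
  simp only [Function.Embedding.coeFn_mk, Finset.mem_Icc]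
  have hk1 : (1 : ℤ) ≤ k := by exact_mod_cast hk
  have h4 : 0 ≤ 2 * (k : ℤ) * r := by positivity
  constructor
  · linarith
  · nlinarith

lemma tendsto_measure_of_real {A : ℕ → Set Ω} {x : ℕ → ℝ} (h : ∀ᶠ n in atTop, P.real (A n) ≤ x n)
    (hx : Tendsto x atTop (𝓝 0)) : Tendsto (fun n => P (A n)) atTop (𝓝 0) := by
  have h1 : Tendsto (fun n => P.real (A n)) atTop (𝓝 0) :=
    squeeze_zero' (Eventually.of_forall fun n => measureReal_nonneg) h hx
  have h2 := ENNReal.tendsto_ofReal h1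
  rw [ENNReal.ofReal_zero] at h2
  exact h2.congr fun n => ofReal_measureReal

/-- With probability tending to one all pairs of grid cells are hit by at least `c * n ρ² h²` pairs
of locations. -/
lemma IsLocationDesign.tendsto_surface_cells (hU : IsLocationDesign P U) (L : ℕ)
    (hθ1 : θ < 1) (hδ : 0 < δ) (hρ₀ : 0 < ρ₀) (hρ : ∀ n, ρ₀ ≤ ρ n) (hh : ∀ n, 0 < h n) (hk : 1 ≤ k)
    (hlog : Tendsto (fun n : ℕ => Real.log (n * ρ n ^ 2) / ((n * ρ n ^ 2) ^ θ * h n ^ 2)) atTop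
      (𝓝 0)) :
    ∃ c : ℝ, 0 < c ∧ Tendsto (fun n : ℕ => P {ω | ∃ j₁ < ⌊1 / (δ * h n)⌋₊,
      ∃ j₂ < ⌊1 / (δ * h n)⌋₊, ∑ t ∈ Finset.Icc (1 : ℤ) ((n : ℤ) - L),
        count U ⌈ρ n⌉₊ (cell (δ * h n) j₁) t ω * count U ⌈ρ n⌉₊ (cell (δ * h n) j₂) (t + k) ω ≤
          c * (n * (ρ n ^ 2 * h n ^ 2))}) atTop (𝓝 0) := by
  obtain ⟨a, -, ha, -, hcell, -⟩ := hU.exists_cell_window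
  have hk0 : (0 : ℝ) < k := by exact_mod_cast hk
  -- `1/(8k)` for the density of the selected time blocks, `1/4` from the lower tail, and `a δ` per
  -- cell from the location density.
  refine ⟨(a * δ) ^ 2 / (32 * k), by positivity, tendsto_measure_of_real ?_
    (tendsto_surface_tail (b := a * δ) L hθ1 (by positivity) hδ hρ₀ hρ hh hk hlog)⟩
  filter_upwards [eventually_ge_atTop (4 * L + 8 * k)] with n hn
  have hhn := hh n
  have hρn := hρ₀.trans_le (hρ n)
  set d := δ * h n with hd
  have hd0 : 0 < d := by positivity
  set N := (n - L) / (2 * k) with hNdef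
  have hN := div_sub_lower hk hn
  rw [← hNdef] at hN
  have hn0 : (0 : ℝ) < n := by
    have : 0 < n := by omega
    exact_mod_cast this
  have hN0 : 0 < N := by
    have : (0 : ℝ) < N := lt_of_lt_of_le (by positivity) hN
    exact_mod_cast this
  set z := a * δ * ρ n * h n with hz
  have hz0 : 0 < z := by positivity
  set bad : ℕ → ℕ → Set Ω := fun j₁ j₂ => {ω | ∑ r ∈ Finset.range N,
    count U ⌈ρ n⌉₊ (cell d j₁) (1 + 2 * k * r) ω *
      count U ⌈ρ n⌉₊ (cell d j₂) (1 + 2 * k * r + k) ω ≤ N * z ^ 2 / 4} with hbad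
  set q := min (Real.exp (-(N * (z / (1 + z)) ^ 2 / 8))) (2 * N * Real.exp (-(z / 8))) with hq
  have hb : ∀ j₁ < ⌊1 / d⌋₊, ∀ j₂ < ⌊1 / d⌋₊, P.real (bad j₁ j₂) ≤ q := by
    intro j₁ h₁ j₂ h₂
    obtain ⟨p₁, l₁, hp₁⟩ := hcell d hd0 j₁ h₁
    obtain ⟨p₂, l₂, hp₂⟩ := hcell d hd0 j₂ h₂
    have hz' : ∀ p, a * d ≤ p → z ≤ ⌈ρ n⌉₊ * p := fun p hp => by
      calc z = ρ n * (a * d) := by rw [hz, hd]; ring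
        _ ≤ ⌈ρ n⌉₊ * p := mul_le_mul (Nat.le_ceil _) hp (by positivity) (by positivity)
    exact l₁.pair_lower_tail_min l₂ _ hk hN0 hz0 (hz' _ hp₁) (hz' _ hp₂)
  have q0 : 0 ≤ q := by positivity
  calc _ ≤ P.real (⋃ j₁ ∈ Finset.range ⌊1 / d⌋₊, ⋃ j₂ ∈ Finset.range ⌊1 / d⌋₊, bad j₁ j₂) := by
        refine measureReal_mono (fun ω hω => ?_) (measure_ne_top _ _)
        obtain ⟨j₁, h₁, j₂, h₂, hle⟩ := hω
        simp only [mem_iUnion, Finset.mem_range]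
        refine ⟨j₁, h₁, j₂, h₂, ?_⟩
        simp only [hbad, mem_ofPred_eq]
        -- Discarding all times outside the separated blocks can only decrease the number of pairs.
        refine (sum_separated_le (k := k) (n := n) (L := L) (fun t => count U ⌈ρ n⌉₊ (cell d j₁) t ω *
          count U ⌈ρ n⌉₊ (cell d j₂) (t + k) ω) (fun t => mul_nonneg (count_nonneg _ _ _ _)
          (count_nonneg _ _ _ _)) hk).trans (hle.trans ?_)
        calc (a * δ) ^ 2 / (32 * k) * (n * (ρ n ^ 2 * h n ^ 2)) = n / (8 * k) * z ^ 2 / 4 := by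
              rw [hz]; field_simp; ring
          _ ≤ N * z ^ 2 / 4 := by gcongr
    _ ≤ ∑ j₁ ∈ Finset.range ⌊1 / d⌋₊, ∑ j₂ ∈ Finset.range ⌊1 / d⌋₊, P.real (bad j₁ j₂) :=
        (measureReal_biUnion_finset_le _ _).trans (Finset.sum_le_sum fun j₁ _ =>
          measureReal_biUnion_finset_le _ _)
    _ ≤ ∑ _j₁ ∈ Finset.range ⌊1 / d⌋₊, ∑ _j₂ ∈ Finset.range ⌊1 / d⌋₊, q :=
        Finset.sum_le_sum fun j₁ h₁ => Finset.sum_le_sum fun j₂ h₂ =>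
          hb _ (Finset.mem_range.1 h₁) _ (Finset.mem_range.1 h₂)
    _ = (⌊1 / d⌋₊ : ℝ) ^ 2 * q := by
        simp only [Finset.sum_const, Finset.card_range, nsmul_eq_mul]; ring
    _ ≤ (1 / d) ^ 2 * q := by
        have := floor_one_div_le hd0
        gcongr

lemma sum_Icc_add (f : ℤ → ℝ) (a b : ℤ) :
    ∑ t ∈ Finset.Icc a b, f (t + k) = ∑ t ∈ Finset.Icc (a + k) (b + k), f t := by
  rw [← Finset.map_add_right_Icc, Finset.sum_map]
  rfl

/-- With probability tending to one all grid cells are hit by at least `c * n ρ h` locations. -/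
lemma IsLocationDesign.tendsto_line_cells (hU : IsLocationDesign P U) (L : ℕ)
    (hθ1 : θ < 1) (hδ : 0 < δ) (hρ₀ : 0 < ρ₀) (hρ : ∀ n, ρ₀ ≤ ρ n) (hh : ∀ n, 0 < h n)
    (hlog : Tendsto (fun n : ℕ => Real.log (n * ρ n) / ((n * ρ n) ^ θ * h n)) atTop (𝓝 0)) :
    ∃ c : ℝ, 0 < c ∧ Tendsto (fun n : ℕ => P {ω | ∃ j < ⌊1 / (δ * h n)⌋₊,
      ∑ t ∈ Finset.Icc (1 : ℤ) ((n : ℤ) - L), count U ⌈ρ n⌉₊ (cell (δ * h n) j) (t + k) ω ≤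
          c * (n * (ρ n * h n))}) atTop (𝓝 0) := by
  obtain ⟨a, -, ha, -, hcell, -⟩ := hU.exists_cell_window
  -- One factor `1/2` accounts for `n - L ≥ n/2`, the other for the lower tail.
  refine ⟨a * δ / 4, by positivity, tendsto_measure_of_real ?_
    (tendsto_line_tail (b := a * δ) L hθ1 (by positivity) hδ hρ₀ hρ hh hlog)⟩
  filter_upwards [eventually_ge_atTop (2 * L)] with n hn
  have hhn := hh n
  have hρn := hρ₀.trans_le (hρ n)
  set d := δ * h n with hd
  have hd0 : 0 < d := by positivity
  set F := Finset.Icc ((1 : ℤ) + k) ((n : ℤ) - L + k) with hF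
  have hcard : (F.card : ℝ) = (n - L : ℕ) := by
    rw [hF, Int.card_Icc]
    congr 1
    omega
  have hn2 : (n : ℝ) / 2 ≤ (n - L : ℕ) := by
    rw [Nat.cast_sub (by omega)]
    have : (2 * L : ℝ) ≤ n := by exact_mod_cast hn
    linarith
  set z := a * δ * ρ n * h n with hz
  have hz0 : 0 < z := by positivity
  set bad : ℕ → Set Ω := fun j => {ω | ∑ t ∈ F, count U ⌈ρ n⌉₊ (cell d j) t ω ≤
    F.card * z / 2} with hbad
  have hb : ∀ j < ⌊1 / d⌋₊, P.real (bad j) ≤ Real.exp (-((n - L : ℕ) * z / 8)) := by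
    intro j hj
    obtain ⟨p, l, hp⟩ := hcell d hd0 j hj
    have hz' : z ≤ ⌈ρ n⌉₊ * p := by
      calc z = ρ n * (a * d) := by rw [hz, hd]; ring
        _ ≤ ⌈ρ n⌉₊ * p := mul_le_mul (Nat.le_ceil _) hp (by positivity) (by positivity)
    have hp0 : 0 < p := lt_of_lt_of_le (by positivity) hp
    refine (measureReal_mono (fun ω hω => ?_) (measure_ne_top _ _)).trans
      ((l.sum_lower_tail hp0 ⌈ρ n⌉₊ F).trans (Real.exp_le_exp.2 ?_))
    · refine le_trans hω.out ?_
      gcongr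
    · rw [← hcard]
      gcongr
  calc _ ≤ P.real (⋃ j ∈ Finset.range ⌊1 / d⌋₊, bad j) := by
        refine measureReal_mono (fun ω hω => ?_) (measure_ne_top _ _)
        obtain ⟨j, hj, hle⟩ := hω
        simp only [mem_iUnion, Finset.mem_range]
        refine ⟨j, hj, ?_⟩
        simp only [hbad, mem_ofPred_eq]
        rw [sum_Icc_add (fun t => count U ⌈ρ n⌉₊ (cell d j) t ω)] at hle
        refine hle.trans ?_
        rw [hcard]
        calc a * δ / 4 * (n * (ρ n * h n)) = n / 2 * z / 2 := by rw [hz]; ring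
          _ ≤ _ := by gcongr
    _ ≤ ∑ j ∈ Finset.range ⌊1 / d⌋₊, P.real (bad j) := measureReal_biUnion_finset_le _ _
    _ ≤ ∑ _j ∈ Finset.range ⌊1 / d⌋₊, Real.exp (-((n - L : ℕ) * z / 8)) :=
        Finset.sum_le_sum fun j hj => hb _ (Finset.mem_range.1 hj)
    _ = (⌊1 / d⌋₊ : ℝ) * Real.exp (-((n - L : ℕ) * z / 8)) := by
        simp only [Finset.sum_const, Finset.card_range, nsmul_eq_mul]
    _ ≤ 1 / d * Real.exp (-((n - L : ℕ) * z / 8)) := by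
        have := floor_one_div_le hd0
        gcongr

end CellCounts

/-! ### Rates from second moments -/

section Rates

variable {Ω Q : Type*} [MeasurableSpace Ω] [MeasurableSpace Q] {P : Measure Ω} {μ : Measure Q}
  [IsProbabilityMeasure P] [IsProbabilityMeasure μ]

/-- An `O_P` rate for an `L²` error that is dominated, on events of probability tending to one, by
a random field with small expectation. -/
lemma isBigOInProb_of_lintegral_le {f : ℕ → Ω → Q → ℝ} {B : ℕ → Ω → Q → ℝ≥0∞} {G : ℕ → Set Ω}
    {δ : ℕ → ℝ} {C : ℝ} (hC : 0 ≤ C) (hδ : ∀ᶠ n in atTop, 0 < δ n)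
    (hG : Tendsto (fun n => P (G n)ᶜ) atTop (𝓝 0))
    (hf : ∀ᶠ n in atTop, ∀ ω ∈ G n, ∀ q, ENNReal.ofReal (f n ω q ^ 2) ≤ B n ω q)
    (mB : ∀ n, Measurable (Function.uncurry (B n)))
    (hB : ∀ᶠ n in atTop, ∀ q, ∫⁻ ω, B n ω q ∂P ≤ ENNReal.ofReal (C * δ n ^ 2)) :
    IsBigOInProb P (fun n ω => eLpNorm (f n ω) 2 μ) δ := by
  intro ε hε
  -- Makes Markov's inequality return at most `ε / 2`; `C + 1` keeps `M` positive when `C = 0`.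
  set M := √(2 * (C + 1) / ε) with hM
  have hM2 : M ^ 2 = 2 * (C + 1) / ε := Real.sq_sqrt (by positivity)
  have hM0 : 0 < M := Real.sqrt_pos.2 (by positivity)
  have hG' : ∀ᶠ n in atTop, P (G n)ᶜ ≤ ENNReal.ofReal (ε / 2) :=
    (hG.eventually_lt_const (by simpa using hε)).mono fun n hn => hn.le
  refine ⟨M, hM0, ?_⟩
  filter_upwards [hδ, hf, hB, hG'] with n hδn hfn hBn hGn
  set T := ENNReal.ofReal ((M * δ n) ^ 2) with hT
  have hT0 : T ≠ 0 := by
    rw [hT, Ne, ENNReal.ofReal_eq_zero, not_le]; positivity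
  -- A choice of minimizers need not be measurable, so the error is never integrated over `Ω`. Only
  -- the dominating field is, and outer measure takes care of the inclusion.
  have hsub : {ω | ENNReal.ofReal (M * δ n) < eLpNorm (f n ω) 2 μ} ⊆
      (G n)ᶜ ∪ {ω | T ≤ ∫⁻ q, B n ω q ∂μ} := by
    intro ω hω
    by_cases hg : ω ∈ G n
    · right
      have h1 : eLpNorm (f n ω) 2 μ ^ 2 ≤ ∫⁻ q, B n ω q ∂μ := by
        rw [eLpNorm_eq_lintegral_rpow_enorm_toReal (by norm_num) (by norm_num),
          ← ENNReal.rpow_natCast, ← ENNReal.rpow_mul]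
        norm_num
        refine lintegral_mono fun q => le_trans (le_of_eq ?_) (hfn ω hg q)
        rw [← sq_abs, ENNReal.ofReal_pow (abs_nonneg _), ← Real.norm_eq_abs, ofReal_norm]
      refine le_trans ?_ h1
      rw [hT, ENNReal.ofReal_pow (by positivity)]
      exact pow_le_pow_left' hω.out.le 2
    · exact Or.inl hg
  have hMarkov : P {ω | T ≤ ∫⁻ q, B n ω q ∂μ} ≤ ENNReal.ofReal (ε / 2) := by
    refine (meas_ge_le_lintegral_div (mB n).lintegral_prod_right'.aemeasurable hT0
      ENNReal.ofReal_ne_top).trans ?_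
    have h2 : ∫⁻ ω, ∫⁻ q, B n ω q ∂μ ∂P ≤ ENNReal.ofReal (C * δ n ^ 2) := by
      rw [lintegral_lintegral_swap (mB n).aemeasurable]
      refine (lintegral_mono hBn).trans ?_
      simp
    refine (ENNReal.div_le_div_right h2 _).trans ?_
    rw [hT, ← ENNReal.ofReal_div_of_pos (by positivity)]
    refine ENNReal.ofReal_le_ofReal ?_
    rw [mul_pow, hM2, div_le_iff₀ (by positivity)]
    have : ε / 2 * (2 * (C + 1) / ε * δ n ^ 2) = (C + 1) * δ n ^ 2 := by field_simp
    rw [this]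
    nlinarith [sq_nonneg (δ n)]
  calc _ ≤ P (G n)ᶜ + P {ω | T ≤ ∫⁻ q, B n ω q ∂μ} := (measure_mono hsub).trans (measure_union_le _ _)
    _ ≤ ENNReal.ofReal (ε / 2) + ENNReal.ofReal (ε / 2) := add_le_add hGn hMarkov
    _ = ENNReal.ofReal ε := by
        rw [← ENNReal.ofReal_add (by positivity) (by positivity), add_halves]

end Rates

/-! ### Expected squared noise and bias of a weighted local fit. -/

section WeightedErrors

variable {Ω : Type*} [MeasurableSpace Ω] {P : Measure Ω} [IsProbabilityMeasure P]
  {U : ℤ → ℕ → Ω → I} {m : ℕ → ℤ → Ω → ℕ} {k : ℕ}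

/-- Controls the bias term: squared remainders are at most of order `h⁴` uniformly, so only the
expected total weight is needed. -/
lemma lintegral_sum_weight_le (hk : 1 ≤ k) {J₁ J₂ : Set I} {p₁ p₂ : ℝ} (h₁ : Locations P U J₁ p₁)
    (h₂ : Locations P U J₂ p₂) (R₁ R₂ : ℕ) (F : Finset ℤ) {B : ℝ} (hB : 0 ≤ B)
    {w : Ω → ℤ × ℕ × ℕ → ℝ}
    (hw : ∀ ω a, |w ω a| ≤ B * (J₁.indicator (fun _ => (1 : ℝ)) (U a.1 a.2.1 ω) *
      J₂.indicator (fun _ => (1 : ℝ)) (U (a.1 + k) a.2.2 ω))) :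
    ∫⁻ ω, ENNReal.ofReal (∑ a ∈ F ×ˢ (Finset.range R₁ ×ˢ Finset.range R₂), w ω a) ∂P ≤
      ENNReal.ofReal (B * (F.card * ((R₁ * p₁) * (R₂ * p₂)))) := by
  have hi : ∀ t, Integrable (fun ω => count U R₁ J₁ t ω * count U R₂ J₂ (t + k) ω) P := fun t =>
    integrable_of_designBound ((measurable_count h₁.measurable h₁.set _ _).mul
      (measurable_count h₁.measurable h₂.set _ _)) (B := R₁ * R₂)
      (fun ω => mul_nonneg (count_nonneg _ _ _ _) (count_nonneg _ _ _ _))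
      fun ω => mul_le_mul (count_le _ _ _ _) (count_le _ _ _ _) (count_nonneg _ _ _ _)
        (by positivity)
  have hle : ∀ ω, ∑ a ∈ F ×ˢ (Finset.range R₁ ×ˢ Finset.range R₂), w ω a ≤
      B * ∑ t ∈ F, count U R₁ J₁ t ω * count U R₂ J₂ (t + k) ω := by
    intro ω
    refine (Finset.sum_le_sum fun a _ => (le_abs_self _).trans (hw ω a)).trans (le_of_eq ?_)
    rw [← Finset.mul_sum, Finset.sum_product]
    simp only [sum_count_mul]
  refine (lintegral_mono fun ω => ENNReal.ofReal_le_ofReal (hle ω)).trans ?_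
  rw [← ofReal_integral_eq_lintegral_ofReal ((integrable_finsetSum _ fun t _ => hi t).const_mul _)
    (ae_of_all _ fun ω => mul_nonneg hB (Finset.sum_nonneg fun t _ =>
      mul_nonneg (count_nonneg _ _ _ _) (count_nonneg _ _ _ _))), integral_const_mul,
    integral_finsetSum _ fun t _ => hi t]
  refine le_of_eq ?_
  congr 2
  rw [Finset.sum_congr rfl fun t _ => h₁.integral_mul h₂ R₁ R₂ (t := t) (t' := t + k) (by omega),
    Finset.sum_const, nsmul_eq_mul]

lemma ofReal_mul_sum_add (ℓ : ℕ) {a b x y : ℝ} (ha : 0 ≤ a) (hb : 0 ≤ b) (hx : 0 ≤ x)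
    (hy : 0 ≤ y) :
    ENNReal.ofReal a * ∑ _i : Fin ℓ, ENNReal.ofReal x + ENNReal.ofReal b * ENNReal.ofReal y =
      ENNReal.ofReal (a * (ℓ * x) + b * y) := by
  rw [ENNReal.ofReal_add (by positivity) (by positivity), ENNReal.ofReal_mul ha,
    ENNReal.ofReal_mul hb, ENNReal.ofReal_mul (Nat.cast_nonneg ℓ)]
  simp

/-- The rate of a local linear estimator whose squared error is bounded by squares of weighted
noise sums and by a squared bias of order `h ^ 4`. -/
lemma NoiseSumBound.isBigOInProb {Q : Type*} [MeasurableSpace Q] {μ : Measure Q}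
    [IsProbabilityMeasure μ] {ε : ℤ × ℕ × ℕ → Ω → ℝ} {Cε : ℝ} (hε : NoiseSumBound P U m k ε Cε)
    (hCε : 0 ≤ Cε) (mε : ∀ a, Measurable (ε a)) (mU : ∀ t i, Measurable (U t i))
    (mm : ∀ n t, Measurable (m n t)) (hk : 1 ≤ k) {y h δ : ℕ → ℝ} (hy : ∀ n, 0 < y n)
    {c κ M B : ℝ} (hc : 0 < c) (hκ : 0 ≤ κ) (hB : 0 ≤ B)
    (hδ : ∀ᶠ n in atTop, 0 < δ n)
    (hrate : ∀ᶠ n in atTop, 1 / (n * y n) + 1 / n + h n ^ 4 ≤ δ n ^ 2)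
    {J₁ J₂ : ℕ → Q → Set I} {R₁ R₂ : ℕ → ℕ} {F : ℕ → Finset ℤ} (hF : ∀ n, (F n).card ≤ n)
    (hJ : ∀ n q, ∃ p₁ p₂, Locations P U (J₁ n q) p₁ ∧ Locations P U (J₂ n q) p₂ ∧
      countSq (R₁ n * p₁) * countSq (R₂ n * p₂) ≤ κ * (y n + y n ^ 2) ∧
      (R₁ n * p₁) * (R₂ n * p₂) ≤ κ * y n)
    {ℓ : ℕ} {w : ℕ → Q → (ℤ → ℕ → I) × (ℤ → ℕ) → ℤ × ℕ × ℕ → ℝ}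
    {x : ℕ → Q → (ℤ → ℕ → I) × (ℤ → ℕ) → ℤ × ℕ × ℕ → Fin ℓ → ℝ}
    (mw : ∀ n a, Measurable fun p : Q × ((ℤ → ℕ → I) × (ℤ → ℕ)) => w n p.1 p.2 a)
    (mx : ∀ n a i, Measurable fun p : Q × ((ℤ → ℕ → I) × (ℤ → ℕ)) => x n p.1 p.2 a i)
    (hw : ∀ n q d a, |w n q d a| ≤ B * ((J₁ n q).indicator (fun _ => (1 : ℝ)) (d.1 a.1 a.2.1) *
      (J₂ n q).indicator (fun _ => (1 : ℝ)) (d.1 (a.1 + k) a.2.2)))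
    (hx : ∀ n q d a i, |w n q d a * x n q d a i| ≤ |w n q d a|)
    {f : ℕ → Ω → Q → ℝ} {G : ℕ → Set Ω} (hG : Tendsto (fun n => P (G n)ᶜ) atTop (𝓝 0))
    (hf : ∀ᶠ n in atTop, ∀ ω ∈ G n, ∀ q, f n ω q ^ 2 ≤
      16 / (c * (n * y n)) ^ 2 * ∑ i, (∑ a ∈ F n ×ˢ (Finset.range (R₁ n) ×ˢ Finset.range (R₂ n)),
        w n q ((fun t i => U t i ω), fun t => m n t ω) a *
          x n q ((fun t i => U t i ω), fun t => m n t ω) a i * ε a ω) ^ 2 +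
      8 / (c * (n * y n)) * (M * h n ^ 2) ^ 2 *
        ∑ a ∈ F n ×ˢ (Finset.range (R₁ n) ×ˢ Finset.range (R₂ n)),
          w n q ((fun t i => U t i ω), fun t => m n t ω) a) :
    IsBigOInProb P (fun n ω => eLpNorm (f n ω) 2 μ) δ := by
  set A : ℕ → Finset (ℤ × ℕ × ℕ) := fun n => F n ×ˢ (Finset.range (R₁ n) ×ˢ Finset.range (R₂ n))
    with hA
  set D : ℕ → Ω → (ℤ → ℕ → I) × (ℤ → ℕ) := fun n ω => ((fun t i => U t i ω), fun t => m n t ω)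
    with hD
  have mD : ∀ n, Measurable (D n) := fun n => (measurable_pi_lambda _ fun t =>
    measurable_pi_lambda _ fun i => mU t i).prodMk (measurable_pi_lambda _ fun t => mm n t)
  set N : ℕ → Fin ℓ → Ω → Q → ℝ := fun n i ω q =>
    (∑ a ∈ A n, w n q (D n ω) a * x n q (D n ω) a i * ε a ω) ^ 2 with hN
  set V : ℕ → Ω → Q → ℝ := fun n ω q => ∑ a ∈ A n, w n q (D n ω) a with hV
  set b₁ : ℕ → ℝ := fun n => 16 / (c * (n * y n)) ^ 2 with hb₁
  set b₂ : ℕ → ℝ := fun n => 8 / (c * (n * y n)) * (M * h n ^ 2) ^ 2 with hb₂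
  have b₁0 : ∀ n, 0 ≤ b₁ n := fun n => by positivity
  have b₂0 : ∀ n, 0 ≤ b₂ n := fun n => by
    have := hy n
    positivity
  have mQ : ∀ n, Measurable fun p : Ω × Q => (p.2, D n p.1) := fun n =>
    measurable_snd.prodMk ((mD n).comp measurable_fst)
  have mN : ∀ n i, Measurable (Function.uncurry (N n i)) := fun n i =>
    (Finset.measurable_fun_sum _ fun a _ => (((mw n a).comp (mQ n)).mul ((mx n a i).comp (mQ n))).mul
      ((mε a).comp measurable_fst)).pow_const 2
  have mV : ∀ n, Measurable (Function.uncurry (V n)) := fun n =>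
    Finset.measurable_fun_sum _ fun a _ => (mw n a).comp (mQ n)
  set Bd : ℕ → Ω → Q → ℝ≥0∞ := fun n ω q =>
    ENNReal.ofReal (b₁ n) * ∑ i, ENNReal.ofReal (N n i ω q) +
      ENNReal.ofReal (b₂ n) * ENNReal.ofReal (V n ω q) with hBd
  refine isBigOInProb_of_lintegral_le (B := Bd) (G := G)
    (C := 16 * ℓ * B ^ 2 * Cε * (κ + κ ^ 2) / c ^ 2 + 8 * M ^ 2 * B * κ / c) (by positivity) hδ hG
    ?_ ?_ ?_
  · filter_upwards [hf] with n hfn ω hω q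
    refine (ENNReal.ofReal_le_ofReal (hfn ω hω q)).trans ?_
    refine ENNReal.ofReal_add_le.trans (add_le_add ?_ ?_)
    · rw [ENNReal.ofReal_mul (b₁0 n), ENNReal.ofReal_sum_of_nonneg fun i _ => sq_nonneg _]
    · rw [ENNReal.ofReal_mul (b₂0 n)]
  · intro n
    refine Measurable.add (Measurable.const_mul (Finset.measurable_fun_sum _ fun i _ => ?_) _)
      (Measurable.const_mul ?_ _)
    · exact ENNReal.measurable_ofReal.comp (mN n i)
    · exact ENNReal.measurable_ofReal.comp (mV n)
  · filter_upwards [hrate, eventually_gt_atTop 0] with n hr hn q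
    obtain ⟨p₁, p₂, h₁, h₂, hsq, hlin⟩ := hJ n q
    have hn0 : (0 : ℝ) < n := by exact_mod_cast hn
    have hyn := hy n
    have np₁ := h₁.nonneg
    have np₂ := h₂.nonneg
    have hcard : ((F n).card : ℝ) ≤ n := by exact_mod_cast hF n
    have iN : ∀ i, ∫⁻ ω, ENNReal.ofReal (N n i ω q) ∂P ≤
        ENNReal.ofReal (B ^ 2 * (n * (Cε * ((κ + κ ^ 2) * (y n + y n ^ 2))))) := by
      intro i
      refine (hε n _ _ p₁ p₂ h₁ h₂ (R₁ n) (R₂ n) (F n) B hB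
        (fun d a => w n q d a * x n q d a i)
        (fun a => ((mw n a).mul (mx n a i)).comp measurable_prodMk_left)
        (fun d a => (hx n q d a i).trans (hw n q d a))).trans (ENNReal.ofReal_le_ofReal ?_)
      have h3 : countSq (R₁ n * p₁) * countSq (R₂ n * p₂) + ((R₁ n * p₁) * (R₂ n * p₂)) ^ 2 ≤
          (κ + κ ^ 2) * (y n + y n ^ 2) := by
        have : ((R₁ n * p₁) * (R₂ n * p₂)) ^ 2 ≤ (κ * y n) ^ 2 :=
          pow_le_pow_left₀ (by positivity) hlin 2
        nlinarith [mul_nonneg (sq_nonneg κ) hyn.le]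
      have h4 : 0 ≤ countSq (R₁ n * p₁) * countSq (R₂ n * p₂) + ((R₁ n * p₁) * (R₂ n * p₂)) ^ 2 := by
        unfold countSq; positivity
      gcongr
    have iV : ∫⁻ ω, ENNReal.ofReal (V n ω q) ∂P ≤ ENNReal.ofReal (B * (n * (κ * y n))) := by
      refine (lintegral_sum_weight_le hk h₁ h₂ (R₁ n) (R₂ n) (F n) hB
        (fun ω a => hw n q (D n ω) a)).trans (ENNReal.ofReal_le_ofReal ?_)
      gcongr
    have m1 : ∀ i, Measurable fun ω => ENNReal.ofReal (N n i ω q) := fun i =>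
      ENNReal.measurable_ofReal.comp ((mN n i).of_uncurry_right (y := q))
    have m2 : Measurable fun ω => ENNReal.ofReal (V n ω q) :=
      ENNReal.measurable_ofReal.comp ((mV n).of_uncurry_right (y := q))
    have e1 : ∫⁻ ω, Bd n ω q ∂P = ENNReal.ofReal (b₁ n) * ∑ i, ∫⁻ ω, ENNReal.ofReal (N n i ω q) ∂P +
        ENNReal.ofReal (b₂ n) * ∫⁻ ω, ENNReal.ofReal (V n ω q) ∂P := by
      rw [hBd, lintegral_add_right _ (m2.const_mul _), lintegral_const_mul _ m2,
        lintegral_const_mul _ (Finset.measurable_fun_sum _ fun i _ => m1 i),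
        lintegral_finsetSum _ fun i _ => m1 i]
    rw [e1]
    calc _ ≤ ENNReal.ofReal (b₁ n) * ∑ _i : Fin ℓ,
            ENNReal.ofReal (B ^ 2 * (n * (Cε * ((κ + κ ^ 2) * (y n + y n ^ 2))))) +
          ENNReal.ofReal (b₂ n) * ENNReal.ofReal (B * (n * (κ * y n))) := by
          gcongr with i
          exact iN i
      _ = ENNReal.ofReal (b₁ n * (ℓ * (B ^ 2 * (n * (Cε * ((κ + κ ^ 2) * (y n + y n ^ 2)))))) +
          b₂ n * (B * (n * (κ * y n)))) := by
          exact ofReal_mul_sum_add ℓ (b₁0 n) (b₂0 n) (by positivity) (by positivity)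
      _ ≤ _ := by
          refine ENNReal.ofReal_le_ofReal ?_
          -- Here the noise rate appears: `n (y + y²) / (n y)² = 1 / (n y) + 1 / n`. In the bias
          -- term `n y` cancels and `h⁴` is left.
          have e2 : b₁ n * (ℓ * (B ^ 2 * (n * (Cε * ((κ + κ ^ 2) * (y n + y n ^ 2)))))) =
              16 * ℓ * B ^ 2 * Cε * (κ + κ ^ 2) / c ^ 2 * (1 / (n * y n) + 1 / n) := by
            rw [hb₁]; field_simp
          have e3 : b₂ n * (B * (n * (κ * y n))) = 8 * M ^ 2 * B * κ / c * h n ^ 4 := by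
            rw [hb₂]; field_simp
          rw [e2, e3, add_mul]
          have h5 : 0 ≤ 1 / (n * y n) + 1 / (n : ℝ) := by positivity
          have h6 : 0 ≤ h n ^ 4 := by positivity
          gcongr <;> linarith

end WeightedErrors

/-! ### Local linear fits on events with enough locations -/

section Fits

variable {Ω : Type*} [MeasurableSpace Ω] {U : ℤ → ℕ → Ω → I} {K : ℝ → ℝ}

/-- Moves the random number of locations from the summation range into the weights, so that the
index set is deterministic when expectations are taken. -/
lemma sum_range_ite {m R : ℕ} (hm : m ≤ R) (f : ℕ → ℝ) :
    ∑ i ∈ Finset.range m, f i = ∑ i ∈ Finset.range R, (if i < m then 1 else 0) * f i := by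
  simp only [ite_mul, one_mul, zero_mul]
  rw [← Finset.sum_filter]
  congr 1
  ext i
  simp only [Finset.mem_range, Finset.mem_filter]
  omega

lemma card_filter_locations (F : Finset ℤ) (R₁ R₂ k : ℕ) (J₁ J₂ : Set I)
    [DecidablePred (· ∈ J₁)] [DecidablePred (· ∈ J₂)] (ω : Ω) :
    (((F ×ˢ (Finset.range R₁ ×ˢ Finset.range R₂)).filter fun a : ℤ × ℕ × ℕ =>
      U a.1 a.2.1 ω ∈ J₁ ∧ U (a.1 + k) a.2.2 ω ∈ J₂).card : ℝ) =
      ∑ t ∈ F, count U R₁ J₁ t ω * count U R₂ J₂ (t + k) ω := by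
  rw [Finset.card_filter, Nat.cast_sum, Finset.sum_product]
  refine Finset.sum_congr rfl fun t _ => ?_
  rw [← sum_count_mul]
  refine Finset.sum_congr rfl fun q _ => ?_
  by_cases h1 : U t q.1 ω ∈ J₁ <;> by_cases h2 : U (t + k) q.2 ω ∈ J₂ <;> simp [h1, h2]

/-- The weights of the local linear surface criterion. -/
def surfaceWeight (K : ℝ → ℝ) (h : ℝ) (k : ℕ) (q : I × I) (d : (ℤ → ℕ → I) × (ℤ → ℕ))
    (a : ℤ × ℕ × ℕ) : ℝ :=
  (if a.2.1 < d.2 a.1 then 1 else 0) * ((if a.2.2 < d.2 (a.1 + k) then 1 else 0) *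
    (K (((d.1 a.1 a.2.1 : ℝ) - q.1) / h) * K (((d.1 (a.1 + k) a.2.2 : ℝ) - q.2) / h)))

/-- The scaled regressors of the local linear surface criterion. -/
def surfaceFeature (h : ℝ) (k : ℕ) (q : I × I) (d : (ℤ → ℕ → I) × (ℤ → ℕ))
    (a : ℤ × ℕ × ℕ) : Fin 3 → ℝ :=
  ![1, ((d.1 a.1 a.2.1 : ℝ) - q.1) / h, ((d.1 (a.1 + k) a.2.2 : ℝ) - q.2) / h]

/-- The weights of the one-dimensional local linear criterion. -/
def lineWeight (K : ℝ → ℝ) (h : ℝ) (k : ℕ) (u : I) (d : (ℤ → ℕ → I) × (ℤ → ℕ))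
    (a : ℤ × ℕ × ℕ) : ℝ :=
  (if a.2.2 < d.2 (a.1 + k) then 1 else 0) * K (((d.1 (a.1 + k) a.2.2 : ℝ) - u) / h)

/-- The scaled regressors of the one-dimensional local linear criterion. -/
def lineFeature (h : ℝ) (k : ℕ) (u : I) (d : (ℤ → ℕ → I) × (ℤ → ℕ)) (a : ℤ × ℕ × ℕ) :
    Fin 2 → ℝ :=
  ![1, ((d.1 (a.1 + k) a.2.2 : ℝ) - u) / h]

lemma IsSmoothingKernel.continuous (hK : IsSmoothingKernel K) : Continuous K := by
  obtain ⟨c, hc⟩ := hK.lipschitz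
  exact hc.continuous

lemma IsSmoothingKernel.abs_le_indicator (hK : IsSmoothingKernel K) {B : ℝ} (hB : ∀ x, K x ≤ B)
    {h : ℝ} (hh : 0 < h) (u x : I) :
    K (((x : ℝ) - u) / h) ≤ B * (window u h).indicator (fun _ => (1 : ℝ)) x := by
  by_cases hx : x ∈ window u h
  · simpa [hx] using hB _
  · rw [indicator_of_notMem hx, mul_zero, hK.support]
    rw [abs_div, abs_of_pos hh, one_lt_div hh]
    exact not_le.1 hx

lemma surfaceWeight_nonneg (hK : IsSmoothingKernel K) (h : ℝ) (k : ℕ) (q : I × I)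
    (d : (ℤ → ℕ → I) × (ℤ → ℕ)) (a : ℤ × ℕ × ℕ) : 0 ≤ surfaceWeight K h k q d a := by
  unfold surfaceWeight
  have h1 := hK.nonneg (((d.1 a.1 a.2.1 : ℝ) - q.1) / h)
  have h2 := hK.nonneg (((d.1 (a.1 + k) a.2.2 : ℝ) - q.2) / h)
  split_ifs <;> simp [mul_nonneg h1 h2]

lemma surfaceWeight_le (hK : IsSmoothingKernel K) {B : ℝ} (hB : ∀ x, K x ≤ B) {h : ℝ} (hh : 0 < h)
    (k : ℕ) (q : I × I) (d : (ℤ → ℕ → I) × (ℤ → ℕ)) (a : ℤ × ℕ × ℕ) :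
    |surfaceWeight K h k q d a| ≤ B ^ 2 * ((window q.1 h).indicator (fun _ => (1 : ℝ))
      (d.1 a.1 a.2.1) * (window q.2 h).indicator (fun _ => (1 : ℝ)) (d.1 (a.1 + k) a.2.2)) := by
  rw [abs_of_nonneg (surfaceWeight_nonneg hK h k q d a)]
  have h1 := hK.nonneg (((d.1 a.1 a.2.1 : ℝ) - q.1) / h)
  have h2 := hK.nonneg (((d.1 (a.1 + k) a.2.2 : ℝ) - q.2) / h)
  have h3 := hK.abs_le_indicator hB hh q.1 (d.1 a.1 a.2.1)
  have h4 := hK.abs_le_indicator hB hh q.2 (d.1 (a.1 + k) a.2.2)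
  have h5 := mul_le_mul h3 h4 h2 (h1.trans h3)
  have h6 : surfaceWeight K h k q d a ≤ K (((d.1 a.1 a.2.1 : ℝ) - q.1) / h) *
      K (((d.1 (a.1 + k) a.2.2 : ℝ) - q.2) / h) := by
    unfold surfaceWeight
    have := mul_nonneg h1 h2
    split_ifs <;> simp [this]
  refine h6.trans (h5.trans (le_of_eq ?_))
  ring

lemma surfaceWeight_support (hK : IsSmoothingKernel K) {h : ℝ} (hh : 0 < h) {k : ℕ} {q : I × I}
    {d : (ℤ → ℕ → I) × (ℤ → ℕ)} {a : ℤ × ℕ × ℕ} (ha : surfaceWeight K h k q d a ≠ 0) :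
    |(d.1 a.1 a.2.1 : ℝ) - q.1| ≤ h ∧ |(d.1 (a.1 + k) a.2.2 : ℝ) - q.2| ≤ h := by
  have key : ∀ x : ℝ, K (x / h) ≠ 0 → |x| ≤ h := fun x hx => by
    by_contra hcon
    exact hx (hK.support _ (by rw [abs_div, abs_of_pos hh, one_lt_div hh]; exact not_le.1 hcon))
  unfold surfaceWeight at ha
  have h1 := right_ne_zero_of_mul (right_ne_zero_of_mul ha)
  exact ⟨key _ (left_ne_zero_of_mul h1), key _ (right_ne_zero_of_mul h1)⟩

lemma lineWeight_nonneg (hK : IsSmoothingKernel K) (h : ℝ) (k : ℕ) (u : I)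
    (d : (ℤ → ℕ → I) × (ℤ → ℕ)) (a : ℤ × ℕ × ℕ) : 0 ≤ lineWeight K h k u d a := by
  unfold lineWeight
  have h2 := hK.nonneg (((d.1 (a.1 + k) a.2.2 : ℝ) - u) / h)
  split_ifs <;> simp [h2]

lemma lineWeight_le (hK : IsSmoothingKernel K) {B : ℝ} (hB : ∀ x, K x ≤ B) {h : ℝ} (hh : 0 < h)
    (k : ℕ) (u : I) (d : (ℤ → ℕ → I) × (ℤ → ℕ)) (a : ℤ × ℕ × ℕ) :
    |lineWeight K h k u d a| ≤ B * ((univ : Set I).indicator (fun _ => (1 : ℝ))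
      (d.1 a.1 a.2.1) * (window u h).indicator (fun _ => (1 : ℝ)) (d.1 (a.1 + k) a.2.2)) := by
  rw [abs_of_nonneg (lineWeight_nonneg hK h k u d a), indicator_univ, one_mul]
  refine le_trans ?_ (hK.abs_le_indicator hB hh u (d.1 (a.1 + k) a.2.2))
  unfold lineWeight
  have h2 := hK.nonneg (((d.1 (a.1 + k) a.2.2 : ℝ) - u) / h)
  split_ifs <;> simp [h2]

lemma lineWeight_support (hK : IsSmoothingKernel K) {h : ℝ} (hh : 0 < h) {k : ℕ} {u : I}
    {d : (ℤ → ℕ → I) × (ℤ → ℕ)} {a : ℤ × ℕ × ℕ} (ha : lineWeight K h k u d a ≠ 0) :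
    |(d.1 (a.1 + k) a.2.2 : ℝ) - u| ≤ h := by
  by_contra hcon
  unfold lineWeight at ha
  exact right_ne_zero_of_mul ha
    (hK.support _ (by rw [abs_div, abs_of_pos hh, one_lt_div hh]; exact not_le.1 hcon))

lemma abs_weight_mul_le {w x : ℝ} (h : w ≠ 0 → |x| ≤ 1) : |w * x| ≤ |w| := by
  by_cases hw : w = 0
  · simp [hw]
  · rw [abs_mul]
    exact mul_le_of_le_one_right (abs_nonneg _) (h hw)

lemma surfaceWeight_mul_feature_le (hK : IsSmoothingKernel K) {h : ℝ} (hh : 0 < h) (k : ℕ)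
    (q : I × I) (d : (ℤ → ℕ → I) × (ℤ → ℕ)) (a : ℤ × ℕ × ℕ) (i : Fin 3) :
    |surfaceWeight K h k q d a * surfaceFeature h k q d a i| ≤ |surfaceWeight K h k q d a| := by
  refine abs_weight_mul_le fun hw => ?_
  obtain ⟨h1, h2⟩ := surfaceWeight_support hK hh hw
  fin_cases i
  · simp [surfaceFeature]
  · simpa [surfaceFeature, abs_div, abs_of_pos hh, div_le_one hh] using h1
  · simpa [surfaceFeature, abs_div, abs_of_pos hh, div_le_one hh] using h2

lemma lineWeight_mul_feature_le (hK : IsSmoothingKernel K) {h : ℝ} (hh : 0 < h) (k : ℕ)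
    (u : I) (d : (ℤ → ℕ → I) × (ℤ → ℕ)) (a : ℤ × ℕ × ℕ) (i : Fin 2) :
    |lineWeight K h k u d a * lineFeature h k u d a i| ≤ |lineWeight K h k u d a| := by
  refine abs_weight_mul_le fun hw => ?_
  have h1 := lineWeight_support hK hh hw
  fin_cases i
  · simp [lineFeature]
  · simpa [lineFeature, abs_div, abs_of_pos hh, div_le_one hh] using h1

lemma measurable_surfaceWeight (hK : IsSmoothingKernel K) (h : ℝ) (k : ℕ) (a : ℤ × ℕ × ℕ) :
    Measurable fun p : (I × I) × ((ℤ → ℕ → I) × (ℤ → ℕ)) => surfaceWeight K h k p.1 p.2 a := by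
  have hKm := hK.continuous.measurable
  unfold surfaceWeight
  refine (Measurable.ite (measurableSet_lt measurable_const (by fun_prop)) measurable_const
    measurable_const).mul ((Measurable.ite (measurableSet_lt measurable_const (by fun_prop))
    measurable_const measurable_const).mul ((hKm.comp ?_).mul (hKm.comp ?_)))
  · exact ((measurable_subtype_coe.comp (by fun_prop : Measurable
      fun p : (I × I) × ((ℤ → ℕ → I) × (ℤ → ℕ)) => p.2.1 a.1 a.2.1)).sub
      (measurable_subtype_coe.comp (by fun_prop))).div_const h
  · exact ((measurable_subtype_coe.comp (by fun_prop : Measurable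
      fun p : (I × I) × ((ℤ → ℕ → I) × (ℤ → ℕ)) => p.2.1 (a.1 + k) a.2.2)).sub
      (measurable_subtype_coe.comp (by fun_prop))).div_const h

lemma measurable_surfaceFeature (h : ℝ) (k : ℕ) (a : ℤ × ℕ × ℕ) (i : Fin 3) :
    Measurable fun p : (I × I) × ((ℤ → ℕ → I) × (ℤ → ℕ)) => surfaceFeature h k p.1 p.2 a i := by
  unfold surfaceFeature
  fin_cases i
  · exact measurable_const
  · exact ((measurable_subtype_coe.comp (by fun_prop : Measurable
      fun p : (I × I) × ((ℤ → ℕ → I) × (ℤ → ℕ)) => p.2.1 a.1 a.2.1)).sub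
      (measurable_subtype_coe.comp (by fun_prop))).div_const h
  · exact ((measurable_subtype_coe.comp (by fun_prop : Measurable
      fun p : (I × I) × ((ℤ → ℕ → I) × (ℤ → ℕ)) => p.2.1 (a.1 + k) a.2.2)).sub
      (measurable_subtype_coe.comp (by fun_prop))).div_const h

lemma measurable_lineWeight (hK : IsSmoothingKernel K) (h : ℝ) (k : ℕ) (a : ℤ × ℕ × ℕ) :
    Measurable fun p : I × ((ℤ → ℕ → I) × (ℤ → ℕ)) => lineWeight K h k p.1 p.2 a := by
  have hKm := hK.continuous.measurable
  unfold lineWeight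
  refine (Measurable.ite (measurableSet_lt measurable_const (by fun_prop)) measurable_const
    measurable_const).mul (hKm.comp ?_)
  exact ((measurable_subtype_coe.comp (by fun_prop : Measurable
      fun p : I × ((ℤ → ℕ → I) × (ℤ → ℕ)) => p.2.1 (a.1 + k) a.2.2)).sub
      (measurable_subtype_coe.comp (by fun_prop))).div_const h

lemma measurable_lineFeature (h : ℝ) (k : ℕ) (a : ℤ × ℕ × ℕ) (i : Fin 2) :
    Measurable fun p : I × ((ℤ → ℕ → I) × (ℤ → ℕ)) => lineFeature h k p.1 p.2 a i := by
  unfold lineFeature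
  fin_cases i
  · exact measurable_const
  · exact ((measurable_subtype_coe.comp (by fun_prop : Measurable
      fun p : I × ((ℤ → ℕ → I) × (ℤ → ℕ)) => p.2.1 (a.1 + k) a.2.2)).sub
      (measurable_subtype_coe.comp (by fun_prop))).div_const h

/-- Slopes are measured in units of `1 / h`, which makes the regressors bounded by one wherever the
weight is nonzero and the design form balanced across coordinates. -/
lemma surfaceLoss_eq (h : ℝ) (L k n R : ℕ) (d : (ℤ → ℕ → I) × (ℤ → ℕ))
    (hR : ∀ t, d.2 t ≤ R) (Z : ℤ → ℕ → ℝ) (u v : I) (b : Fin 3 → ℝ) :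
    surfaceLoss K h L k n d.2 d.1 Z u v (b 0) (b 1 / h) (b 2 / h) =
      ∑ a ∈ Finset.Icc (1 : ℤ) ((n : ℤ) - L) ×ˢ (Finset.range R ×ˢ Finset.range R),
        surfaceWeight K h k (u, v) d a *
          (Z a.1 a.2.1 * Z (a.1 + k) a.2.2 - ∑ i, b i * surfaceFeature h k (u, v) d a i) ^ 2 := by
  unfold surfaceLoss
  rw [Finset.sum_product]
  refine Finset.sum_congr rfl fun t _ => ?_
  rw [Finset.sum_product, sum_range_ite (hR t)]
  refine Finset.sum_congr rfl fun i _ => ?_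
  rw [sum_range_ite (hR (t + k)), Finset.mul_sum]
  refine Finset.sum_congr rfl fun j _ => ?_
  simp only [surfaceWeight, surfaceFeature, Fin.sum_univ_three, Matrix.cons_val_zero,
    Matrix.cons_val_one, Matrix.cons_val]
  ring

/-- The middle index runs over the single value `0`; it is a dummy that lets the one-dimensional
problem share the index type of triples. -/
lemma lineLoss_eq (h : ℝ) (L k n R : ℕ) (d : (ℤ → ℕ → I) × (ℤ → ℕ))
    (hR : ∀ t, d.2 t ≤ R) (Z : ℤ → ℕ → ℝ) (y : ℤ → ℝ) (u : I) (b : Fin 2 → ℝ) :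
    lineLoss K h L k n d.2 d.1 Z y u (b 0) (b 1 / h) =
      ∑ a ∈ Finset.Icc (1 : ℤ) ((n : ℤ) - L) ×ˢ (Finset.range 1 ×ˢ Finset.range R),
        lineWeight K h k u d a *
          (y a.1 * Z (a.1 + k) a.2.2 - ∑ i, b i * lineFeature h k u d a i) ^ 2 := by
  unfold lineLoss
  rw [Finset.sum_product]
  refine Finset.sum_congr rfl fun t _ => ?_
  rw [Finset.sum_product, Finset.sum_range_one, sum_range_ite (hR (t + k))]
  refine Finset.sum_congr rfl fun j _ => ?_
  simp only [lineWeight, lineFeature, Fin.sum_univ_two, Matrix.cons_val_zero,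
    Matrix.cons_val_one]
  ring

end Fits

/-! ### Squared error of a fit on a sample with well filled cells. -/

section FitErrors

variable {Ω : Type*} [MeasurableSpace Ω] {U : ℤ → ℕ → Ω → I} {K : ℝ → ℝ}

lemma IsC2Square.exists_taylor {g : I → I → ℝ} (hg : IsC2Square g) :
    ∃ M : ℝ, 0 ≤ M ∧ ∀ u v : I, ∃ b₁ b₂ : ℝ, ∀ x y : I, ∀ h : ℝ, |(x : ℝ) - u| ≤ h →
      |(y : ℝ) - v| ≤ h →
      |g x y - g u v - (b₁ * (x - u) + b₂ * (y - v))| ≤ M * h ^ 2 := by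
  obtain ⟨M, hM, H⟩ := exists_taylor_bound (s := Icc (0 : ℝ) 1 ×ˢ Icc (0 : ℝ) 1)
    ((convex_Icc 0 1).prod (convex_Icc 0 1)) (isCompact_Icc.prod isCompact_Icc)
    ((uniqueDiffOn_Icc zero_lt_one).prod (uniqueDiffOn_Icc zero_lt_one)) hg
  refine ⟨M, hM, fun u v => ?_⟩
  obtain ⟨l, hl⟩ := H ((u : ℝ), (v : ℝ)) ⟨u.2, v.2⟩
  refine ⟨l (1, 0), l (0, 1), fun x y h hx hy => ?_⟩
  have h1 := hl ((x : ℝ), (y : ℝ)) ⟨x.2, y.2⟩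
  have e : l (((x : ℝ), (y : ℝ)) - ((u : ℝ), (v : ℝ))) =
      l (1, 0) * (x - u) + l (0, 1) * (y - v) := by
    have : (((x : ℝ), (y : ℝ)) - ((u : ℝ), (v : ℝ)) : ℝ × ℝ) =
        ((x : ℝ) - u) • ((1 : ℝ), (0 : ℝ)) + ((y : ℝ) - v) • ((0 : ℝ), (1 : ℝ)) := by
      ext <;> simp
    rw [this, map_add, map_smul, map_smul, smul_eq_mul, smul_eq_mul]
    ring
  rw [e] at h1
  simp only [projIcc_val] at h1
  refine h1.trans ?_
  have h2 : ‖(((x : ℝ), (y : ℝ)) - ((u : ℝ), (v : ℝ)) : ℝ × ℝ)‖ ≤ h := by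
    rw [Prod.norm_def]
    exact max_le hx hy
  gcongr

lemma IsC2.exists_taylor {g : I → ℝ} (hg : IsC2 g) :
    ∃ M : ℝ, 0 ≤ M ∧ ∀ u : I, ∃ b₁ : ℝ, ∀ x : I, ∀ h : ℝ, |(x : ℝ) - u| ≤ h →
      |g x - g u - b₁ * (x - u)| ≤ M * h ^ 2 := by
  obtain ⟨M, hM, H⟩ := exists_taylor_bound (s := Icc (0 : ℝ) 1)
    (convex_Icc 0 1) isCompact_Icc (uniqueDiffOn_Icc zero_lt_one) hg
  refine ⟨M, hM, fun u => ?_⟩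
  obtain ⟨l, hl⟩ := H (u : ℝ) u.2
  refine ⟨l 1, fun x h hx => ?_⟩
  have h1 := hl (x : ℝ) x.2
  have e : l ((x : ℝ) - u) = l 1 * (x - u) := by
    have : (x : ℝ) - u = ((x : ℝ) - u) • (1 : ℝ) := by simp
    rw [this, map_smul, smul_eq_mul]
    simp [mul_comm]
  rw [e] at h1
  simp only [projIcc_val] at h1
  refine h1.trans ?_
  rw [Real.norm_eq_abs]
  gcongr

/-- `K` is bounded below by `κ` on an interval of length `6 δ` in `[0, 1]` and on its mirror
image. -/
def KernelBoundedBelow (K : ℝ → ℝ) (α δ κ : ℝ) : Prop :=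
  ∀ x, α ≤ x → x ≤ α + 6 * δ → κ ≤ K x ∧ κ ≤ K (-x)

/-- For one fixed sample, the fit is compared with the first-order Taylor polynomial. Products of
the separated cells for `u` and for `v` supply the L-shaped design, and the kernel's support
restricts the remainders to points within `h`. -/
lemma surface_error_le (hK : IsSmoothingKernel K) {α δ κ : ℝ} (hα : 0 ≤ α) (hδ : 0 < δ)
    (hα1 : α + 6 * δ ≤ 1) (hκ : 0 < κ) (hKκ : KernelBoundedBelow K α δ κ) {h : ℝ} (hh : 0 < h)
    (hh2 : h ≤ 1 / 2) {g : I → I → ℝ} {M : ℝ} {u v : I} {b₁ b₂ : ℝ}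
    (hg : ∀ x y : I, |(x : ℝ) - u| ≤ h → |(y : ℝ) - v| ≤ h →
      |g x y - g u v - (b₁ * (x - u) + b₂ * (y - v))| ≤ M * h ^ 2)
    {L k n r R : ℕ} {ω : Ω} {m : ℤ → ℕ} (hr : ∀ t, r ≤ m t) (hR : ∀ t, m t ≤ R) {x : ℝ} (hx : 0 < x)
    (hcell : ∀ j₁ < ⌊1 / (δ * h)⌋₊, ∀ j₂ < ⌊1 / (δ * h)⌋₊,
      x < ∑ t ∈ Finset.Icc (1 : ℤ) ((n : ℤ) - L),
        count U r (cell (δ * h) j₁) t ω * count U r (cell (δ * h) j₂) (t + k) ω)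
    {Z : ℤ → ℕ → ℝ} {c : ℝ} (hfit : IsSurfaceFit K h L k n m (fun t i => U t i ω) Z u v c) :
    (c - g u v) ^ 2 ≤
      16 / (κ ^ 2 / (9 * (1 + 4 / δ) ^ 2) * x) ^ 2 *
        ∑ i, (∑ a ∈ Finset.Icc (1 : ℤ) ((n : ℤ) - L) ×ˢ (Finset.range R ×ˢ Finset.range R),
          surfaceWeight K h k (u, v) ((fun t i => U t i ω), m) a *
            surfaceFeature h k (u, v) ((fun t i => U t i ω), m) a i *
              (Z a.1 a.2.1 * Z (a.1 + k) a.2.2 - g (U a.1 a.2.1 ω) (U (a.1 + k) a.2.2 ω))) ^ 2 +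
      8 / (κ ^ 2 / (9 * (1 + 4 / δ) ^ 2) * x) * (M * h ^ 2) ^ 2 *
        ∑ a ∈ Finset.Icc (1 : ℤ) ((n : ℤ) - L) ×ˢ (Finset.range R ×ˢ Finset.range R),
          surfaceWeight K h k (u, v) ((fun t i => U t i ω), m) a := by
  classical
  set d : (ℤ → ℕ → I) × (ℤ → ℕ) := ((fun t i => U t i ω), m) with hd
  set A := Finset.Icc (1 : ℤ) ((n : ℤ) - L) ×ˢ (Finset.range R ×ˢ Finset.range R) with hA
  set w := surfaceWeight K h k (u, v) d with hw
  set X := surfaceFeature h k (u, v) d with hX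
  have w0 : ∀ a, 0 ≤ w a := surfaceWeight_nonneg hK h k (u, v) d
  obtain ⟨a₁, a₂, hmin⟩ := hfit
  set b : Fin 3 → ℝ := ![c, h * a₁, h * a₂] with hb
  set β : Fin 3 → ℝ := ![g u v, h * b₁, h * b₂] with hβ
  set rem : ℤ × ℕ × ℕ → ℝ := fun a => g (U a.1 a.2.1 ω) (U (a.1 + k) a.2.2 ω) -
    ∑ i, β i * X a i with hrem
  have hβX : ∀ a, ∑ i, β i * X a i = g u v + (b₁ * ((U a.1 a.2.1 ω : ℝ) - u) +
      b₂ * ((U (a.1 + k) a.2.2 ω : ℝ) - v)) := by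
    intro a
    simp only [hX, hβ, surfaceFeature, hd, Fin.sum_univ_three, Matrix.cons_val_zero,
      Matrix.cons_val_one, Matrix.cons_val]
    field_simp
    ring
  obtain ⟨j₁, hj₁, j₂, hj₂, J1, J2, J12⟩ := exists_cells hα hδ hα1 hKκ hh hh2 u
  obtain ⟨l₁, hl₁, l₂, hl₂, L1, L2, L12⟩ := exists_cells hα hδ hα1 hKκ hh hh2 v
  -- Only the first `r` locations of each curve are used for the lower bound: they are all present
  -- since `r ≤ m t`, and their law does not involve the random counts.
  set S : ℕ → ℕ → Finset (ℤ × ℕ × ℕ) := fun j l =>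
    (Finset.Icc (1 : ℤ) ((n : ℤ) - L) ×ˢ (Finset.range r ×ˢ Finset.range r)).filter fun a =>
      U a.1 a.2.1 ω ∈ cell (δ * h) j ∧ U (a.1 + k) a.2.2 ω ∈ cell (δ * h) l with hS
  have hSA : ∀ j l, S j l ⊆ A := fun j l => (Finset.filter_subset _ _).trans
    (Finset.product_subset_product_right (Finset.product_subset_product
      (Finset.range_mono ((hr 0).trans (hR 0))) (Finset.range_mono ((hr 0).trans (hR 0)))))
  have hScard : ∀ j < ⌊1 / (δ * h)⌋₊, ∀ l < ⌊1 / (δ * h)⌋₊, x ≤ (S j l).card := by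
    intro j hj l hl
    rw [hS, card_filter_locations]
    exact (hcell j hj l hl).le
  have hmem : ∀ {j l a}, a ∈ S j l → U a.1 a.2.1 ω ∈ cell (δ * h) j ∧
      U (a.1 + k) a.2.2 ω ∈ cell (δ * h) l ∧ a.2.1 < m a.1 ∧ a.2.2 < m (a.1 + k) := by
    intro j l a ha
    simp only [hS, Finset.mem_filter, Finset.mem_product, Finset.mem_range] at ha
    exact ⟨ha.2.1, ha.2.2, ha.1.2.1.trans_le (hr _), ha.1.2.2.trans_le (hr _)⟩
  have hSw : ∀ {j l},
      (∀ x ∈ cell (δ * h) j, κ ≤ K ((x - u) / h) ∧ |((x : ℝ) - u) / h| ≤ 1) →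
      (∀ x ∈ cell (δ * h) l, κ ≤ K ((x - v) / h) ∧ |((x : ℝ) - v) / h| ≤ 1) →
      ∀ a ∈ S j l, κ ^ 2 ≤ w a := by
    intro j l hj hl a ha
    obtain ⟨m1, m2, m3, m4⟩ := hmem ha
    simp only [hw, surfaceWeight, hd, if_pos m3, if_pos m4, one_mul]
    rw [sq]
    exact mul_le_mul (hj _ m1).1 (hl _ m2).1 hκ.le (hκ.le.trans (hj _ m1).1)
  have hsmall : ∀ {j : ℕ} {p q : I} (o : I), p ∈ cell (δ * h) j → q ∈ cell (δ * h) j →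
      |((q : ℝ) - o) / h - (p - o) / h| ≤ δ := by
    intro j p q o hp hq
    rw [← sub_div, abs_div, abs_of_pos hh, div_le_iff₀ hh]
    have := cell_diff hp hq
    rwa [sub_sub_sub_cancel_right]
  have hdes : ∀ γ : Fin 3 → ℝ, κ ^ 2 / (9 * (1 + 4 / δ) ^ 2) * x * ∑ i, γ i ^ 2 ≤
      ∑ a ∈ A, w a * (∑ i, γ i * X a i) ^ 2 := by
    intro γ
    have := surface_design_bound (hSA j₁ l₁) (hSA j₂ l₁) (hSA j₁ l₂) (w := w)
      (x := fun a => ((U a.1 a.2.1 ω : ℝ) - u) / h)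
      (y := fun a => ((U (a.1 + k) a.2.2 ω : ℝ) - v) / h) (fun a _ => w0 a) hx (sq_nonneg κ) hδ
      (hScard _ hj₁ _ hl₁) (hScard _ hj₂ _ hl₁) (hScard _ hj₁ _ hl₂)
      (hSw J1 L1) (hSw J2 L1) (hSw J1 L2) (fun a ha => (J1 _ (hmem ha).1).2)
      (fun a ha => (L1 _ (hmem ha).2.1).2)
      (fun a ha a' ha' => ⟨J12 _ (hmem ha).1 _ (hmem ha').1,
        hsmall v (hmem ha).2.1 (hmem ha').2.1⟩)
      (fun a ha a' ha' => ⟨hsmall u (hmem ha).1 (hmem ha').1,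
        L12 _ (hmem ha).2.1 _ (hmem ha').2.1⟩) (γ 0) (γ 1) (γ 2)
    calc _ = x * κ ^ 2 / (9 * (1 + 4 / δ) ^ 2) * (γ 0 ^ 2 + γ 1 ^ 2 + γ 2 ^ 2) := by
          rw [Fin.sum_univ_three]; ring
      _ ≤ _ := this
      _ = _ := by
          refine Finset.sum_congr rfl fun a _ => ?_
          simp only [hX, surfaceFeature, hd, Fin.sum_univ_three, Matrix.cons_val_zero,
            Matrix.cons_val_one, Matrix.cons_val, mul_one]
  have hLS := leastSquares_error A w X (fun a => Z a.1 a.2.1 * Z (a.1 + k) a.2.2)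
    (fun a => Z a.1 a.2.1 * Z (a.1 + k) a.2.2 - g (U a.1 a.2.1 ω) (U (a.1 + k) a.2.2 ω)) rem b β
    (c := κ ^ 2 / (9 * (1 + 4 / δ) ^ 2) * x) (by positivity) (fun a _ => w0 a)
    (hdes fun i => b i - β i)
    (by
      have := hmin (β 0) (β 1 / h) (β 2 / h)
      have e : surfaceLoss K h L k n m (fun t i => U t i ω) Z u v c a₁ a₂ =
          surfaceLoss K h L k n d.2 d.1 Z u v (b 0) (b 1 / h) (b 2 / h) := by
        simp only [hb, hd, Matrix.cons_val_zero, Matrix.cons_val_one, Matrix.cons_val]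
        rw [mul_div_cancel_left₀ _ hh.ne', mul_div_cancel_left₀ _ hh.ne']
      rw [e, surfaceLoss_eq h L k n R d hR] at this
      refine this.trans (le_of_eq ?_)
      exact surfaceLoss_eq h L k n R d hR Z u v β)
    (fun a _ => by simp only [hrem]; ring)
  have h0 : (c - g u v) ^ 2 ≤ ∑ i, (b i - β i) ^ 2 := by
    rw [Fin.sum_univ_three]
    simp only [hb, hβ, Matrix.cons_val_zero]
    nlinarith [sq_nonneg (b 1 - β 1), sq_nonneg (b 2 - β 2)]
  refine h0.trans (hLS.trans (add_le_add le_rfl ?_))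
  rw [mul_assoc]
  refine mul_le_mul_of_nonneg_left ?_ (by positivity)
  rw [Finset.mul_sum]
  refine Finset.sum_le_sum fun a _ => ?_
  rw [mul_comm]
  by_cases hwa : w a = 0
  · simp [hwa]
  · refine mul_le_mul_of_nonneg_right ?_ (w0 a)
    obtain ⟨s1, s2⟩ := surfaceWeight_support hK hh hwa
    have := hg _ _ s1 s2
    rw [← sq_abs (rem a)]
    refine pow_le_pow_left₀ (abs_nonneg _) ?_ 2
    rw [hrem]
    simp only [hβX]
    rw [← sub_sub]
    exact this

/-- Two cells suffice here. The constraint that the first location lies in `univ` is vacuous and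
only matches the format of pairs. -/
lemma line_error_le (hK : IsSmoothingKernel K) {α δ κ : ℝ} (hα : 0 ≤ α) (hδ : 0 < δ)
    (hα1 : α + 6 * δ ≤ 1) (hκ : 0 < κ) (hKκ : KernelBoundedBelow K α δ κ) {h : ℝ} (hh : 0 < h)
    (hh2 : h ≤ 1 / 2) {g : I → ℝ} {M : ℝ} {u : I} {b₁ : ℝ}
    (hg : ∀ x : I, |(x : ℝ) - u| ≤ h → |g x - g u - b₁ * (x - u)| ≤ M * h ^ 2)
    {L k n r R : ℕ} {ω : Ω} {m : ℤ → ℕ} (hr : ∀ t, r ≤ m t) (hR : ∀ t, m t ≤ R) {x : ℝ} (hx : 0 < x)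
    (hcell : ∀ j < ⌊1 / (δ * h)⌋₊, x < ∑ t ∈ Finset.Icc (1 : ℤ) ((n : ℤ) - L),
      count U r (cell (δ * h) j) (t + k) ω)
    {Z : ℤ → ℕ → ℝ} {y : ℤ → ℝ} {c : ℝ}
    (hfit : IsLineFit K h L k n m (fun t i => U t i ω) Z y u c) :
    (c - g u) ^ 2 ≤
      16 / (κ / (9 * (1 + 4 / δ) ^ 2) * x) ^ 2 *
        ∑ i, (∑ a ∈ Finset.Icc (1 : ℤ) ((n : ℤ) - L) ×ˢ (Finset.range 1 ×ˢ Finset.range R),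
          lineWeight K h k u ((fun t i => U t i ω), m) a *
            lineFeature h k u ((fun t i => U t i ω), m) a i *
              (y a.1 * Z (a.1 + k) a.2.2 - g (U (a.1 + k) a.2.2 ω))) ^ 2 +
      8 / (κ / (9 * (1 + 4 / δ) ^ 2) * x) * (M * h ^ 2) ^ 2 *
        ∑ a ∈ Finset.Icc (1 : ℤ) ((n : ℤ) - L) ×ˢ (Finset.range 1 ×ˢ Finset.range R),
          lineWeight K h k u ((fun t i => U t i ω), m) a := by
  classical
  set d : (ℤ → ℕ → I) × (ℤ → ℕ) := ((fun t i => U t i ω), m) with hd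
  set A := Finset.Icc (1 : ℤ) ((n : ℤ) - L) ×ˢ (Finset.range 1 ×ˢ Finset.range R) with hA
  set w := lineWeight K h k u d with hw
  set X := lineFeature h k u d with hX
  have w0 : ∀ a, 0 ≤ w a := lineWeight_nonneg hK h k u d
  obtain ⟨a₁, hmin⟩ := hfit
  set b : Fin 2 → ℝ := ![c, h * a₁] with hb
  set β : Fin 2 → ℝ := ![g u, h * b₁] with hβ
  set rem : ℤ × ℕ × ℕ → ℝ := fun a => g (U (a.1 + k) a.2.2 ω) - ∑ i, β i * X a i with hrem
  have hβX : ∀ a, ∑ i, β i * X a i = g u + b₁ * ((U (a.1 + k) a.2.2 ω : ℝ) - u) := by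
    intro a
    simp only [hX, hβ, lineFeature, hd, Fin.sum_univ_two, Matrix.cons_val_zero,
      Matrix.cons_val_one]
    field_simp
  obtain ⟨j₁, hj₁, j₂, hj₂, J1, J2, J12⟩ := exists_cells hα hδ hα1 hKκ hh hh2 u
  set S : ℕ → Finset (ℤ × ℕ × ℕ) := fun j =>
    (Finset.Icc (1 : ℤ) ((n : ℤ) - L) ×ˢ (Finset.range 1 ×ˢ Finset.range r)).filter fun a =>
      U a.1 a.2.1 ω ∈ (univ : Set I) ∧ U (a.1 + k) a.2.2 ω ∈ cell (δ * h) j with hS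
  have hSA : ∀ j, S j ⊆ A := fun j => (Finset.filter_subset _ _).trans
    (Finset.product_subset_product_right (Finset.product_subset_product_right
      (Finset.range_mono ((hr 0).trans (hR 0)))))
  have hScard : ∀ j < ⌊1 / (δ * h)⌋₊, x ≤ (S j).card := by
    intro j hj
    rw [hS, card_filter_locations]
    refine (hcell j hj).le.trans (le_of_eq (Finset.sum_congr rfl fun t _ => ?_))
    simp [count]
  have hmem : ∀ {j a}, a ∈ S j → U (a.1 + k) a.2.2 ω ∈ cell (δ * h) j ∧ a.2.2 < m (a.1 + k) := by
    intro j a ha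
    simp only [hS, Finset.mem_filter, Finset.mem_product, Finset.mem_range] at ha
    exact ⟨ha.2.2, ha.1.2.2.trans_le (hr _)⟩
  have hSw : ∀ {j},
      (∀ x ∈ cell (δ * h) j, κ ≤ K ((x - u) / h) ∧ |((x : ℝ) - u) / h| ≤ 1) →
      ∀ a ∈ S j, κ ≤ w a := by
    intro j hj a ha
    obtain ⟨m1, m2⟩ := hmem ha
    simp only [hw, lineWeight, hd, if_pos m2, one_mul]
    exact (hj _ m1).1
  have hdes : ∀ γ : Fin 2 → ℝ, κ / (9 * (1 + 4 / δ) ^ 2) * x * ∑ i, γ i ^ 2 ≤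
      ∑ a ∈ A, w a * (∑ i, γ i * X a i) ^ 2 := by
    intro γ
    have := line_design_bound (hSA j₁) (hSA j₂) (w := w)
      (x := fun a => ((U (a.1 + k) a.2.2 ω : ℝ) - u) / h) (fun a _ => w0 a) hx hκ.le hδ
      (hScard _ hj₁) (hScard _ hj₂) (hSw J1) (hSw J2) (fun a ha => (J1 _ (hmem ha).1).2)
      (fun a ha a' ha' => J12 _ (hmem ha).1 _ (hmem ha').1) (γ 0) (γ 1)
    calc _ = x * κ / (9 * (1 + 4 / δ) ^ 2) * (γ 0 ^ 2 + γ 1 ^ 2) := by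
          rw [Fin.sum_univ_two]; ring
      _ ≤ _ := this
      _ = _ := by
          refine Finset.sum_congr rfl fun a _ => ?_
          simp only [hX, lineFeature, hd, Fin.sum_univ_two, Matrix.cons_val_zero,
            Matrix.cons_val_one, mul_one]
  have hLS := leastSquares_error A w X (fun a => y a.1 * Z (a.1 + k) a.2.2)
    (fun a => y a.1 * Z (a.1 + k) a.2.2 - g (U (a.1 + k) a.2.2 ω)) rem b β
    (c := κ / (9 * (1 + 4 / δ) ^ 2) * x) (by positivity) (fun a _ => w0 a)
    (hdes fun i => b i - β i)
    (by
      have := hmin (β 0) (β 1 / h)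
      have e : lineLoss K h L k n m (fun t i => U t i ω) Z y u c a₁ =
          lineLoss K h L k n d.2 d.1 Z y u (b 0) (b 1 / h) := by
        simp only [hb, hd, Matrix.cons_val_zero, Matrix.cons_val_one]
        rw [mul_div_cancel_left₀ _ hh.ne']
      rw [e, lineLoss_eq h L k n R d hR] at this
      refine this.trans (le_of_eq ?_)
      exact lineLoss_eq h L k n R d hR Z y u β)
    (fun a _ => by simp only [hrem]; ring)
  have h0 : (c - g u) ^ 2 ≤ ∑ i, (b i - β i) ^ 2 := by
    rw [Fin.sum_univ_two]
    simp only [hb, hβ, Matrix.cons_val_zero]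
    nlinarith [sq_nonneg (b 1 - β 1)]
  refine h0.trans (hLS.trans (add_le_add le_rfl ?_))
  rw [mul_assoc]
  refine mul_le_mul_of_nonneg_left ?_ (by positivity)
  rw [Finset.mul_sum]
  refine Finset.sum_le_sum fun a _ => ?_
  rw [mul_comm]
  by_cases hwa : w a = 0
  · simp [hwa]
  · refine mul_le_mul_of_nonneg_right ?_ (w0 a)
    have := hg _ (lineWeight_support hK hh hwa)
    rw [← sq_abs (rem a)]
    refine pow_le_pow_left₀ (abs_nonneg _) ?_ 2
    rw [hrem]
    simp only [hβX]
    rw [← sub_sub]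
    exact this

end FitErrors

/-! ### The convergence rates -/

section Exponents

variable {s lam : ℝ}

/-- After clearing denominators this is the assumption on `lam` itself. It makes the denominators of
both exponents positive; as numerators and denominators differ by `4`, both exponents are below one.
-/
lemma sub_div_pos (hs : 2 < s) (hlam : (3 * s - 2) / (s - 2) < lam) :
    0 < lam - 3 - (1 + lam) / (s - 1) := by
  rw [div_lt_iff₀ (by linarith)] at hlam
  rw [sub_pos, div_lt_iff₀ (by linarith)]
  linarith

lemma three_lt_of_lt (hs : 2 < s) (hlam : (3 * s - 2) / (s - 2) < lam) : 3 < lam := by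
  refine lt_trans ?_ hlam
  rw [lt_div_iff₀ (by linarith)]
  linarith

lemma thetaC_lt_one (hs : 2 < s) (hlam : (3 * s - 2) / (s - 2) < lam) : thetaC s lam < 1 := by
  have := sub_div_pos hs hlam
  rw [thetaC, div_lt_one (by linarith)]
  linarith

lemma thetaS_lt_one (hs : 2 < s) (hlam : (3 * s - 2) / (s - 2) < lam) : thetaS s lam < 1 := by
  have := sub_div_pos hs hlam
  rw [thetaS, div_lt_one (by linarith)]
  linarith

end Exponents

/-! ### Assembly of the two rates. -/

section Main

variable {Ω : Type*} [MeasurableSpace Ω] {P : Measure Ω} [IsProbabilityMeasure P]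
  {W X e : ℤ → Ω → I → ℝ} {Y : ℤ → Ω → ℝ} {U : ℤ → ℕ → Ω → I} {η : ℤ → ℕ → Ω → ℝ}
  {m : ℕ → ℤ → Ω → ℕ} {ρ : ℕ → ℝ} {K : ℝ → ℝ} {s lam : ℝ} {L k : ℕ}

lemma MeasurableCurves.measurable_obs (hW : MeasurableCurves W) (mW : ∀ t, Measurable (W t))
    (mU : ∀ t i, Measurable (U t i)) (mη : ∀ t i, Measurable (η t i)) (t : ℤ) (i : ℕ) :
    Measurable fun ω => obs W U η ω t i := by
  obtain ⟨F, mF, hF⟩ := hW.exists_factor t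
  have : (fun ω => obs W U η ω t i) = fun ω => F (W t ω, U t i ω) + η t i ω :=
    funext fun ω => by rw [hF]; rfl
  rw [this]
  exact (mF.comp ((mW t).prodMk (mU t i))).add (mη t i)

lemma inv_add_le_rate {n x h : ℝ} (hn : 0 < n) (hx : 0 ≤ x) :
    1 / x + 1 / n + h ^ 4 ≤ (1 / √x + 1 / √n + h ^ 2) ^ 2 := by
  have := sq_add_sq_add_sq_le_sq_add (a := 1 / √x) (b := 1 / √n) (c := h ^ 2) (by positivity)
    (by positivity) (sq_nonneg h)
  rw [div_pow, div_pow, Real.sq_sqrt hx, Real.sq_sqrt hn.le] at this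
  calc 1 / x + 1 / n + h ^ 4 = 1 ^ 2 / x + 1 ^ 2 / n + (h ^ 2) ^ 2 := by ring
    _ ≤ _ := this
    _ = _ := by ring

lemma rateC_pos {ρ h : ℕ → ℝ} {n : ℕ} (hn : 0 < n) : 0 < rateC ρ h n := by
  have : (0 : ℝ) < n := by exact_mod_cast hn
  unfold rateC
  positivity

lemma rateS_pos {ρ h : ℕ → ℝ} {n : ℕ} (hn : 0 < n) : 0 < rateS ρ h n := by
  have : (0 : ℝ) < n := by exact_mod_cast hn
  unfold rateS
  positivity

lemma countSq_mono {x y : ℝ} (hx : 0 ≤ x) (hxy : x ≤ y) : countSq x ≤ countSq y := by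
  unfold countSq
  gcongr

lemma card_Icc_sub_le (n L : ℕ) : (Finset.Icc (1 : ℤ) ((n : ℤ) - L)).card ≤ n := by
  rw [Int.card_Icc]
  omega

lemma tendsto_measure_compl_inter {A B : ℕ → Set Ω} (hA : Tendsto (fun n => P (A n)) atTop (𝓝 0))
    (hB : ∀ n, ∀ᵐ ω ∂P, ω ∈ B n) : Tendsto (fun n => P (B n \ A n)ᶜ) atTop (𝓝 0) := by
  refine tendsto_of_tendsto_of_tendsto_of_le_of_le tendsto_const_nhds hA (fun n => zero_le)
    fun n => measure_mono_ae ?_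
  filter_upwards [hB n] with ω hω hn
  by_contra hcon
  exact hn ⟨hω, hcon⟩

theorem isBigOInProb_surface (hs : 2 < s) (hlam : (3 * s - 2) / (s - 2) < lam) (hk : 1 ≤ k)
    (hmodel : ContaminationModel P W X e) (hWmeas : MeasurableCurves W)
    (hWmix : IsMixingSequence P W lam) (hWmom : BoundedMoments P W (2 * s))
    (hη : IsMeasurementError P η (2 * s)) (hU : IsLocationDesign P U) (hm : IsCountDesign P m ρ)
    (hindep : IsIndependentDesign P W U η m) (hK : IsSmoothingKernel K)
    {h : ℕ → ℝ} {Ct : ℕ → Ω → I → I → ℝ} (hh : ∀ n, 0 < h n) (hh0 : Tendsto h atTop (𝓝 0))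
    (hlog : Tendsto (fun n : ℕ => Real.log (n * ρ n ^ 2) /
      ((n * ρ n ^ 2) ^ thetaC s lam * h n ^ 2)) atTop (𝓝 0))
    (hC : IsC2Square (autocov P X k))
    (hfit : ∀ n ω u v, IsSurfaceFit K (h n) L k n (fun t => m n t ω) (fun t i => U t i ω)
      (obs W U η ω) u v (Ct n ω u v)) :
    IsBigOInProb P (fun n ω => eLpNorm
      (fun p : I × I => Ct n ω p.1 p.2 - autocov P X k p.1 p.2) 2 volume) (rateC ρ h) := by
  have hlam3 := three_lt_of_lt hs hlam
  obtain ⟨Cε, hCε, hε⟩ := exists_noiseSumBound_surface hs (by linarith) hk hmodel hWmeas hWmix hWmom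
    hη hU hm hindep hC
  obtain ⟨M, hM1, hρM, hmb⟩ := hm.exists_bounds
  have hM0 : 0 < M := by linarith
  obtain ⟨⟨Kb, hKb0, hKb⟩, α, δ, κ, hα, hδ, hα1, hκ, hKκ⟩ := hK.exists_bounds
  obtain ⟨T, hT, htay⟩ := hC.exists_taylor
  obtain ⟨-, b, -, hb, -, hwin⟩ := hU.exists_cell_window
  obtain ⟨c₁, hc₁, hbad⟩ := hU.tendsto_surface_cells L (thetaC_lt_one hs hlam) hδ
    (by positivity : 0 < 1 / M) hρM hh hk hlog
  have mobs := hWmeas.measurable_obs hWmix.measurable hU.measurable hη.measurable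
  have hρ := hm.pos
  -- `⌊M ρ⌋` locations per curve almost surely include all those observed. The constant `κ` comes
  -- from window counts with mean at most `z = M b ρ h`, for which `countSq z ^ 2 ≤ 2 z² + 2 z⁴`.
  refine hε.isBigOInProb (Q := I × I) (μ := volume) hCε (y := fun n => ρ n ^ 2 * h n ^ 2) (h := h)
    (c := κ ^ 2 / (9 * (1 + 4 / δ) ^ 2) * c₁) (κ := 2 * (M * b) ^ 2 + 2 * (M * b) ^ 4) (M := T)
    (B := Kb ^ 2) (J₁ := fun n q => window q.1 (h n)) (J₂ := fun n q => window q.2 (h n))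
    (R₁ := fun n => ⌊M * ρ n⌋₊) (R₂ := fun n => ⌊M * ρ n⌋₊)
    (F := fun n => Finset.Icc (1 : ℤ) ((n : ℤ) - L))
    (w := fun n => surfaceWeight K (h n) k) (x := fun n => surfaceFeature (h n) k)
    (fun a => ?_) hU.measurable hm.measurable hk
    (fun n => ?_) (by positivity) (by positivity) (by positivity) ?_ ?_
    (fun n => card_Icc_sub_le n L) (fun n q => ?_)
    (fun n a => measurable_surfaceWeight hK (h n) k a)
    (fun n a i => measurable_surfaceFeature (h n) k a i)
    (fun n q d a => surfaceWeight_le hK hKb (hh n) k q d a)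
    (fun n q d a i => surfaceWeight_mul_feature_le hK (hh n) k q d a i)
    (tendsto_measure_compl_inter hbad hmb) ?_
  · exact ((mobs _ _).mul (mobs _ _)).sub (hC.continuous.measurable.comp
      ((hU.measurable _ _).prodMk (hU.measurable _ _)))
  · have := hρ n
    have := hh n
    positivity
  · filter_upwards [eventually_gt_atTop 0] with n hn using rateC_pos hn
  · filter_upwards [eventually_gt_atTop 0] with n hn
    have hn0 : (0 : ℝ) < n := by exact_mod_cast hn
    rw [← mul_assoc]
    exact inv_add_le_rate hn0 (by positivity)
  · obtain ⟨p₁, l₁, hp₁⟩ := hwin q.1 (h n) (hh n)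
    obtain ⟨p₂, l₂, hp₂⟩ := hwin q.2 (h n) (hh n)
    refine ⟨p₁, p₂, l₁, l₂, ?_⟩
    have hρn := hρ n
    have hhn := hh n
    have n₁ := l₁.nonneg
    have n₂ := l₂.nonneg
    have hR : ((⌊M * ρ n⌋₊ : ℕ) : ℝ) ≤ M * ρ n := Nat.floor_le (by positivity)
    set z := M * b * (ρ n * h n) with hz
    have z0 : 0 ≤ z := by positivity
    have x₁ : (⌊M * ρ n⌋₊ : ℝ) * p₁ ≤ z := by
      calc _ ≤ M * ρ n * (b * h n) := by gcongr
        _ = z := by rw [hz]; ring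
    have x₂ : (⌊M * ρ n⌋₊ : ℝ) * p₂ ≤ z := by
      calc _ ≤ M * ρ n * (b * h n) := by gcongr
        _ = z := by rw [hz]; ring
    have e2 : z ^ 2 = (M * b) ^ 2 * (ρ n ^ 2 * h n ^ 2) := by rw [hz]; ring
    constructor
    · have h1 := mul_le_mul (countSq_mono (by positivity) x₁) (countSq_mono (by positivity) x₂)
        (by unfold countSq; positivity) (by unfold countSq; positivity)
      refine h1.trans ?_
      have h2 : countSq z * countSq z ≤ 2 * z ^ 2 + 2 * (z ^ 2) ^ 2 := by
        unfold countSq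
        nlinarith [sq_nonneg (z - z ^ 2)]
      refine h2.trans ?_
      rw [e2]
      have q0 : 0 ≤ (M * b) ^ 2 * (ρ n ^ 2 * h n ^ 2) ^ 2 := by positivity
      have q1 : 0 ≤ (M * b) ^ 4 * (ρ n ^ 2 * h n ^ 2) := by positivity
      nlinarith
    · have h1 := mul_le_mul x₁ x₂ (by positivity) z0
      refine h1.trans ?_
      rw [← sq, e2]
      gcongr
      have : 0 ≤ (M * b) ^ 4 := by positivity
      nlinarith [sq_nonneg (M * b)]
  · filter_upwards [hh0.eventually_le_const (by norm_num : (0 : ℝ) < 1 / 2), eventually_gt_atTop 0]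
      with n hn2 hn ω hω q
    have hn0 : (0 : ℝ) < n := by exact_mod_cast hn
    have hρn := hρ n
    have hhn := hh n
    obtain ⟨hmω, hcell⟩ := hω
    simp only [mem_ofPred_eq, not_exists, not_and, not_le] at hcell
    obtain ⟨b₁, b₂, hg⟩ := htay q.1 q.2
    -- Integer counts between `ρ n` and `M ρ n` lie between `⌈ρ n⌉` and `⌊M ρ n⌋`, which links the
    -- lower bound for the design to the index set of the noise sums.
    have key := surface_error_le hK hα hδ hα1 hκ hKκ hhn hn2 (fun x y => hg x y (h n))
      (r := ⌈ρ n⌉₊) (R := ⌊M * ρ n⌋₊) (fun t => Nat.ceil_le.2 (hmω t).1)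
      (fun t => Nat.le_floor (hmω t).2) (x := c₁ * (n * (ρ n ^ 2 * h n ^ 2))) (by positivity)
      hcell (hfit n ω q.1 q.2)
    rw [← mul_assoc (κ ^ 2 / (9 * (1 + 4 / δ) ^ 2)) c₁] at key
    exact key

theorem isBigOInProb_line (hs : 2 < s) (hlam : (3 * s - 2) / (s - 2) < lam) (hk : 1 ≤ k)
    (hmodel : ContaminationModel P W X e) (hWmeas : MeasurableCurves W)
    (hWmix : IsMixingSequence P W lam) (hWmom : BoundedMoments P W (2 * s))
    (hη : IsMeasurementError P η (2 * s)) (hU : IsLocationDesign P U) (hm : IsCountDesign P m ρ)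
    (hK : IsSmoothingKernel K) {h : ℕ → ℝ} {St : ℕ → Ω → I → ℝ} (hY : ∀ t, MemLp (Y t) 2 P)
    (hmix : IsMixingSequence P (fun t ω => (W t ω, Y t ω)) lam)
    (hindep : IsIndependentDesign P (fun t ω => (W t ω, Y t ω)) U η m)
    (hh : ∀ n, 0 < h n) (hh0 : Tendsto h atTop (𝓝 0))
    (hlog : Tendsto (fun n : ℕ => Real.log (n * ρ n) /
      ((n * ρ n) ^ thetaS s lam * h n)) atTop (𝓝 0))
    (hS : IsC2 (crosscov P Y W k))
    (hfit : ∀ n ω u, IsLineFit K (h n) L k n (fun t => m n t ω) (fun t i => U t i ω)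
      (obs W U η ω) (fun t => Y t ω) u (St n ω u)) :
    IsBigOInProb P (fun n ω => eLpNorm
      (fun u : I => St n ω u - crosscov P Y W k u) 2 volume) (rateS ρ h) := by
  have hlam3 := three_lt_of_lt hs hlam
  obtain ⟨Cε, hCε, hε⟩ := exists_noiseSumBound_line hs (by linarith) hk hmodel hWmeas hWmom hY hmix
    hη hU hm hindep hS
  obtain ⟨M, hM1, hρM, hmb⟩ := hm.exists_bounds
  have hM0 : 0 < M := by linarith
  obtain ⟨⟨Kb, hKb0, hKb⟩, α, δ, κ, hα, hδ, hα1, hκ, hKκ⟩ := hK.exists_bounds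
  obtain ⟨T, hT, htay⟩ := hS.exists_taylor
  obtain ⟨-, b, -, hb, -, hwin⟩ := hU.exists_cell_window
  obtain ⟨c₁, hc₁, hbad⟩ := hU.tendsto_line_cells (k := k) L (thetaS_lt_one hs hlam) hδ
    (by positivity : 0 < 1 / M) hρM hh hlog
  have mobs := hWmeas.measurable_obs hWmix.measurable hU.measurable hη.measurable
  have hρ := hm.pos
  refine hε.isBigOInProb (Q := I) (μ := volume) hCε (y := fun n => ρ n * h n) (h := h)
    (c := κ / (9 * (1 + 4 / δ) ^ 2) * c₁) (κ := 2 * (M * b) + 2 * (M * b) ^ 2) (M := T)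
    (B := Kb) (J₁ := fun _ _ => univ) (J₂ := fun n u => window u (h n))
    (R₁ := fun _ => 1) (R₂ := fun n => ⌊M * ρ n⌋₊)
    (F := fun n => Finset.Icc (1 : ℤ) ((n : ℤ) - L))
    (w := fun n => lineWeight K (h n) k) (x := fun n => lineFeature (h n) k)
    (fun a => ?_) hU.measurable hm.measurable hk
    (fun n => mul_pos (hρ n) (hh n)) (by positivity) (by positivity) hKb0.le ?_ ?_
    (fun n => card_Icc_sub_le n L) (fun n u => ?_)
    (fun n a => measurable_lineWeight hK (h n) k a)
    (fun n a i => measurable_lineFeature (h n) k a i)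
    (fun n u d a => lineWeight_le hK hKb (hh n) k u d a)
    (fun n u d a i => lineWeight_mul_feature_le hK (hh n) k u d a i)
    (tendsto_measure_compl_inter hbad hmb) ?_
  · exact ((measurable_snd.comp (hmix.measurable _)).mul (mobs _ _)).sub
      (hS.continuous.measurable.comp (hU.measurable _ _))
  · filter_upwards [eventually_gt_atTop 0] with n hn using rateS_pos hn
  · filter_upwards [eventually_gt_atTop 0] with n hn
    have hn0 : (0 : ℝ) < n := by exact_mod_cast hn
    have := hρ n
    have := hh n
    rw [← mul_assoc]
    exact inv_add_le_rate hn0 (by positivity)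
  · obtain ⟨p, l, hp⟩ := hwin u (h n) (hh n)
    refine ⟨1, p, locations_univ hU, l, ?_⟩
    have hρn := hρ n
    have hhn := hh n
    have n₁ := l.nonneg
    have hR : ((⌊M * ρ n⌋₊ : ℕ) : ℝ) ≤ M * ρ n := Nat.floor_le (by positivity)
    set v := ρ n * h n with hv
    have v0 : 0 ≤ v := by positivity
    have x₁ : (⌊M * ρ n⌋₊ : ℝ) * p ≤ M * b * v := by
      calc _ ≤ M * ρ n * (b * h n) := by gcongr
        _ = M * b * v := by rw [hv]; ring
    have q0 : 0 ≤ (M * b) ^ 2 * v := by positivity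
    have q1 : 0 ≤ M * b * v ^ 2 := by positivity
    have q2 : 0 ≤ M * b * v := by positivity
    constructor
    · have h1 := countSq_mono (by positivity) x₁
      -- The dummy first window contains exactly one location, with probability one; it contributes
      -- the factor `2` in `κ`.
      have e1 : countSq ((1 : ℕ) * 1) = 2 := by norm_num [countSq]
      rw [e1]
      unfold countSq at h1 ⊢
      nlinarith
    · rw [Nat.cast_one, one_mul, one_mul]
      nlinarith
  · filter_upwards [hh0.eventually_le_const (by norm_num : (0 : ℝ) < 1 / 2), eventually_gt_atTop 0]
      with n hn2 hn ω hω u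
    have hn0 : (0 : ℝ) < n := by exact_mod_cast hn
    have hρn := hρ n
    have hhn := hh n
    obtain ⟨hmω, hcell⟩ := hω
    simp only [mem_ofPred_eq, not_exists, not_and, not_le] at hcell
    obtain ⟨b₁, hg⟩ := htay u
    have key := line_error_le hK hα hδ hα1 hκ hKκ hhn hn2 (fun x => hg x (h n))
      (r := ⌈ρ n⌉₊) (R := ⌊M * ρ n⌋₊) (fun t => Nat.ceil_le.2 (hmω t).1)
      (fun t => Nat.le_floor (hmω t).2) (x := c₁ * (n * (ρ n * h n))) (by positivity)
      hcell (hfit n ω u)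
    rw [← mul_assoc (κ / (9 * (1 + 4 / δ) ^ 2)) c₁] at key
    exact key

end Main

end PartialCurve

end

theorem theorem3 {Ω : Type*} [MeasurableSpace Ω] (P : Measure Ω) [IsProbabilityMeasure P]
    (W X e : ℤ → Ω → I → ℝ) (Y : ℤ → Ω → ℝ)
    (U : ℤ → ℕ → Ω → I) (η : ℤ → ℕ → Ω → ℝ) (m : ℕ → ℤ → Ω → ℕ) (ρ : ℕ → ℝ)
    (K : ℝ → ℝ) (s lam : ℝ) (L k : ℕ)
    (hs : 2 < s) (hlam : (3 * s - 2) / (s - 2) < lam) (hk : 1 ≤ k) (hkL : k ≤ L)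
    (hmodel : PartialCurve.ContaminationModel P W X e)
    (hWmeas : PartialCurve.MeasurableCurves W)
    (hWmix : PartialCurve.IsMixingSequence P W lam)
    (hWmom : PartialCurve.BoundedMoments P W (2 * s))
    (hη : PartialCurve.IsMeasurementError P η (2 * s))
    (hU : PartialCurve.IsLocationDesign P U)
    (hm : PartialCurve.IsCountDesign P m ρ)
    (hindep : PartialCurve.IsIndependentDesign P W U η m)
    (hK : PartialCurve.IsSmoothingKernel K) :
    -- the autocovariance estimator
    (∀ (hC : ℕ → ℝ) (Ct : ℕ → Ω → I → I → ℝ),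
      (∀ n, 0 < hC n) → Tendsto hC atTop (𝓝 0) →
      Tendsto (fun n : ℕ => Real.log (n * ρ n ^ 2) /
        ((n * ρ n ^ 2) ^ PartialCurve.thetaC s lam * hC n ^ 2)) atTop (𝓝 0) →
      PartialCurve.IsC2Square (PartialCurve.autocov P X k) →
      (∀ n ω u v, PartialCurve.IsSurfaceFit K (hC n) L k n (fun t => m n t ω)
        (fun t i => U t i ω) (PartialCurve.obs W U η ω) u v (Ct n ω u v)) →
      PartialCurve.IsBigOInProb P
        (fun n ω => eLpNorm
          (fun p : I × I => Ct n ω p.1 p.2 - PartialCurve.autocov P X k p.1 p.2) 2 volume)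
        (PartialCurve.rateC ρ hC)) ∧
    -- the cross-covariance estimator
    (∀ (hS : ℕ → ℝ) (St : ℕ → Ω → I → ℝ),
      (∀ t, MemLp (Y t) 2 P) →
      PartialCurve.IsMixingSequence P (fun t ω => (W t ω, Y t ω)) lam →
      PartialCurve.IsIndependentDesign P (fun t ω => (W t ω, Y t ω)) U η m →
      (∀ n, 0 < hS n) → Tendsto hS atTop (𝓝 0) →
      Tendsto (fun n : ℕ => Real.log (n * ρ n) /
        ((n * ρ n) ^ PartialCurve.thetaS s lam * hS n)) atTop (𝓝 0) →
      PartialCurve.IsC2 (PartialCurve.crosscov P Y W k) →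
      (∀ n ω u, PartialCurve.IsLineFit K (hS n) L k n (fun t => m n t ω)
        (fun t i => U t i ω) (PartialCurve.obs W U η ω) (fun t => Y t ω) u (St n ω u)) →
      PartialCurve.IsBigOInProb P
        (fun n ω => eLpNorm
          (fun u : I => St n ω u - PartialCurve.crosscov P Y W k u) 2 volume)
        (PartialCurve.rateS ρ hS)) :=
  ⟨fun _ _ hh hh0 hlog hC hfit => PartialCurve.isBigOInProb_surface hs hlam hk hmodel hWmeas hWmix
    hWmom hη hU hm hindep hK hh hh0 hlog hC hfit,
  fun _ _ hY hmix hindep' hh hh0 hlog hS hfit => PartialCurve.isBigOInProb_line hs hlam hk hmodel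
    hWmeas hWmix hWmom hη hU hm hK hY hmix hindep' hh hh0 hlog hS hfit⟩
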